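/- Let $\Pi$ be the homotopy category of pointed spaces having the homotopy type of a finite (possibly empty) wedge of spheres of positive dimensions, and for $0\le a$, $b\le\infty$ let $\Pi_a^b\subseteq\Pi$ be the full subcategory of wedges of spheres of dimensions $i$ with $a\le i\le b$. Let $\Pi\mathrm{Alg}_a^b$ be the category of functors $(\Pi_a^b)^{\mathrm{op}}\to\mathrm{Set}$ that send wedges to products, and $\Pi\mathrm{Alg}=\Pi\mathrm{Alg}_1^\infty$ the category of $\Pi$-algebras. A $\Pi$-algebra $A$ is $m$-connected if $A(S^i)=*$ for all $i\le m$, and $n$-truncated if $A(S^i)=*$ for all $i>n$. Let $P_n\colon \Pi\mathrm{Alg}_a^\infty\to\Pi\mathrm{Alg}_a^n$ and $C_m\colon\Pi\mathrm{Alg}_1^b\to\Pi\mathrm{Alg}_{m+1}^b$ be the restriction functors, so that $C_mP_n=P_nC_m$. For $X$ in $\mathcal C=\Pi\mathrm{Alg}_a^b$, a module over $X$ is an abelian group object $M\to X$ in $\mathcal C/X$, and $$\mathrm{HQ}^q_{\mathcal C}(X;M)=\pi^q\,\mathrm{Hom}_{\mathcal C/X}(C_\bullet,M),\qquad q\ge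 0,$$ where $C_\bullet\to X$ is a cofibrant replacement in simplicial objects of $\mathcal C$ (weak equivalences and fibrations are those of the underlying simplicial sets at each sphere). A module is $n$-truncated if its kernel (the fibre over the trivial element) at $S^i$ is trivial for all $i>n$. **Proposition.** Let $m,n\ge 0$. (1) For $a\in\{1,m+1\}$, $P_n\colon \Pi\mathrm{Alg}_a^\infty\to\Pi\mathrm{Alg}_a^n$ is left adjoint to a fully faithful functor $\iota$ whose essential image consists of the $n$-truncated objects. For $b\in\{n,\infty\}$, $C_m\colon\Pi\mathrm{Alg}_1^b\to\Pi\mathrm{Alg}_{m+1}^b$ is right adjoint to a fully faithful functor $\iota$ whose essential image consists of the $m$-connected objects. (Thus $\Pi\mathrm{Alg}_1^n$, $\Pi\mathrm{Alg}_{m+1}^\infty$, $\Pi\mathrm{Alg}_{m+1}^n$ are identified with the full subcategories of $n$-truncated, $m$-connected, and $m$-connected $n$-truncated $\Pi$-algebras; we suppress $\iota$.) (2) Let $A$ be an $m$-connected $\Pi$-algebra and $M$ a module over $A$ that is $n$-truncated. Cofibrant replacements of $A$, $P_nA$, $C_mA$, $P_nC_mA$ exist in the respective categories. For all choices of these and all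 $q\ge0$, the comparison maps $$\begin{array}{ccc} \mathrm{HQ}^q_{\Pi\mathrm{Alg}_1^n}(P_nA;P_nM)&\xrightarrow{\ \cong\ }&\mathrm{HQ}^q_{\Pi\mathrm{Alg}}(A;M)\\ \downarrow{\scriptstyle\cong}&&\downarrow{\scriptstyle\cong}\\ \mathrm{HQ}^q_{\Pi\mathrm{Alg}_{m+1}^n}(P_nC_mA;C_mP_nM)&\xrightarrow{\ \cong\ }&\mathrm{HQ}^q_{\Pi\mathrm{Alg}_{m+1}^\infty}(C_mA;C_mM) \end{array}$$ exist, are uniquely determined and are isomorphisms, and the square commutes. Here the horizontal (truncation) map is the map $\mathrm{Hom}(C'_\bullet,P_nM)\to\mathrm{Hom}(P_nC_\bullet,P_nM)\cong\mathrm{Hom}(C_\bullet,M)$ induced by any comparison $P_nC_\bullet\to C'_\bullet$ of cofibrant replacements over $P_nA$ (and likewise over $P_nC_mA$), and the vertical (connected cover) map is the map $\mathrm{Hom}(C_\bullet,M)\to\mathrm{Hom}(C_mC_\bullet,C_mM)\to\mathrm{Hom}(C''_\bullet,C_mM)$ induced by any comparison $C''_\bullet\to C_mC_\bullet$ over $C_mA$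 (and likewise over $C_mP_nA$). (3) Let $A$ be $m$-connected and $n$-truncated and $k\ge1$. There is a module $\Omega^kA$ over $A$ whose underlying object over $A$ is $U\mapsto A\big((S^k)_+\wedge U\big)\to A(U)$ with zero section induced by the projection $(S^k)_+\wedge U\to U$. Every such module is $j$-truncated for $j=\max(n-k,0)$, and the square in (2), for $j$ in place of $n$ and $M=\Omega^kA$, yields isomorphisms for all $q\ge 0$ $$\mathrm{HQ}^q_{\Pi\mathrm{Alg}}(A;\Omega^kA)\;\cong\;\mathrm{HQ}^q_{\Pi\mathrm{Alg}_{m+1}^{j}}(P_jA;C_m\Omega^kA),$$ where on the right $P_jA$ and $C_m\Omega^kA$ stand for $P_jC_mA$ and $P_jC_m\Omega^kA$: the composites of the inverse of the truncation map and the connected cover map, along either side of the square. -/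

import Mathlib

open CategoryTheory Opposite

noncomputable section

namespace PiAlgebra

/-! ### The pointed homotopy category -/

/-- A pointed topological space. -/
structure PtdSpace : Type 1 where
  carrier : Type
  [top : TopologicalSpace carrier]
  pt : carrier

attribute [instance] PtdSpace.top

/-- Pointed continuous maps. -/
def PtdMap (X Y : PtdSpace) : Type := {f : C(X.carrier, Y.carrier) // f X.pt = Y.pt}

/-- Pointed homotopy, i.e. homotopy relative to the base point. -/
instance ptdHomotopy (X Y : PtdSpace) : Setoid (PtdMap X Y) where
  r f g := ContinuousMap.HomotopicRel f.1 g.1 {X.pt}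
  iseqv :=
    ⟨fun _ => ContinuousMap.HomotopicRel.refl _, fun h => h.symm, fun h h' => h.trans h'⟩

def PtdMap.id (X : PtdSpace) : PtdMap X X := ⟨ContinuousMap.id _, rfl⟩

def PtdMap.comp {X Y Z : PtdSpace} (f : PtdMap X Y) (g : PtdMap Y Z) : PtdMap X Z :=
  ⟨g.1.comp f.1, by rw [ContinuousMap.comp_apply, f.2, g.2]⟩

theorem PtdMap.comp_congr {X Y Z : PtdSpace} {f f' : PtdMap X Y} (hf : f ≈ f')
    {g g' : PtdMap Y Z} (hg : g ≈ g') : f.comp g ≈ f'.comp g' := by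
  obtain ⟨F⟩ := hf
  obtain ⟨G⟩ := hg
  refine ⟨⟨⟨⟨fun p => G (p.1, F p), by fun_prop⟩, ?_, ?_⟩, ?_⟩⟩
  · intro x; simp [PtdMap.comp]
  · intro x; simp [PtdMap.comp]
  · intro t x hx
    have hx' : x = X.pt := hx
    subst hx'
    have h1 : F (t, X.pt) = Y.pt := (F.eq_fst t rfl).trans f.2
    have h2 : G (t, Y.pt) = Z.pt := (G.eq_fst t rfl).trans g.2
    simp only [ContinuousMap.coe_mk, PtdMap.comp, ContinuousMap.comp_apply]
    rw [h1, h2, f.2, g.2]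

/-- The homotopy category of pointed spaces: morphisms are pointed homotopy classes. -/
instance : Category PtdSpace where
  Hom X Y := Quotient (ptdHomotopy X Y)
  id X := ⟦PtdMap.id X⟧
  comp f g := Quotient.map₂ PtdMap.comp (fun _ _ hf _ _ hg => PtdMap.comp_congr hf hg) f g
  id_comp f := by induction f using Quotient.inductionOn; rfl
  comp_id f := by induction f using Quotient.inductionOn; rfl
  assoc f g h := by
    induction f using Quotient.inductionOn
    induction g using Quotient.inductionOn
    induction h using Quotient.inductionOn
    rfl

/-- The pointed homotopy class of a pointed map. -/
def PtdMap.toHom {X Y : PtdSpace} (f : PtdMap X Y) : X ⟶ Y := Quotient.mk (ptdHomotopy X Y) f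

/-- The unit sphere `S^k` of `ℝ^(k+1)`, pointed at the first vector of the standard basis. -/
def sphere (k : ℕ) : PtdSpace where
  carrier := Metric.sphere (0 : EuclideanSpace ℝ (Fin (k + 1))) 1
  pt := ⟨EuclideanSpace.single 0 1, by simp⟩

/-- The relation on `* ⊔ ∐ X i` that identifies all the base points. -/
inductive WedgeRel {ι : Type} (X : ι → PtdSpace) :
    PUnit.{1} ⊕ (Σ i, (X i).carrier) → PUnit.{1} ⊕ (Σ i, (X i).carrier) → Prop
  | glue (i : ι) : WedgeRel X (Sum.inl PUnit.unit) (Sum.inr ⟨i, (X i).pt⟩)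

/-- The wedge of a family of pointed spaces (a point if the family is empty). -/
def wedge {ι : Type} (X : ι → PtdSpace) : PtdSpace where
  carrier := Quot (WedgeRel X)
  pt := Quot.mk _ (Sum.inl PUnit.unit)

/-- The relation on `S^k × X` that identifies all the points `(s, *)`. -/
inductive HalfSmashRel (k : ℕ) (X : PtdSpace) :
    (sphere k).carrier × X.carrier → (sphere k).carrier × X.carrier → Prop
  | collapse (s t : (sphere k).carrier) : HalfSmashRel k X (s, X.pt) (t, X.pt)

/-- The half-smash product `(S^k)₊ ∧ X = (S^k × X) / (S^k × *)`. -/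
def halfSmash (k : ℕ) (X : PtdSpace) : PtdSpace where
  carrier := Quot (HalfSmashRel k X)
  pt := Quot.mk _ ((sphere k).pt, X.pt)

/-- The pointed map `(S^k)₊ ∧ f`. -/
def halfSmashMap (k : ℕ) {X Y : PtdSpace} (f : PtdMap X Y) :
    PtdMap (halfSmash k X) (halfSmash k Y) :=
  ⟨⟨Quot.map (fun p => (p.1, f.1 p.2)) (by
      rintro _ _ ⟨s, t⟩
      simp only [f.2]
      exact HalfSmashRel.collapse s t),
    continuous_quot_lift _ (continuous_quot_mk.comp (by fun_prop))⟩,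
    congrArg (fun y => Quot.mk _ ((sphere k).pt, y)) f.2⟩

theorem halfSmashMap_congr (k : ℕ) {X Y : PtdSpace} {f g : PtdMap X Y} (h : f ≈ g) :
    halfSmashMap k f ≈ halfSmashMap k g := by
  obtain ⟨F⟩ := h
  let Φ : C((sphere k).carrier × X.carrier, C(unitInterval, (halfSmash k Y).carrier)) :=
    ContinuousMap.curry ⟨fun p => Quot.mk _ (p.1.1, F (p.2, p.1.2)),
      continuous_quot_mk.comp (by fun_prop)⟩
  have hΦ : ∀ p p', HalfSmashRel k X p p' → Φ p = Φ p' := by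
    rintro _ _ ⟨s, t⟩
    ext τ
    have e : F (τ, X.pt) = Y.pt := (F.eq_fst τ rfl).trans f.2
    change (Quot.mk _ (s, F (τ, X.pt)) : Quot (HalfSmashRel k Y)) = Quot.mk _ (t, F (τ, X.pt))
    rw [e]
    exact Quot.sound (HalfSmashRel.collapse s t)
  let Ψ : C((halfSmash k X).carrier, C(unitInterval, (halfSmash k Y).carrier)) :=
    ⟨Quot.lift Φ hΦ, continuous_quot_lift _ Φ.continuous⟩
  refine ⟨⟨⟨Ψ.uncurry.comp ⟨Prod.swap, continuous_swap⟩, ?_, ?_⟩, ?_⟩⟩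
  · rintro ⟨s, x⟩
    exact congrArg (fun y => Quot.mk _ (s, y)) (F.apply_zero x)
  · rintro ⟨s, x⟩
    exact congrArg (fun y => Quot.mk _ (s, y)) (F.apply_one x)
  · intro τ x hx
    have hx' : x = (halfSmash k X).pt := hx
    subst hx'
    exact congrArg (fun y => Quot.mk _ ((sphere k).pt, y)) (F.eq_fst τ rfl)

/-- `(S^k)₊ ∧ -` as an endofunctor of the pointed homotopy category. -/
def halfSmashFunctor (k : ℕ) : PtdSpace ⥤ PtdSpace where
  obj X := halfSmash k X
  map {X Y} f := Quotient.map (halfSmashMap k) (fun _ _ h => halfSmashMap_congr k h) f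
  map_id X := by
    refine congrArg (Quotient.mk (ptdHomotopy _ _)) (Subtype.ext (ContinuousMap.ext ?_))
    rintro ⟨p⟩
    rfl
  map_comp f g := by
    induction f using Quotient.inductionOn
    induction g using Quotient.inductionOn
    refine congrArg (Quotient.mk (ptdHomotopy _ _)) (Subtype.ext (ContinuousMap.ext ?_))
    rintro ⟨p⟩
    rfl

/-- The inclusion `X ⟶ (S^k)₊ ∧ X` at the base point of `S^k`. -/
def halfSmashIncl (k : ℕ) (X : PtdSpace) : X ⟶ halfSmash k X :=
  PtdMap.toHom ⟨⟨fun x => Quot.mk _ ((sphere k).pt, x), continuous_quot_mk.comp (by fun_prop)⟩, rfl⟩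

/-- The projection `(S^k)₊ ∧ X ⟶ X` that forgets the point of `S^k`. -/
def halfSmashProj (k : ℕ) (X : PtdSpace) : halfSmash k X ⟶ X :=
  PtdMap.toHom ⟨⟨Quot.lift Prod.snd (by rintro _ _ ⟨s, t⟩; rfl),
    continuous_quot_lift _ continuous_snd⟩, rfl⟩

/-! ### The category `Π` and its subcategories `Π_a^b` -/

/-- The positive dimensions `i` with `a ≤ i ≤ b`. -/
def Dim (a : ℕ) (b : ℕ∞) : Type := {i : ℕ // 1 ≤ i ∧ a ≤ i ∧ (i : ℕ∞) ≤ b}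

/-- The objects of `Π_a^b`: finite (possibly empty) wedges of spheres of positive dimensions in
`[a, b]`, each given by the list of its dimensions. With pointed homotopy classes of all pointed
maps as morphisms (below), `Π = Π_1^∞` is a full subcategory of the homotopy category of
pointed spaces that meets every homotopy type of a finite wedge of spheres; so it is equivalent to
the full subcategory of all pointed spaces that have the homotopy type of such a wedge, and it
has the same product-preserving presheaves. -/
structure SphereWedge (a : ℕ) (b : ℕ∞) : Type where
  card : ℕ
  dim : Fin card → Dim a b

namespace SphereWedge

variable {a : ℕ} {b : ℕ∞}

/-- The wedge of spheres itself. -/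
def space (U : SphereWedge a b) : PtdSpace := wedge fun j => PiAlgebra.sphere (U.dim j).1

instance : Category (SphereWedge a b) where
  Hom U V := U.space ⟶ V.space
  id U := 𝟙 U.space
  comp f g := CategoryStruct.comp (obj := PtdSpace) f g
  id_comp f := Category.id_comp (obj := PtdSpace) f
  comp_id f := Category.comp_id (obj := PtdSpace) f
  assoc f g h := Category.assoc (obj := PtdSpace) f g h

/-- `Π_a^b` as a full subcategory of the pointed homotopy category. -/
def toPtd (a : ℕ) (b : ℕ∞) : SphereWedge a b ⥤ PtdSpace where
  obj U := U.space
  map f := f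

/-- The sphere `S^d`, as a wedge with one summand. -/
def sphere (d : Dim a b) : SphereWedge a b := ⟨1, fun _ => d⟩

/-- The point, as the empty wedge. -/
def point (a : ℕ) (b : ℕ∞) : SphereWedge a b := ⟨0, Fin.elim0⟩

/-- The constant map to the point. -/
def toPoint (U : SphereWedge a b) : U ⟶ point a b :=
  PtdMap.toHom (X := U.space) (Y := (point a b).space)
    ⟨⟨fun _ => (point a b).space.pt, continuous_const⟩, rfl⟩

/-- The inclusion of the `j`-th summand. -/
def summand (U : SphereWedge a b) (j : Fin U.card) : sphere (U.dim j) ⟶ U :=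
  PtdMap.toHom (X := (sphere (U.dim j)).space) (Y := U.space)
    ⟨⟨Quot.map (Sum.map id fun x => ⟨j, x.2⟩) (by rintro _ _ ⟨i⟩; exact WedgeRel.glue j),
      continuous_quot_lift _ (continuous_quot_mk.comp
        (Continuous.sumMap continuous_id
          (continuous_sigma fun _ => continuous_sigmaMk
            (σ := fun i => (PiAlgebra.sphere (U.dim i).1).carrier) (i := j))))⟩, rfl⟩

/-- The inclusion of `Π_a'^b'` into `Π_a^b` for a smaller range of dimensions `[a', b']`. -/
def widen {a' : ℕ} {b' : ℕ∞} (ha : a ≤ a') (hb : b' ≤ b) :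
    SphereWedge a' b' ⥤ SphereWedge a b where
  obj U := ⟨U.card, fun j => ⟨(U.dim j).1, (U.dim j).2.1, ha.trans (U.dim j).2.2.1,
    (U.dim j).2.2.2.trans hb⟩⟩
  map f := f

end SphereWedge

/-! ### `Π`-algebras -/

/-- A presheaf on `Π_a^b` sends wedges to products: `A(⋁ S^{d_j}) → ∏ A(S^{d_j})` is bijective. -/
def SendsWedgesToProducts (a : ℕ) (b : ℕ∞) :
    ObjectProperty ((SphereWedge a b)ᵒᵖ ⥤ Type) := fun A =>
  ∀ U : SphereWedge a b, Function.Bijective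
    fun (x : A.obj (op U)) (j : Fin U.card) => A.map (U.summand j).op x

/-- `ΠAlg_a^b`: the product-preserving functors `(Π_a^b)ᵒᵖ ⥤ Set`. In particular `PiAlg 1 ⊤` is the
category of all `Π`-algebras. -/
abbrev PiAlg (a : ℕ) (b : ℕ∞) : Type 1 := (SendsWedgesToProducts a b).FullSubcategory

section

variable {a : ℕ} {b : ℕ∞}

/-- `A` is `m`-connected: `A(S^i) = *` for `i ≤ m`. -/
def IsConnected (m : ℕ) (A : PiAlg a b) : Prop :=
  ∀ d : Dim a b, d.1 ≤ m → Subsingleton (A.obj.obj (op (SphereWedge.sphere d)))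

/-- `A` is `n`-truncated: `A(S^i) = *` for `i > n`. -/
def IsTruncated (n : ℕ) (A : PiAlg a b) : Prop :=
  ∀ d : Dim a b, n < d.1 → Subsingleton (A.obj.obj (op (SphereWedge.sphere d)))

/-- Restriction of algebras along the inclusion of `Π_a'^b'` into `Π_a^b`. -/
def restriction {a' : ℕ} {b' : ℕ∞} (ha : a ≤ a') (hb : b' ≤ b) : PiAlg a b ⥤ PiAlg a' b' where
  obj A := ⟨(SphereWedge.widen ha hb).op ⋙ A.obj,
    fun U => A.property ((SphereWedge.widen ha hb).obj U)⟩
  map f := ObjectProperty.homMk (Functor.whiskerLeft (SphereWedge.widen ha hb).op f.hom)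

/-- The Postnikov truncation `P_n`. -/
def truncation (a n : ℕ) : PiAlg a ⊤ ⥤ PiAlg a n := restriction le_rfl le_top

/-- The connected cover `C_m`. -/
def cover (m : ℕ) (b : ℕ∞) : PiAlg 1 b ⥤ PiAlg (m + 1) b :=
  restriction (Nat.le_add_left 1 m) le_rfl

/-- `R` is left adjoint to a fully faithful functor whose essential image consists of the objects
with property `P`: that is, `R` is the reflection onto the full subcategory of these objects. -/
def IsReflectionOnto {C D : Type 1} [Category.{0} C] [Category.{0} D] (R : C ⥤ D)
    (P : C → Prop) : Prop :=
  ∃ ι : D ⥤ C, Nonempty (R ⊣ ι) ∧ ι.Full ∧ ι.Faithful ∧ ∀ X, ι.essImage X ↔ P X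

/-- `R` is right adjoint to a fully faithful functor whose essential image consists of the objects
with property `P`: that is, `R` is the coreflection onto the full subcategory of these objects. -/
def IsCoreflectionOnto {C D : Type 1} [Category.{0} C] [Category.{0} D] (R : C ⥤ D)
    (P : C → Prop) : Prop :=
  ∃ ι : D ⥤ C, Nonempty (ι ⊣ R) ∧ ι.Full ∧ ι.Faithful ∧ ∀ X, ι.essImage X ↔ P X

/-! ### Beck modules and derivations -/

/-- The fibre of `p : E ⟶ A` over `x ∈ A(U)`. -/
def Fiber {E A : PiAlg a b} (p : E ⟶ A) (U : SphereWedge a b) (x : A.obj.obj (op U)) : Type :=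
  {e : E.obj.obj (op U) // p.hom.app (op U) e = x}

/-- The map of fibres induced by `f : U ⟶ V`. -/
def Fiber.map {E A : PiAlg a b} (p : E ⟶ A) {U V : SphereWedge a b} (f : U ⟶ V)
    {x : A.obj.obj (op V)} (e : Fiber p V x) : Fiber p U (A.obj.map f.op x) :=
  ⟨E.obj.map f.op e.1, by rw [NatTrans.naturality_apply, e.2]⟩

/-- A Beck module over `A`: an abelian group object in the slice category over `A`. Since the
products in this slice category are the objectwise fibre products over `A`, such a group
structure on `p : E ⟶ A` amounts to an abelian group structure on every fibre of `E(U) → A(U)`,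
natural in `U`. -/
structure BeckModule (A : PiAlg a b) where
  total : PiAlg a b
  proj : total ⟶ A
  group (U : SphereWedge a b) (x : A.obj.obj (op U)) : AddCommGroup (Fiber proj U x)
  map_add {U V : SphereWedge a b} (f : U ⟶ V) {x : A.obj.obj (op V)} (e e' : Fiber proj V x) :
    Fiber.map proj f (e + e') = Fiber.map proj f e + Fiber.map proj f e'

attribute [instance] BeckModule.group

namespace BeckModule

variable {A : PiAlg a b}

/-- The underlying object `U_A M` of the slice category. -/
def toOver (M : BeckModule A) : Over A := Over.mk M.proj

/-- The kernel of `M` at `S^d`: the fibre over the trivial element of `A(S^d)`, which is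
the image of the only element `z` of `A(*)`. The module is `n`-truncated if it vanishes for
`d > n`. -/
def IsTruncated (n : ℕ) (M : BeckModule A) : Prop :=
  ∀ d : Dim a b, n < d.1 → ∀ z : A.obj.obj (op (SphereWedge.point a b)),
    Subsingleton (Fiber M.proj (SphereWedge.sphere d)
      (A.obj.map (SphereWedge.sphere d).toPoint.op z))

/-- Restriction of modules along the inclusion of `Π_a'^b'` into `Π_a^b`. -/
def restrict {a' : ℕ} {b' : ℕ∞} (ha : a ≤ a') (hb : b' ≤ b) (M : BeckModule A) :
    BeckModule ((restriction ha hb).obj A) where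
  total := (restriction ha hb).obj M.total
  proj := (restriction ha hb).map M.proj
  group U x := M.group ((SphereWedge.widen ha hb).obj U) x
  map_add {U V} f {x} e e' := M.map_add (U := (SphereWedge.widen ha hb).obj U)
    (V := (SphereWedge.widen ha hb).obj V) f (x := x) e e'

end BeckModule

namespace BeckModule

variable {A : PiAlg a b} (M : BeckModule A)

/-- The restriction map of fibres as a group homomorphism. -/
def mapHom {U V : SphereWedge a b} (f : U ⟶ V) (x : A.obj.obj (op V)) :
    Fiber M.proj V x →+ Fiber M.proj U (A.obj.map f.op x) :=
  AddMonoidHom.mk' (Fiber.map M.proj f) (M.map_add f)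

theorem add_congr {U : SphereWedge a b} {x x' : A.obj.obj (op U)} (h : x = x')
    {e₁ e₂ : Fiber M.proj U x} {e₁' e₂' : Fiber M.proj U x'}
    (h₁ : e₁.1 = e₁'.1) (h₂ : e₂.1 = e₂'.1) : (e₁ + e₂).1 = (e₁' + e₂').1 := by
  subst h
  rw [Subtype.ext h₁, Subtype.ext h₂]

theorem neg_congr {U : SphereWedge a b} {x x' : A.obj.obj (op U)} (h : x = x')
    {e : Fiber M.proj U x} {e' : Fiber M.proj U x'} (h₁ : e.1 = e'.1) : (-e).1 = (-e').1 := by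
  subst h
  rw [Subtype.ext h₁]

theorem zero_congr {U : SphereWedge a b} {x x' : A.obj.obj (op U)} (h : x = x') :
    (0 : Fiber M.proj U x).1 = (0 : Fiber M.proj U x').1 := by
  subst h
  rfl

/-- The value of a morphism `f : Y ⟶ M` over `A` at `y ∈ Y(U)`, as an element of a fibre of `M`. -/
def value {Y : Over A} (f : Y ⟶ M.toOver) (U : SphereWedge a b) (y : Y.left.obj.obj (op U)) :
    Fiber M.proj U (Y.hom.hom.app (op U) y) :=
  ⟨f.left.hom.app (op U) y, by
    have h : f.left ≫ M.proj = Y.hom := Over.w f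
    rw [← h]
    rfl⟩

theorem base_naturality (Y : Over A) {U V : SphereWedge a b} (f : U ⟶ V)
    (y : Y.left.obj.obj (op V)) :
    Y.hom.hom.app (op U) (Y.left.obj.map f.op y) = A.obj.map f.op (Y.hom.hom.app (op V) y) :=
  NatTrans.naturality_apply Y.hom.hom f.op y

/-- The natural families `y ↦ s(y)` with `s(y)` in the fibre of `M` under `y`, as a group under
addition of values. -/
def families (Y : Over A) :
    AddSubgroup (∀ (U : SphereWedge a b) (y : Y.left.obj.obj (op U)),
      Fiber M.proj U (Y.hom.hom.app (op U) y)) where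
  carrier := {s | ∀ (U V : SphereWedge a b) (f : U ⟶ V) (y : Y.left.obj.obj (op V)),
    (s U (Y.left.obj.map f.op y)).1 = (Fiber.map M.proj f (s V y)).1}
  zero_mem' U V f y := by
    refine (M.zero_congr (base_naturality Y f y)).trans ?_
    exact congrArg Subtype.val (M.mapHom f _).map_zero.symm
  add_mem' {s t} hs ht U V f y := by
    refine (M.add_congr (base_naturality Y f y) (hs U V f y) (ht U V f y)).trans ?_
    exact congrArg Subtype.val ((M.mapHom f _).map_add (s V y) (t V y)).symm
  neg_mem' {s} hs U V f y := by
    refine (M.neg_congr (base_naturality Y f y) (hs U V f y)).trans ?_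
    exact congrArg Subtype.val ((M.mapHom f _).map_neg (s V y)).symm

/-- A morphism `Y ⟶ M` over `A` is the same as a natural family of elements of the fibres. -/
def homEquiv (Y : Over A) : (Y ⟶ M.toOver) ≃ M.families Y where
  toFun f := ⟨M.value f, fun U V g y =>
    (NatTrans.naturality_apply f.left.hom g.op y :
      f.left.hom.app (op U) (Y.left.obj.map g.op y) =
        M.total.obj.map g.op (f.left.hom.app (op V) y))⟩
  invFun s := Over.homMk
    (ObjectProperty.homMk
      { app := fun U => TypeCat.ofHom fun y => (s.1 U.unop y).1
        naturality := fun V U g => by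
          ext y
          exact s.2 U.unop V.unop g.unop y })
    (by
      ext U y
      exact (s.1 U.unop y).2)
  left_inv f := by ext; rfl
  right_inv s := by ext; rfl

/-- The group structure on `Hom(Y, M)` over `A`: pointwise addition in the fibres of `M`. -/
instance homGroup (Y : Over A) : AddCommGroup (Y ⟶ M.toOver) := (M.homEquiv Y).addCommGroup

theorem value_add {Y : Over A} (f g : Y ⟶ M.toOver) (U : SphereWedge a b)
    (y : Y.left.obj.obj (op U)) : M.value (f + g) U y = M.value f U y + M.value g U y := by
  have h : M.homEquiv Y (f + g) = M.homEquiv Y f + M.homEquiv Y g :=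
    (M.homEquiv Y).apply_symm_apply _
  exact congrFun (congrFun (congrArg Subtype.val h) U) y

theorem hom_ext {Y : Over A} {f g : Y ⟶ M.toOver}
    (h : ∀ U y, (M.value f U y).1 = (M.value g U y).1) : f = g := by
  apply (M.homEquiv Y).injective
  apply Subtype.ext
  funext U y
  exact Subtype.ext (h U y)

/-- The functor of derivations `Hom(-, M)` from the slice category over `A` to abelian groups. -/
def derivations : (Over A)ᵒᵖ ⥤ AddCommGrpCat.{0} where
  obj Y := AddCommGrpCat.of (Y.unop ⟶ M.toOver)
  map {Y Z} h := AddCommGrpCat.ofHom <| AddMonoidHom.mk' (fun f => h.unop ≫ f) fun f g => by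
    apply M.hom_ext
    intro U y
    have e : Z.unop.hom.hom.app (op U) y =
        Y.unop.hom.hom.app (op U) (h.unop.left.hom.app (op U) y) := by
      rw [← Over.w h.unop]
      rfl
    rw [M.value_add]
    refine Eq.trans (b := (M.value (f + g) U (h.unop.left.hom.app (op U) y)).1) rfl ?_
    rw [M.value_add]
    exact M.add_congr e.symm rfl rfl

/-- Restriction of a morphism `Y ⟶ M` over `A` along the inclusion of `Π_a'^b'` into `Π_a^b`. -/
def restrictHom {a' : ℕ} {b' : ℕ∞} (ha : a ≤ a') (hb : b' ≤ b) {Y : Over A}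
    (f : Y ⟶ M.toOver) :
    (Over.post (restriction ha hb)).obj Y ⟶ (M.restrict ha hb).toOver :=
  (Over.post (restriction ha hb)).map f

/-- Restriction of derivations along the inclusion of `Π_a'^b'` into `Π_a^b`. -/
def restrictDerivations {a' : ℕ} {b' : ℕ∞} (ha : a ≤ a') (hb : b' ≤ b) :
    M.derivations ⟶ (Over.post (restriction ha hb)).op ⋙ (M.restrict ha hb).derivations where
  app Y := AddCommGrpCat.ofHom <|
    AddMonoidHom.mk' (fun f => M.restrictHom ha hb f) fun f g => by
      apply (M.restrict ha hb).hom_ext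
      intro U y
      rw [(M.restrict ha hb).value_add]
      exact congrArg Subtype.val (M.value_add f g ((SphereWedge.widen ha hb).obj U) y)
  naturality Y Z h := by
    ext f
    exact (Over.post (restriction ha hb)).map_comp h.unop f

end BeckModule

/-! ### Simplicial `Π`-algebras and Quillen cohomology -/

/-- Evaluation of algebras at an object of `Π_a^b`. -/
def evaluation (U : SphereWedge a b) : PiAlg a b ⥤ Type :=
  (SendsWedgesToProducts a b).ι ⋙ (CategoryTheory.evaluation _ _).obj (op U)

/-- The acyclic fibrations of the standard model structure on simplicial algebras: the
underlying maps of simplicial sets `X(S^d) ⟶ Y(S^d)` are acyclic Kan fibrations, i.e. have the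
right lifting property against the inclusions of the boundaries of the standard simplices. -/
def IsAcyclicFibration {X Y : SimplicialObject (PiAlg a b)} (f : X ⟶ Y) : Prop :=
  ∀ d : Dim a b, SSet.modelCategoryQuillen.I.{0}.rlp
    (((SimplicialObject.whiskering _ _).obj (evaluation (SphereWedge.sphere d))).map f)

/-- Cofibrant simplicial algebras: the map from the initial object has the left lifting property
against the acyclic fibrations. -/
def IsCofibrant (C : SimplicialObject (PiAlg a b)) : Prop :=
  ∀ ⦃X Y : SimplicialObject (PiAlg a b)⦄ (p : X ⟶ Y), IsAcyclicFibration p →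
    ∀ g : C ⟶ Y, ∃ l : C ⟶ X, l ≫ p = g

/-- For a simplicial object `C` over `A`, the underlying map from `C` to the constant simplicial
object `A`. -/
def augmentation {A : PiAlg a b} (C : SimplicialObject (Over A)) :
    ((SimplicialObject.whiskering _ _).obj (Over.forget A)).obj C ⟶
      (SimplicialObject.const (PiAlg a b)).obj A where
  app i := (C.obj i).hom
  naturality _ _ f := (Over.w (C.map f)).trans (Category.comp_id _).symm

/-- A cofibrant replacement of `A` in simplicial algebras: a cofibrant object with an acyclic
fibration to the constant object `A`. (A weak equivalence to a constant object is always a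
fibration, since it is a weak equivalence of simplicial groups at every sphere; so this is the
same as a cofibrant object with a weak equivalence to `A`.) -/
structure CofibrantReplacement (A : PiAlg a b) where
  obj : SimplicialObject (Over A)
  cofibrant : IsCofibrant (((SimplicialObject.whiskering _ _).obj (Over.forget A)).obj obj)
  acyclic : IsAcyclicFibration (augmentation obj)

/-- The cosimplicial abelian group of derivations `Hom(C_•, M)` over `A`. -/
def cosimplicialDerivations {A : PiAlg a b} (C : SimplicialObject (Over A)) (M : BeckModule A) :
    CosimplicialObject AddCommGrpCat.{0} :=
  Functor.rightOp C ⋙ M.derivations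

/-- The cohomotopy `π^q Hom(C_•, M)`: the cohomology of the alternating sum complex. -/
def cohomotopy {A : PiAlg a b} (C : SimplicialObject (Over A)) (M : BeckModule A) (q : ℕ) :
    AddCommGrpCat.{0} :=
  ((AlgebraicTopology.alternatingCofaceMapComplex AddCommGrpCat.{0}).obj
    (cosimplicialDerivations C M)).homology q

/-- Quillen cohomology `HQ^q(A; M)`, computed by the cofibrant replacement `C` of `A`. -/
abbrev HQ {A : PiAlg a b} (C : CofibrantReplacement A) (M : BeckModule A) (q : ℕ) :
    AddCommGrpCat.{0} :=
  cohomotopy C.obj M q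

/-- The map `π^q Hom(C_•, M) ⟶ π^q Hom(C'_•, M)` induced by `h : C' ⟶ C` over `A`. -/
def pullback {A : PiAlg a b} {C' C : SimplicialObject (Over A)} (h : C' ⟶ C) (M : BeckModule A)
    (q : ℕ) : cohomotopy C M q ⟶ cohomotopy C' M q :=
  HomologicalComplex.homologyMap
    ((AlgebraicTopology.alternatingCofaceMapComplex AddCommGrpCat.{0}).map
      (Functor.whiskerRight (NatTrans.rightOp h) M.derivations)) q

/-- Restriction of simplicial objects over `A` along the inclusion of `Π_a'^b'` into `Π_a^b`. -/
def restrictSimplicial {a' : ℕ} {b' : ℕ∞} (ha : a ≤ a') (hb : b' ≤ b) {A : PiAlg a b}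
    (C : SimplicialObject (Over A)) : SimplicialObject (Over ((restriction ha hb).obj A)) :=
  ((SimplicialObject.whiskering _ _).obj (Over.post (restriction ha hb))).obj C

/-- The map `π^q Hom(C_•, M) ⟶ π^q Hom(RC_•, RM)` that applies the restriction functor `R`. -/
def restrictCohomotopy {a' : ℕ} {b' : ℕ∞} (ha : a ≤ a') (hb : b' ≤ b) {A : PiAlg a b}
    (C : SimplicialObject (Over A)) (M : BeckModule A) (q : ℕ) :
    cohomotopy C M q ⟶ cohomotopy (restrictSimplicial ha hb C) (M.restrict ha hb) q :=
  HomologicalComplex.homologyMap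
    ((AlgebraicTopology.alternatingCofaceMapComplex AddCommGrpCat.{0}).map
      (show cosimplicialDerivations C M ⟶
          cosimplicialDerivations (restrictSimplicial ha hb C) (M.restrict ha hb) from
        Functor.whiskerLeft (Functor.rightOp C) (M.restrictDerivations ha hb))) q

/-- `t` is the comparison map `HQ^q(P_n A; P_n M) ⟶ HQ^q(A; M)` of an `n`-truncated module `M`:
it corresponds, under `Hom(C_•, M) ≅ Hom(P_n C_•, P_n M)`, to the map induced by some
comparison `P_n C ⟶ C'` over `P_n A` with the cofibrant replacement `C'` of `P_n A`. -/
def IsTruncationMap {a n : ℕ} {A : PiAlg a ⊤} (C : CofibrantReplacement A)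
    (C' : CofibrantReplacement ((truncation a n).obj A)) (M : BeckModule A) (q : ℕ)
    (t : HQ C' (M.restrict (le_refl a) (le_top (a := (n : ℕ∞)))) q ⟶ HQ C M q) : Prop :=
  ∃ h : restrictSimplicial (le_refl a) (le_top (a := (n : ℕ∞))) C.obj ⟶ C'.obj,
    t ≫ restrictCohomotopy _ _ C.obj M q = pullback h (M.restrict _ _) q

/-- `c` is the comparison map `HQ^q(A; M) ⟶ HQ^q(C_m A; C_m M)`: apply `C_m` to derivations and
precompose with some comparison `C' ⟶ C_m C` over `C_m A` from the cofibrant replacement `C'` of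
`C_m A`. (For `m`-connected `A` these comparisons correspond, under the adjunction of `C_m` with
the inclusion `ι`, to the comparisons `ι C' ⟶ C` over `A = ι C_m A`.) -/
def IsCoverMap {m : ℕ} {b : ℕ∞} {A : PiAlg 1 b} (C : CofibrantReplacement A)
    (C' : CofibrantReplacement ((cover m b).obj A)) (M : BeckModule A) (q : ℕ)
    (c : HQ C M q ⟶ HQ C' (M.restrict (Nat.le_add_left 1 m) (le_refl b)) q) : Prop :=
  ∃ h : C'.obj ⟶ restrictSimplicial (Nat.le_add_left 1 m) (le_refl b) C.obj,
    c = restrictCohomotopy _ _ C.obj M q ≫ pullback h (M.restrict _ _) q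

/-! ### Loop modules -/

/-- The presheaf `V ↦ [V, X]` on `Π` of a pointed space `X`, functorial in `X`. -/
def homotopyPresheaf : PtdSpace ⥤ ((SphereWedge 1 ⊤)ᵒᵖ ⥤ Type) :=
  yoneda ⋙ (Functor.whiskeringLeft _ _ _).obj (SphereWedge.toPtd 1 ⊤).op

/-- The presheaf `U ↦ A((S^k)₊ ∧ U)` on `Π`. Here the value of `A` at a pointed space `X` is the set
of natural transformations `[-, X] ⟶ A` on `Π`; for `X` homotopy equivalent to an object `V` of
`Π`, as is `(S^k)₊ ∧ U` for `k ≥ 1`, this is `A(V)` by the Yoneda lemma. -/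
def freeLoops (k : ℕ) (A : PiAlg 1 ⊤) : (SphereWedge 1 ⊤)ᵒᵖ ⥤ Type :=
  (SphereWedge.toPtd 1 ⊤ ⋙ halfSmashFunctor k ⋙ homotopyPresheaf).op ⋙ yoneda.obj A.obj

/-- The map `A((S^k)₊ ∧ U) → A(U)` induced by the inclusion of `U`. -/
def freeLoops.eval (k : ℕ) (A : PiAlg 1 ⊤) (U : SphereWedge 1 ⊤)
    (φ : (freeLoops k A).obj (op U)) : A.obj.obj (op U) :=
  NatTrans.app (F := homotopyPresheaf.obj (halfSmash k U.space)) (G := A.obj) φ (op U)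
    (halfSmashIncl k U.space)

/-- The map `A(U) → A((S^k)₊ ∧ U)` induced by the projection to `U`. -/
def freeLoops.const (k : ℕ) (A : PiAlg 1 ⊤) (U : SphereWedge 1 ⊤) (x : A.obj.obj (op U)) :
    (freeLoops k A).obj (op U) :=
  homotopyPresheaf.map (halfSmashProj k U.space) ≫
    (yonedaEquiv.symm x : yoneda.obj U ⟶ A.obj)

/-- `N` is the module `Ω^k A` over `A`: its underlying object over `A` is `U ↦ A((S^k)₊ ∧ U)`, with
the constant loops as its zero section. So its kernel at `S^i` is `A(S^(k+i))`. (This determines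
the group structure of `N`, since an object over a `Π`-algebra admits at most one abelian group
structure with a given zero section.) -/
def IsLoopModule (k : ℕ) {A : PiAlg 1 ⊤} (N : BeckModule A) : Prop :=
  ∃ e : freeLoops k A ≅ N.total.obj,
    (∀ U φ, N.proj.hom.app (op U) (e.hom.app (op U) φ) = freeLoops.eval k A U φ) ∧
    ∀ U x, e.hom.app (op U) (freeLoops.const k A U x) = (0 : Fiber N.proj U x).1

end

end PiAlgebra

end

section

open CategoryTheory Opposite

noncomputable section

namespace PiAlgebra

open scoped unitInterval Topology.Homotopy

/-! ### Spheres as quotients of cubes -/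

/-! The topological input is that a map from a sphere to a wedge of spheres does not see the
summands of higher dimension (`comp_wedgeCollapse`). Over such a summand, smooth approximation and a
dimension count push the map off the antipode of the base point, and the complement of the antipode
contracts. Consequently maps out of spheres of dimension at most `n` factor through the subwedge of
cells of dimension at most `n`, and spheres of dimension at most `m` map trivially to wedges of
spheres of dimension above `m`. In the form `FactorsThroughSub` and `FactorsThroughRetr`, this says
that discarding the other summands is right adjoint to the inclusion of the low-dimensional wedges,
and left adjoint to the inclusion of the high-dimensional ones. Precomposition turns these
adjunctions into those of algebras, with `ι` the extension of an algebra by its values on subwedges.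

Algebras are the presheaves local for a set of maps between finitely presentable presheaves, so they
form a locally presentable category, and the small object argument yields cofibrant replacements.
Between simplicial objects over `A`, a map from a cofibrant one to an acyclic one exists, and any
two are homotopic over `A`, because the two ends of the path object form an acyclic fibration over
the fibre square (`isAcyclicFibration_pathEnds`). So all comparisons induce the same map in
cohomology (`pullback_eq`).

Truncation is left adjoint to an extension that preserves acyclic fibrations; hence it carries a
cofibrant replacement of `A` to one of its truncation. A truncated module has injective projection
at the high spheres, where the zero section also makes it surjective, so derivations into it are
determined by, and may be prescribed on, the low dimensions
(`FactorsThroughSub.bijective_restrictHom`). Together these make the truncation map an isomorphism.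
For connected `A`, the extension of a cofibrant replacement of the cover is a cofibrant replacement
of `A` on which the counit is invertible, and the adjunction identifies the derivations
(`FactorsThroughRetr.isIso_comparison`). The square commutes since, after restriction to both
ranges, its two sides come from two maps between the same cofibrant and acyclic objects.

For the loop modules, evaluation of free loops is a fibration with the constant loops as a section.
Its split sequences show that the half-smash product with `S^d` has the cells `S^d` and `S^(k+d)`
(`exists_topCell`), so that `U ↦ A((S^k)₊ ∧ U)` is again an algebra. Concatenation of loops with a
common base point respects the group structure coming from the source sphere, and an Eckmann–Hilton
argument (`adjunct_loopMul_sphere`) makes it an abelian group law. Loops in an algebra are pulled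
back from a universal element on an amalgam of half-smash products (`loopAdd_eq`), which transports
the law to `A`. The kernel at `S^d` is controlled by the value of `A` at `S^(k+d)`, whence the
truncation bound. -/

/-- The coordinates of a point of the cube, rescaled to `[-1, 1]`. -/
def centered {k : ℕ} (x : Fin k → I) : Fin k → ℝ := fun j => 2 * (x j : ℝ) - 1

theorem continuous_centered {k : ℕ} : Continuous (centered (k := k)) := by
  unfold centered; fun_prop

theorem centered_injective {k : ℕ} : Function.Injective (centered (k := k)) := by
  intro x y h
  funext j
  have := congrFun h j
  simp only [centered] at this
  exact Subtype.ext (by linarith)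

theorem abs_centered_le {k : ℕ} (x : Fin k → I) (j : Fin k) : |centered x j| ≤ 1 := by
  have h0 := (x j).2.1
  have h1 := (x j).2.2
  rw [abs_le, centered]
  constructor <;> linarith

theorem norm_centered_le {k : ℕ} (x : Fin k → I) : ‖centered x‖ ≤ 1 :=
  (pi_norm_le_iff_of_nonneg zero_le_one).2 fun j => abs_centered_le x j

/-- For the sup norm the centered cube is the unit ball, and its boundary is the unit sphere. -/
theorem mem_boundary_iff {k : ℕ} (x : Fin k → I) :
    x ∈ Cube.boundary (Fin k) ↔ ‖centered x‖ = 1 := by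
  constructor
  · rintro ⟨j, hj⟩
    refine le_antisymm (norm_centered_le x) ?_
    refine le_trans ?_ (norm_le_pi_norm (centered x) j)
    rcases hj with hj | hj <;> (simp [centered, hj]; try norm_num)
  · intro h
    by_contra hx
    have : ‖centered x‖ < 1 := by
      refine (pi_norm_lt_iff one_pos).2 fun j => ?_
      have h0 := (x j).2.1
      have h1 := (x j).2.2
      have hj : ¬ (x j = 0 ∨ x j = 1) := fun hj => hx ⟨j, hj⟩
      push Not at hj
      have h0' : (x j : ℝ) ≠ 0 := fun e => hj.1 (Subtype.ext e)
      have h1' : (x j : ℝ) ≠ 1 := fun e => hj.2 (Subtype.ext e)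
      have := lt_of_le_of_ne h0 h0'.symm
      have := lt_of_le_of_ne h1 h1'
      rw [Real.norm_eq_abs, abs_lt, centered]
      constructor <;> linarith
    exact this.ne h

/-- The squared Euclidean norm. -/
def sumSq {k : ℕ} (y : Fin k → ℝ) : ℝ := ∑ j, y j ^ 2

theorem sumSq_nonneg {k : ℕ} (y : Fin k → ℝ) : 0 ≤ sumSq y :=
  Finset.sum_nonneg fun _ _ => sq_nonneg _

/-- The two squares cannot vanish together: at `y = 0` the second one is `1`. -/
theorem denom_pos {k : ℕ} (y : Fin k → ℝ) : 0 < sumSq y + (1 - ‖y‖) ^ 2 := by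
  rcases (sumSq_nonneg y).lt_or_eq with h | h
  · positivity
  · have : y = 0 := by
      funext j
      have := (Finset.sum_eq_zero_iff_of_nonneg (fun _ _ => sq_nonneg _)).1 h.symm j
        (Finset.mem_univ j)
      simpa using this
    simp [this, sumSq]

/-- The map from the centered cube to the sphere that collapses the boundary: the inverse
stereographic projection of `y / (1 - ‖y‖)`. -/
def collapseFun {k : ℕ} (y : Fin k → ℝ) : EuclideanSpace ℝ (Fin (k + 1)) :=
  WithLp.toLp 2 (Fin.cons ((sumSq y - (1 - ‖y‖) ^ 2) / (sumSq y + (1 - ‖y‖) ^ 2))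
    fun j => 2 * (1 - ‖y‖) * y j / (sumSq y + (1 - ‖y‖) ^ 2))

theorem continuous_collapseFun {k : ℕ} : Continuous (collapseFun (k := k)) := by
  have h : Continuous (sumSq (k := k)) := by unfold sumSq; fun_prop
  have hd : ∀ y : Fin k → ℝ, sumSq y + (1 - ‖y‖) ^ 2 ≠ 0 := fun y => (denom_pos y).ne'
  refine (PiLp.continuous_toLp 2 _).comp (continuous_pi fun j => ?_)
  refine Fin.cases ?_ (fun j => ?_) j
  · simp only [Fin.cons_zero]
    exact Continuous.div (by fun_prop) (by fun_prop) hd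
  · simp only [Fin.cons_succ]
    exact Continuous.div (by fun_prop) (by fun_prop) hd

/-- With `s = sumSq y` and `r = 1 - ‖y‖`, this is the identity `(s - r²)² + 4r²s = (s + r²)²`. -/
theorem norm_collapseFun {k : ℕ} (y : Fin k → ℝ) : ‖collapseFun y‖ = 1 := by
  rw [EuclideanSpace.norm_eq, Real.sqrt_eq_one, Fin.sum_univ_succ]
  simp only [collapseFun, Fin.cons_zero, Fin.cons_succ, Real.norm_eq_abs, sq_abs, div_pow, mul_pow]
  rw [← Finset.sum_div, ← Finset.mul_sum, ← add_div, div_eq_one_iff_eq (pow_pos (denom_pos y) 2).ne']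
  change _ + 2 ^ 2 * (1 - ‖y‖) ^ 2 * sumSq y = _
  ring

/-- The collapse of the boundary of the cube, as a map to the sphere. -/
def cubeCollapse (k : ℕ) : C(Fin k → I, (sphere k).carrier) :=
  ⟨fun x => ⟨collapseFun (centered x), by simp [norm_collapseFun]⟩,
    (continuous_collapseFun.comp continuous_centered).subtype_mk _⟩

/-- The first coordinate of the image equals `1` exactly when `1 - ‖y‖` vanishes, and then all other
coordinates vanish too. -/
theorem cubeCollapse_eq_pt_iff {k : ℕ} (x : Fin k → I) :
    cubeCollapse k x = (sphere k).pt ↔ x ∈ Cube.boundary (Fin k) := by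
  have hD := denom_pos (centered x)
  rw [mem_boundary_iff]
  constructor
  · intro h
    have h0 : collapseFun (centered x) 0 = 1 :=
      (congrArg (fun p : (sphere k).carrier => p.1 0) h).trans (by simp [sphere])
    simp only [collapseFun, Fin.cons_zero] at h0
    rw [div_eq_one_iff_eq hD.ne'] at h0
    nlinarith
  · intro h
    refine Subtype.ext ?_
    change collapseFun (centered x) = EuclideanSpace.single 0 1
    rw [h] at hD
    ext j
    refine Fin.cases ?_ (fun j => ?_) j
    · simp only [collapseFun, Fin.cons_zero, h]
      simp only [sub_self, ne_eq, OfNat.ofNat_ne_zero, not_false_eq_true, zero_pow, add_zero] at hD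
      simp [hD.ne']
    · simp [collapseFun, h]

theorem one_sub_collapseFun {k : ℕ} (y : Fin k → ℝ) :
    1 - collapseFun y 0 = 2 * (1 - ‖y‖) ^ 2 / (sumSq y + (1 - ‖y‖) ^ 2) := by
  have := denom_pos y
  simp only [collapseFun, Fin.cons_zero]
  field_simp
  ring

/-- Stereographic projection recovers the point `y / (1 - ‖y‖)` from which the collapse was built.
-/
theorem collapseFun_div {k : ℕ} (y : Fin k → ℝ) (hy : ‖y‖ < 1) (j : Fin k) :
    collapseFun y j.succ / (1 - collapseFun y 0) = y j / (1 - ‖y‖) := by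
  have := denom_pos y
  have h1 : 1 - ‖y‖ ≠ 0 := by linarith
  rw [one_sub_collapseFun]
  simp only [collapseFun, Fin.cons_succ]
  field_simp

/-- The vector `y / (1 - ‖y‖)` determines `y`: its norm is `t / (1 - t)` with `t = ‖y‖ < 1`, which
determines `t`, and then the scalar can be cancelled. -/
theorem cubeCollapse_injOn {k : ℕ} {x x' : Fin k → I} (h : cubeCollapse k x = cubeCollapse k x')
    (hx : x ∉ Cube.boundary (Fin k)) : x = x' := by
  have hx' : x' ∉ Cube.boundary (Fin k) := by
    rwa [← cubeCollapse_eq_pt_iff, ← h, cubeCollapse_eq_pt_iff]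
  rw [mem_boundary_iff] at hx hx'
  have hx := lt_of_le_of_ne (norm_centered_le x) hx
  have hx' := lt_of_le_of_ne (norm_centered_le x') hx'
  apply centered_injective
  set y := centered x
  set y' := centered x'
  have h : collapseFun y = collapseFun y' := congrArg Subtype.val h
  have e : (1 - ‖y‖)⁻¹ • y = (1 - ‖y'‖)⁻¹ • y' := by
    funext j
    have := collapseFun_div y hx j
    rw [h, collapseFun_div y' hx' j] at this
    simp only [Pi.smul_apply, smul_eq_mul]
    rw [inv_mul_eq_div, inv_mul_eq_div, this]
  have hN : ‖y‖ = ‖y'‖ := by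
    have := congrArg norm e
    rw [norm_smul, norm_smul, norm_inv, norm_inv, Real.norm_of_nonneg (by linarith),
      Real.norm_of_nonneg (by linarith)] at this
    have p : 1 - ‖y‖ ≠ 0 := by linarith
    have p' : 1 - ‖y'‖ ≠ 0 := by linarith
    field_simp at this
    linarith
  rw [hN] at e
  exact smul_right_injective _ (inv_ne_zero (by linarith : 1 - ‖y'‖ ≠ 0)) e

theorem exists_cubeCollapse_eq {k : ℕ} (p : (sphere k).carrier) (hp : p ≠ (sphere k).pt) :
    ∃ x, cubeCollapse k x = p := by
  have hn : ∑ j, (p.1 j) ^ 2 = 1 := by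
    have : ‖p.1‖ = 1 := by simpa using p.2
    rw [EuclideanSpace.norm_eq, Real.sqrt_eq_one] at this
    simpa using this
  rw [Fin.sum_univ_succ] at hn
  have hS : ∑ j : Fin k, p.1 j.succ ^ 2 = 1 - p.1 0 ^ 2 := by linarith
  have h0 : 0 < 1 - p.1 0 := by
    have hle : p.1 0 ≤ 1 := by
      have := Finset.sum_nonneg (s := Finset.univ) fun (j : Fin k) _ => sq_nonneg (p.1 j.succ)
      nlinarith
    refine lt_of_le_of_ne (by linarith) fun e => hp (Subtype.ext ?_)
    have e0 : p.1 0 = 1 := by linarith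
    rw [e0] at hS
    have hz := (Finset.sum_eq_zero_iff_of_nonneg (fun (j : Fin k) _ => sq_nonneg (p.1 j.succ))).1
      (by rw [hS]; norm_num)
    change p.1 = EuclideanSpace.single 0 1
    ext j
    refine Fin.cases (by simpa using e0) (fun j => ?_) j
    simpa using hz j (Finset.mem_univ j)
  -- `v` is the stereographic projection of `p`; the scaling by `(1 + ‖v‖)⁻¹` inverts `y ↦ y / (1 -
  -- ‖y‖)`.
  set v : Fin k → ℝ := fun j => p.1 j.succ / (1 - p.1 0) with hv
  have hN : 0 ≤ ‖v‖ := norm_nonneg v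
  have hN1 : 0 < 1 + ‖v‖ := by linarith
  set y : Fin k → ℝ := (1 + ‖v‖)⁻¹ • v with hy
  have hny : ‖y‖ = ‖v‖ / (1 + ‖v‖) := by
    rw [hy, norm_smul, norm_inv, Real.norm_of_nonneg hN1.le, inv_mul_eq_div]
  have hy1 : ‖y‖ ≤ 1 := by rw [hny, div_le_one hN1]; linarith
  have hyj : ∀ j, |y j| ≤ 1 := fun j => (norm_le_pi_norm y j).trans hy1
  let x : Fin k → I := fun j => ⟨(y j + 1) / 2, by
    have := abs_le.1 (hyj j)
    constructor <;> linarith⟩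
  have hx : centered x = y := by funext j; simp only [centered, x]; ring
  refine ⟨x, Subtype.ext ?_⟩
  change collapseFun (centered x) = p.1
  rw [hx]
  have e1 : 1 - ‖y‖ = (1 + ‖v‖)⁻¹ := by rw [hny]; field_simp; ring
  have e2 : sumSq y = ((1 + ‖v‖)⁻¹) ^ 2 * ((1 + p.1 0) / (1 - p.1 0)) := by
    simp only [sumSq, hy, hv, Pi.smul_apply, smul_eq_mul, mul_pow, div_pow]
    rw [← Finset.mul_sum, ← Finset.sum_div, hS]
    field_simp
    ring
  have e3 : sumSq y + (1 - ‖y‖) ^ 2 = ((1 + ‖v‖)⁻¹) ^ 2 * (2 / (1 - p.1 0)) := by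
    rw [e1, e2]; field_simp; ring
  ext j
  refine Fin.cases ?_ (fun j => ?_) j
  · simp only [collapseFun, Fin.cons_zero, e3]
    rw [e1, e2]
    field_simp
    ring
  · simp only [collapseFun, Fin.cons_succ, e3]
    rw [e1]
    simp only [hy, hv, Pi.smul_apply, smul_eq_mul]
    field_simp

/-- Positive dimension is needed for the base point, which only boundary points reach: the cube of
dimension `0` has no boundary. -/
theorem cubeCollapse_surjective {k : ℕ} (hk : 1 ≤ k) : Function.Surjective (cubeCollapse k) := by
  intro p
  by_cases hp : p = (sphere k).pt
  · exact ⟨fun _ => 0, hp ▸ (cubeCollapse_eq_pt_iff _).2 ⟨⟨0, hk⟩, Or.inl rfl⟩⟩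
  · exact exists_cubeCollapse_eq p hp

instance (k : ℕ) : CompactSpace (sphere k).carrier :=
  inferInstanceAs (CompactSpace (Metric.sphere (0 : EuclideanSpace ℝ (Fin (k + 1))) 1))

instance (k : ℕ) : T2Space (sphere k).carrier :=
  inferInstanceAs (T2Space (Metric.sphere (0 : EuclideanSpace ℝ (Fin (k + 1))) 1))

instance (k : ℕ) : LocallyCompactSpace (sphere k).carrier := inferInstance

/-- The collapse is proper, being continuous from a compact to a Hausdorff space, so its product
with any identity is closed. No local compactness of `T` is required, and this is what lets families
and homotopies descend from the cube to the sphere. -/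
theorem isQuotientMap_cubeCollapse {k : ℕ} (hk : 1 ≤ k) (T : Type*) [TopologicalSpace T] :
    Topology.IsQuotientMap (Prod.map (id : T → T) (cubeCollapse k)) := by
  have h : IsProperMap (cubeCollapse k) := (cubeCollapse k).continuous.isProperMap
  exact (IsProperMap.isClosedMap (isProperMap_id.prodMap h)).isQuotientMap
    (by fun_prop) (Function.surjective_id.prodMap (cubeCollapse_surjective hk))

/-- The product of a space with the collapse of the cube. -/
def prodCollapse (k : ℕ) (T : Type*) [TopologicalSpace T] :
    C(T × (Fin k → I), T × (sphere k).carrier) :=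
  ⟨Prod.map (id : T → T) (cubeCollapse k), by fun_prop⟩

theorem factorsThrough_prodCollapse {k : ℕ} {T Y : Type*} [TopologicalSpace T]
    [TopologicalSpace Y] (g : C(T × (Fin k → I), Y))
    (hg : ∀ t, ∀ x ∈ Cube.boundary (Fin k), ∀ x' ∈ Cube.boundary (Fin k), g (t, x) = g (t, x')) :
    Function.FactorsThrough g (prodCollapse k T) := by
  rintro ⟨t, x⟩ ⟨t', x'⟩ h
  obtain rfl : t = t' := congrArg Prod.fst h
  have h : cubeCollapse k x = cubeCollapse k x' := congrArg Prod.snd h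
  by_cases hx : x ∈ Cube.boundary (Fin k)
  · refine hg _ x hx x' ?_
    rwa [← cubeCollapse_eq_pt_iff, ← h, cubeCollapse_eq_pt_iff]
  · rw [cubeCollapse_injOn h hx]

/-- A family of maps on the cube that are constant on the boundary descends to the sphere. -/
def descend {k : ℕ} (hk : 1 ≤ k) {T Y : Type*} [TopologicalSpace T] [TopologicalSpace Y]
    (g : C(T × (Fin k → I), Y))
    (hg : ∀ t, ∀ x ∈ Cube.boundary (Fin k), ∀ x' ∈ Cube.boundary (Fin k), g (t, x) = g (t, x')) :
    C(T × (sphere k).carrier, Y) :=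
  Topology.IsQuotientMap.lift (f := prodCollapse k T) (isQuotientMap_cubeCollapse hk T) g
    (factorsThrough_prodCollapse g hg)

theorem descend_apply {k : ℕ} (hk : 1 ≤ k) {T Y : Type*} [TopologicalSpace T] [TopologicalSpace Y]
    (g : C(T × (Fin k → I), Y)) (hg) (t : T) (x : Fin k → I) :
    descend hk g hg (t, cubeCollapse k x) = g (t, x) :=
  DFunLike.congr_fun (Topology.IsQuotientMap.lift_comp (f := prodCollapse k T)
    (isQuotientMap_cubeCollapse hk T) g (factorsThrough_prodCollapse g hg)) (t, x)

end PiAlgebra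

end

end

section

open CategoryTheory Opposite

noncomputable section

namespace PiAlgebra

open scoped unitInterval Topology.Homotopy

/-! ### Morphisms of the pointed homotopy category -/

theorem PtdMap.toHom_surjective {X Y : PtdSpace} (f : X ⟶ Y) : ∃ g : PtdMap X Y, g.toHom = f :=
  Quotient.exists_rep f

theorem PtdMap.toHom_eq {X Y : PtdSpace} {f g : PtdMap X Y} (F : C(I × X.carrier, Y.carrier))
    (h0 : ∀ x, F (0, x) = f.1 x) (h1 : ∀ x, F (1, x) = g.1 x) (hpt : ∀ t, F (t, X.pt) = Y.pt) :
    f.toHom = g.toHom := by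
  refine Quotient.sound ⟨⟨⟨F, h0, h1⟩, fun t x hx => ?_⟩⟩
  obtain rfl : x = X.pt := hx
  exact (hpt t).trans f.2.symm

theorem PtdMap.exists_homotopy {X Y : PtdSpace} {f g : PtdMap X Y} (h : f.toHom = g.toHom) :
    ∃ F : C(I × X.carrier, Y.carrier), (∀ x, F (0, x) = f.1 x) ∧ (∀ x, F (1, x) = g.1 x) ∧
      ∀ t, F (t, X.pt) = Y.pt := by
  obtain ⟨F⟩ := (Quotient.exact h : f ≈ g)
  exact ⟨F.toContinuousMap, F.apply_zero, F.apply_one, fun t => (F.eq_fst t rfl).trans f.2⟩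

/-! ### Wedges are coproducts -/

section Wedge

variable {ι : Type} (X : ι → PtdSpace)

/-- The inclusion of a summand of a wedge, as a pointed map. -/
def wedgeInclMap (i : ι) : PtdMap (X i) (wedge X) :=
  ⟨⟨fun x => Quot.mk _ (Sum.inr ⟨i, x⟩), continuous_quot_mk.comp
    (by exact continuous_inr.comp continuous_sigmaMk)⟩,
    (Quot.sound (WedgeRel.glue i)).symm⟩

/-- The inclusion of a summand of a wedge. -/
def wedgeIncl (i : ι) : X i ⟶ wedge X := (wedgeInclMap X i).toHom

variable {X}

theorem wedge_ind {p : (wedge X).carrier → Prop} (h0 : p (wedge X).pt)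
    (h : ∀ i x, p ((wedgeInclMap X i).1 x)) (w) : p w := by
  obtain ⟨⟨⟩ | ⟨i, x⟩⟩ := w
  exacts [h0, h i x]

/-- A map out of a wedge, given by its restrictions to the base point and the summands. -/
def wedgeLift {Y : Type*} [TopologicalSpace Y] (y : Y) (f : ∀ i, C((X i).carrier, Y))
    (hf : ∀ i, f i (X i).pt = y) : C((wedge X).carrier, Y) :=
  ⟨Quot.lift (Sum.elim (fun _ => y) fun x => f x.1 x.2) (by
      rintro _ _ ⟨i⟩
      exact (hf i).symm),
    continuous_quot_lift _ (continuous_const.sumElim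
      (continuous_sigma fun i => (f i).continuous))⟩

/-- The pointed map out of a wedge with given restrictions to the summands. -/
def wedgeDescMap {Z : PtdSpace} (f : ∀ i, PtdMap (X i) Z) : PtdMap (wedge X) Z :=
  ⟨wedgeLift Z.pt (fun i => (f i).1) fun i => (f i).2, rfl⟩

/-- On the level of pointed maps the wedge is a coproduct by construction; the point is that
homotopies can be glued as well. -/
theorem wedge_hom_bijective (Z : PtdSpace) :
    Function.Bijective fun (f : wedge X ⟶ Z) i => wedgeIncl X i ≫ f := by
  constructor
  · intro f g h
    obtain ⟨f, rfl⟩ := PtdMap.toHom_surjective f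
    obtain ⟨g, rfl⟩ := PtdMap.toHom_surjective g
    have h' : ∀ i, ((wedgeInclMap X i).comp f).toHom = ((wedgeInclMap X i).comp g).toHom :=
      fun i => congrFun h i
    choose F h0 h1 hF using fun i => PtdMap.exists_homotopy (h' i)
    -- Homotopies are glued as maps to the path space, so that only the quotient topology of the
    -- wedge is used, not that of its product with `I`.
    let G : C((wedge X).carrier, C(I, Z.carrier)) :=
      wedgeLift (ContinuousMap.const _ Z.pt)
        (fun i => ((F i).comp ⟨Prod.swap, continuous_swap⟩).curry)
        (fun i => ContinuousMap.ext fun t => hF i t)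
    refine PtdMap.toHom_eq (G.uncurry.comp ⟨Prod.swap, continuous_swap⟩) ?_ ?_ fun t => rfl
    · intro x
      induction x using wedge_ind with
      | h0 => exact f.2.symm
      | h i x => exact h0 i x
    · intro x
      induction x using wedge_ind with
      | h0 => exact g.2.symm
      | h i x => exact h1 i x
  · intro f
    choose g hg using fun i => PtdMap.toHom_surjective (f i)
    refine ⟨(wedgeDescMap g).toHom, ?_⟩
    funext i
    rw [← hg i]
    rfl

theorem wedge_hom_ext {Z : PtdSpace} {f g : wedge X ⟶ Z}
    (h : ∀ i, wedgeIncl X i ≫ f = wedgeIncl X i ≫ g) : f = g :=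
  (wedge_hom_bijective Z).1 (funext h)

/-- The morphism out of a wedge with given restrictions to the summands. -/
def wedgeDesc {Z : PtdSpace} (f : ∀ i, X i ⟶ Z) : wedge X ⟶ Z :=
  ((wedge_hom_bijective Z).2 f).choose

@[simp]
theorem wedgeIncl_desc {Z : PtdSpace} (f : ∀ i, X i ⟶ Z) (i : ι) :
    wedgeIncl X i ≫ wedgeDesc f = f i :=
  congrFun ((wedge_hom_bijective Z).2 f).choose_spec i

@[simp]
theorem wedgeIncl_desc_assoc {Z W : PtdSpace} (f : ∀ i, X i ⟶ Z) (i : ι) (g : Z ⟶ W) :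
    wedgeIncl X i ≫ wedgeDesc f ≫ g = f i ≫ g := by
  rw [← Category.assoc, wedgeIncl_desc]

end Wedge

/-! ### The group structure on homotopy classes of maps out of a sphere -/

section SphereGroup

variable (d : ℕ) [hd : NeZero d] (Z : PtdSpace)

/-- The sphere `S^d`, as a wedge with one summand. -/
def wedgeSphere (d : ℕ) : PtdSpace := wedge fun _ : Fin 1 => sphere d

/-- The homeomorphism from the sphere to the wedge with one summand. -/
def wedgeSphereIncl (d : ℕ) : PtdMap (sphere d) (wedgeSphere d) :=
  wedgeInclMap (fun _ : Fin 1 => sphere d) 0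

theorem wedgeSphere_hom_ext {d : ℕ} {Z : PtdSpace} {f g : wedgeSphere d ⟶ Z}
    (h : (wedgeSphereIncl d).toHom ≫ f = (wedgeSphereIncl d).toHom ≫ g) : f = g :=
  wedge_hom_ext fun i => by
    obtain rfl : i = 0 := Subsingleton.elim _ _
    exact h

/-- The restriction of a pointed map along the collapse of the cube. -/
def toGenLoop (f : PtdMap (wedgeSphere d) Z) : Ω^ (Fin d) Z.carrier Z.pt :=
  ⟨(f.1.comp (wedgeSphereIncl d).1).comp (cubeCollapse d), by
    intro x hx
    rw [ContinuousMap.comp_apply, (cubeCollapse_eq_pt_iff x).2 hx, ContinuousMap.comp_apply,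
      (wedgeSphereIncl d).2]
    exact f.2⟩

variable {d Z}

theorem toGenLoop_homotopic {f g : PtdMap (wedgeSphere d) Z} (h : f.toHom = g.toHom) :
    GenLoop.Homotopic (toGenLoop d Z f) (toGenLoop d Z g) := by
  obtain ⟨F, h0, h1, hF⟩ := PtdMap.exists_homotopy h
  refine ⟨⟨⟨F.comp ⟨fun p => (p.1, (wedgeSphereIncl d).1
    (cubeCollapse d p.2)), by fun_prop⟩, fun x => h0 _, fun x => h1 _⟩, fun t x hx => ?_⟩⟩
  refine (congrArg (fun y => F (t, y)) ?_).trans ((hF t).trans ((toGenLoop d Z f).2 x hx).symm)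
  exact (congrArg _ ((cubeCollapse_eq_pt_iff x).2 hx)).trans (wedgeSphereIncl d).2

/-- A homotopy relative to the boundary is constant on the boundary at each time, so it descends
along the quotient map from `I` times the cube to `I` times the sphere. -/
theorem toHom_eq_of_toGenLoop_homotopic {f g : PtdMap (wedgeSphere d) Z}
    (h : GenLoop.Homotopic (toGenLoop d Z f) (toGenLoop d Z g)) : f.toHom = g.toHom := by
  obtain ⟨F⟩ := h
  have hF : ∀ t, ∀ x ∈ Cube.boundary (Fin d), F.toContinuousMap (t, x) = Z.pt := fun t x hx =>
    (F.eq_fst t hx).trans ((toGenLoop d Z f).2 x hx)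
  let G := descend NeZero.one_le F.toContinuousMap fun t x hx x' hx' => by rw [hF t x hx, hF t x' hx']
  have hG : ∀ t x, G (t, cubeCollapse d x) = F (t, x) := fun t x => descend_apply _ _ _ t x
  refine wedgeSphere_hom_ext ?_
  refine PtdMap.toHom_eq (f := (wedgeSphereIncl d).comp f) (g := (wedgeSphereIncl d).comp g) G
    (fun p => ?_) (fun p => ?_) fun t => ?_
  · obtain ⟨x, rfl⟩ := cubeCollapse_surjective NeZero.one_le p
    exact (hG _ _).trans (F.apply_zero x)
  · obtain ⟨x, rfl⟩ := cubeCollapse_surjective NeZero.one_le p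
    exact (hG _ _).trans (F.apply_one x)
  · obtain ⟨x, hx⟩ := cubeCollapse_surjective NeZero.one_le (sphere d).pt
    have hx' := (cubeCollapse_eq_pt_iff x).1 hx
    have := hG t x
    rw [hx] at this
    exact this.trans (hF t x hx')

theorem exists_toGenLoop_eq (p : Ω^ (Fin d) Z.carrier Z.pt) :
    ∃ f : PtdMap (wedgeSphere d) Z, toGenLoop d Z f = p := by
  let G := descend NeZero.one_le (T := Unit) (p.1.comp ⟨Prod.snd, continuous_snd⟩)
    fun t x hx x' hx' => (p.2 x hx).trans (p.2 x' hx').symm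
  have hG : ∀ x, G ((), cubeCollapse d x) = p x := fun x => descend_apply _ _ _ () x
  refine ⟨wedgeDescMap fun _ => ⟨G.comp ⟨fun x => ((), x), by fun_prop⟩, ?_⟩, ?_⟩
  · obtain ⟨x, hx⟩ := cubeCollapse_surjective NeZero.one_le (sphere d).pt
    rw [← hx]
    exact (hG x).trans (p.2 x ((cubeCollapse_eq_pt_iff x).1 hx))
  · ext x
    exact hG x

variable (d Z)

/-- Homotopy classes of maps out of a sphere form a homotopy group. -/
def sphereHomEquiv : (wedgeSphere d ⟶ Z) ≃ HomotopyGroup (Fin d) Z.carrier Z.pt :=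
  Equiv.ofBijective
    (Quotient.lift (fun f => (Quotient.mk _ (toGenLoop d Z f) : HomotopyGroup _ _ _))
      fun _ _ h => Quotient.sound (toGenLoop_homotopic (Quotient.sound h)))
    (by
      constructor
      · intro f g h
        obtain ⟨f, rfl⟩ := PtdMap.toHom_surjective f
        obtain ⟨g, rfl⟩ := PtdMap.toHom_surjective g
        exact toHom_eq_of_toGenLoop_homotopic (Quotient.exact h)
      · intro p
        induction p using Quotient.inductionOn with | h p => ?_
        obtain ⟨f, rfl⟩ := exists_toGenLoop_eq p
        exact ⟨f.toHom, rfl⟩)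

instance sphereHomGroup : Group (wedgeSphere d ⟶ Z) := (sphereHomEquiv d Z).group

variable {d Z}

/-- Concatenation takes place in the source cube, so it commutes with composition on the target
side. -/
theorem sphereHom_mul_comp {W : PtdSpace} (f g : wedgeSphere d ⟶ Z) (h : Z ⟶ W) :
    (f * g) ≫ h = (f ≫ h) * (g ≫ h) := by
  obtain ⟨h, rfl⟩ := PtdMap.toHom_surjective h
  obtain ⟨f, rfl⟩ := PtdMap.toHom_surjective f
  obtain ⟨g, rfl⟩ := PtdMap.toHom_surjective g
  -- In `HomotopyGroup` a product is represented by the concatenation in the opposite order, hence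
  -- `g` comes first.
  obtain ⟨m, hm⟩ := exists_toGenLoop_eq (GenLoop.transAt 0 (toGenLoop d Z g) (toGenLoop d Z f))
  have e : f.toHom * g.toHom = m.toHom := by
    apply (sphereHomEquiv d Z).injective
    refine ((sphereHomEquiv d Z).apply_symm_apply _).trans ?_
    change _ = (Quotient.mk _ (toGenLoop d Z m) : HomotopyGroup _ _ _)
    rw [hm]
    exact HomotopyGroup.mul_spec (i := 0)
  rw [e]
  apply (sphereHomEquiv d W).injective
  refine Eq.trans ?_ ((sphereHomEquiv d W).apply_symm_apply _).symm
  refine Eq.trans ?_ (HomotopyGroup.mul_spec (i := 0) (p := toGenLoop d W (f.comp h))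
    (q := toGenLoop d W (g.comp h))).symm
  refine congrArg (Quotient.mk _) ?_
  ext x
  refine (congrArg h.1 (DFunLike.congr_fun hm x)).trans ?_
  simp only [GenLoop.transAt, GenLoop.coe_copy]
  split_ifs <;> rfl

/-- Composition with a fixed morphism, as a homomorphism of groups. -/
def sphereHomComp (d : ℕ) [NeZero d] {W : PtdSpace} (h : Z ⟶ W) :
    (wedgeSphere d ⟶ Z) →* (wedgeSphere d ⟶ W) :=
  MonoidHom.mk' (fun f => f ≫ h) fun f g => sphereHom_mul_comp f g h

theorem sphereHom_inv_comp {W : PtdSpace} (f : wedgeSphere d ⟶ Z) (h : Z ⟶ W) :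
    f⁻¹ ≫ h = (f ≫ h)⁻¹ :=
  (sphereHomComp d h).map_inv f

end SphereGroup

/-- The constant morphism. -/
def ptdZero (X Y : PtdSpace) : X ⟶ Y :=
  PtdMap.toHom ⟨ContinuousMap.const _ Y.pt, rfl⟩

theorem ptdZero_comp {X Y Z : PtdSpace} (f : Y ⟶ Z) : ptdZero X Y ≫ f = ptdZero X Z := by
  obtain ⟨f, rfl⟩ := PtdMap.toHom_surjective f
  refine congrArg (Quotient.mk _) (Subtype.ext (ContinuousMap.ext fun x => ?_))
  exact f.2

theorem comp_ptdZero {X Y Z : PtdSpace} (f : X ⟶ Y) : f ≫ ptdZero Y Z = ptdZero X Z := by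
  obtain ⟨f, rfl⟩ := PtdMap.toHom_surjective f
  rfl

theorem sphereHom_one (d : ℕ) [NeZero d] (Z : PtdSpace) :
    (1 : wedgeSphere d ⟶ Z) = ptdZero _ Z := by
  apply (sphereHomEquiv d Z).injective
  exact (sphereHomEquiv d Z).apply_symm_apply _

end PiAlgebra

end

end

section

open CategoryTheory Opposite

noncomputable section

namespace PiAlgebra

open scoped unitInterval Topology.Homotopy

/-! ### Low-dimensional maps into wedges of spheres -/

-- Pasting along two closed sets: the frontier of `A` lies in both, and there the two functions
-- agree.
open Classical in
theorem continuous_ite_of_isClosed {X Y : Type*} [TopologicalSpace X] [TopologicalSpace Y]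
    {A B : Set X} (hA : IsClosed A) (hB : IsClosed B) (hAB : ∀ x, x ∈ A ∨ x ∈ B) {f g : X → Y}
    (hf : ContinuousOn f A) (hg : ContinuousOn g B) (hfg : ∀ x ∈ A, x ∈ B → f x = g x) :
    Continuous fun x => if x ∈ A then f x else g x := by
  have hsub : closure {x | x ∉ A} ⊆ B := closure_minimal (fun x hx => (hAB x).resolve_left hx) hB
  refine continuous_if (fun x hx => ?_) ?_ (hg.mono hsub)
  · refine hfg x (hA.closure_eq ▸ frontier_subset_closure hx) (hsub ?_)
    have : x ∈ frontier {x | x ∉ A} := by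
      have e : {x | x ∉ A} = Aᶜ := rfl
      rw [e, frontier_compl]
      exact hx
    exact frontier_subset_closure this
  · exact hf.mono hA.closure_eq.le

/-- The ambient Euclidean space of a sphere. -/
abbrev Ambient (d : ℕ) : Type := EuclideanSpace ℝ (Fin (d + 1))

/-- The coordinates of a point of the sphere. -/
def sphereCoord {d : ℕ} (p : (sphere d).carrier) : Ambient d := p.1

theorem continuous_sphereCoord {d : ℕ} : Continuous (sphereCoord (d := d)) := continuous_subtype_val

theorem norm_sphereCoord {d : ℕ} (p : (sphere d).carrier) : ‖sphereCoord p‖ = 1 := by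
  simpa [sphereCoord] using p.2

theorem sphereCoord_pt (d : ℕ) : sphereCoord (sphere d).pt = EuclideanSpace.single 0 1 := rfl

theorem sphereCoord_injective {d : ℕ} : Function.Injective (sphereCoord (d := d)) :=
  Subtype.val_injective

open Classical in
/-- Normalization of vectors (with the base point as default value). -/
def normalized {d : ℕ} (v : Ambient d) : (sphere d).carrier :=
  if h : v = 0 then (sphere d).pt else ⟨‖v‖⁻¹ • v, by
    simp [norm_smul, inv_mul_cancel₀ (norm_ne_zero_iff.2 h)]⟩

theorem sphereCoord_normalized {d : ℕ} {v : Ambient d} (h : v ≠ 0) :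
    sphereCoord (normalized v) = ‖v‖⁻¹ • v := 
  congrArg sphereCoord (dif_neg h)

theorem normalized_sphereCoord {d : ℕ} (p : (sphere d).carrier) : normalized (sphereCoord p) = p := by
  have h : sphereCoord p ≠ 0 := norm_ne_zero_iff.1 (by rw [norm_sphereCoord]; exact one_ne_zero)
  apply sphereCoord_injective
  rw [sphereCoord_normalized h, norm_sphereCoord, inv_one, one_smul]

theorem continuousOn_normalized {d : ℕ} : ContinuousOn (normalized (d := d)) {v | v ≠ 0} := by
  rw [continuousOn_iff_continuous_domRestrict]
  have h : Topology.IsEmbedding (sphereCoord (d := d)) := Topology.IsEmbedding.subtypeVal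
  rw [h.continuous_iff]
  have : sphereCoord ∘ Set.domRestrict {v : Ambient d | v ≠ 0} normalized =
      fun v => ‖v.1‖⁻¹ • v.1 := funext fun v => sphereCoord_normalized v.2
  rw [this]
  exact Continuous.smul (Continuous.inv₀ (by fun_prop) fun v => norm_ne_zero_iff.2 v.2) (by fun_prop)

/-- The contraction of the complement of the antipode to the base point. -/
def contractFun {d : ℕ} (q : I × (sphere d).carrier) : (sphere d).carrier :=
  normalized ((1 - (q.1 : ℝ)) • sphereCoord q.2 + (q.1 : ℝ) • sphereCoord (sphere d).pt)

/-- If the segment from `y` to the base point meets the origin, equality of norms forces `t = 1/2`,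
and then `y` is the antipode. -/
theorem contract_ne_zero {d : ℕ} (t : I) (y : (sphere d).carrier) (hy : sphereCoord y 0 ≠ -1) :
    (1 - (t : ℝ)) • sphereCoord y + (t : ℝ) • sphereCoord (sphere d).pt ≠ 0 := by
  intro h
  have h' := eq_neg_of_add_eq_zero_left h
  have hn := congrArg norm h'
  rw [norm_neg, norm_smul, norm_smul, norm_sphereCoord, norm_sphereCoord, mul_one, mul_one,
    Real.norm_of_nonneg (by linarith [t.2.2]), Real.norm_of_nonneg t.2.1] at hn
  have ht : (t : ℝ) = 1 / 2 := by linarith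
  have h0 := congrArg (fun v : Ambient d => v 0) h
  rw [ht, sphereCoord_pt] at h0
  simp only [PiLp.add_apply, PiLp.smul_apply, PiLp.zero_apply, smul_eq_mul,
    PiLp.single_apply, if_true] at h0
  exact hy (by linarith)

theorem continuousOn_contractFun {d : ℕ} :
    ContinuousOn (contractFun (d := d)) {q | sphereCoord q.2 0 ≠ -1} := by
  refine continuousOn_normalized.comp (Continuous.continuousOn ?_)
    fun q hq => contract_ne_zero q.1 q.2 hq
  have := continuous_sphereCoord (d := d)
  fun_prop

theorem contractFun_zero {d : ℕ} (y : (sphere d).carrier) : contractFun (0, y) = y := by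
  simp [contractFun, normalized_sphereCoord]

theorem contractFun_one {d : ℕ} (y : (sphere d).carrier) : contractFun (1, y) = (sphere d).pt := by
  simp [contractFun, normalized_sphereCoord]

theorem contractFun_pt {d : ℕ} (t : I) : contractFun (t, (sphere d).pt) = (sphere d).pt := by
  rw [contractFun, ← add_smul, sub_add_cancel, one_smul, normalized_sphereCoord]

theorem abs_coord_le {d : ℕ} (v : Ambient d) (j : Fin (d + 1)) : |v j| ≤ ‖v‖ :=
  PiLp.norm_apply_le v j

/-- A map from a cube to a sphere of higher dimension may be approximated by a map whose
coordinates after the first never vanish simultaneously. -/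
theorem exists_approx {k d : ℕ} (hkd : k < d) (F : C(Fin k → I, (sphere d).carrier)) :
    ∃ G : C(Fin k → I, Ambient d), (∀ x, ‖G x - sphereCoord (F x)‖ < 1 / 4) ∧
      ∀ x, ∃ j : Fin d, G x j.succ ≠ 0 := by
  -- Clamping extends `F` to a uniformly continuous map on all of `ℝ^k`, where smooth approximation
  -- is available.
  let r : (Fin k → ℝ) → Fin k → I := fun x j => Set.projIcc 0 1 zero_le_one (x j)
  have hr : UniformContinuous r := by
    refine uniformContinuous_pi.2 fun j => ?_
    exact (LipschitzWith.projIcc (zero_le_one (α := ℝ))).uniformContinuous.comp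
      (Pi.uniformContinuous_proj _ j)
  have hri : ∀ x : Fin k → I, r (fun j => x j) = x := fun x => by
    funext j; exact Set.projIcc_val _ (x j)
  have hF : UniformContinuous fun x => sphereCoord (F x) :=
    CompactSpace.uniformContinuous_of_continuous (continuous_sphereCoord.comp F.continuous)
  obtain ⟨g, hg, hgF⟩ := (hF.comp hr).exists_contDiff_dist_le (ε := 1 / 8) (by norm_num)
  let e : (Fin d → ℝ) → Ambient d := fun p => WithLp.toLp 2 (Fin.cons 0 p)
  have he : Continuous e := by
    refine (PiLp.continuous_toLp 2 _).comp (continuous_pi fun j => ?_)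
    refine Fin.cases ?_ (fun j => ?_) j
    · simp only [Fin.cons_zero]; fun_prop
    · simp only [Fin.cons_succ]; fun_prop
  let g' : (Fin k → ℝ) → Fin d → ℝ := fun x j => g x j.succ
  have hg' : ContDiff ℝ 1 g' := by
    refine contDiff_pi.2 fun j => ?_
    exact ((EuclideanSpace.proj (𝕜 := ℝ) (j.succ : Fin (d + 1))).contDiff.comp hg).of_le (by simp)
  -- The image of a `C¹` map from `ℝ^k` to `ℝ^d` with `k < d` has dense complement. So some
  -- arbitrarily small `p` is not a value of the last `d` coordinates, and subtracting it makes them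
  -- vanish nowhere simultaneously.
  have hdense := hg'.dense_compl_range_of_finrank_lt_finrank (by simpa using hkd)
  obtain ⟨p, hp, hp'⟩ := hdense.exists_mem_open
    (isOpen_lt (he.norm) continuous_const : IsOpen {p | ‖e p‖ < 1 / 8})
    ⟨0, by
      have : e 0 = 0 := by
        ext j
        refine Fin.cases ?_ (fun j => ?_) j <;> simp [e]
      change ‖e 0‖ < 1 / 8
      rw [this]; norm_num⟩
  refine ⟨⟨fun x => g (fun j => x j) - e p, by
    have := hg.continuous
    fun_prop⟩, fun x => ?_, fun x => ?_⟩
  · have h1 := hgF fun j => x j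
    simp only [Function.comp_apply, hri, dist_eq_norm] at h1
    have h2 : ‖e p‖ < 1 / 8 := hp'
    calc ‖g (fun j => x j) - e p - sphereCoord (F x)‖
        = ‖(g (fun j => x j) - sphereCoord (F x)) - e p‖ := by congr 1; abel
      _ ≤ _ := norm_sub_le _ _
      _ < 1 / 4 := by linarith
  · by_contra hx
    push Not at hx
    refine hp ⟨fun j => x j, ?_⟩
    funext j
    have := hx j
    simp only [ContinuousMap.coe_mk, PiLp.sub_apply, e, Fin.cons_succ] at this
    linarith

/-- A map from a cube to a sphere of higher dimension may be deformed away from the antipode of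
the base point, without changing it near the base point. -/
theorem exists_deformation {k d : ℕ} (hkd : k < d) (F : C(Fin k → I, (sphere d).carrier)) :
    ∃ H : C(I × (Fin k → I), (sphere d).carrier), (∀ x, H (0, x) = F x) ∧
      (∀ x, sphereCoord (H (1, x)) 0 ≠ -1) ∧
      ∀ t x, 0 ≤ sphereCoord (F x) 0 → H (t, x) = F x := by
  obtain ⟨G, hG, hG'⟩ := exists_approx hkd F
  -- A cutoff that is `0` for `s ≥ 0`, where nothing may move, and `1` for `s ≤ -1/2`, where the
  -- approximation takes over completely.
  let c : ℝ → ℝ := fun s => max 0 (min 1 (-2 * s))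
  have hc0 : ∀ s, 0 ≤ c s := fun s => le_max_left _ _
  have hc1 : ∀ s, c s ≤ 1 := fun s => max_le zero_le_one (min_le_left _ _)
  let w : I × (Fin k → I) → Ambient d := fun q =>
    sphereCoord (F q.2) + ((q.1 : ℝ) * c (sphereCoord (F q.2) 0)) • (G q.2 - sphereCoord (F q.2))
  have hu : ∀ q : I × (Fin k → I), ‖((q.1 : ℝ) * c (sphereCoord (F q.2) 0)) •
      (G q.2 - sphereCoord (F q.2))‖ < 1 / 4 := fun q => by
    rw [norm_smul, Real.norm_of_nonneg (mul_nonneg q.1.2.1 (hc0 _))]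
    refine lt_of_le_of_lt (mul_le_of_le_one_left (norm_nonneg _) ?_) (hG q.2)
    exact mul_le_one₀ q.1.2.2 (hc0 _) (hc1 _)
  -- The displacement is shorter than `1/4`, so the vector stays away from the origin and may be
  -- normalized.
  have hw : ∀ q, 3 / 4 < ‖w q‖ := fun q => by
    have := norm_sub_norm_le (sphereCoord (F q.2)) (sphereCoord (F q.2) - w q)
    rw [norm_sphereCoord, sub_sub_cancel] at this
    have h2 : ‖sphereCoord (F q.2) - w q‖ < 1 / 4 := by
      rw [norm_sub_rev]
      simpa [w] using hu q
    linarith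
  have hw0 : ∀ q, w q ≠ 0 := fun q => norm_ne_zero_iff.1 (by linarith [hw q])
  have hwc : Continuous w := by
    have := continuous_sphereCoord (d := d)
    fun_prop
  refine ⟨⟨fun q => normalized (w q), continuousOn_normalized.comp_continuous hwc hw0⟩,
    fun x => ?_, fun x h => ?_, fun t x h => ?_⟩
  · change normalized (w (0, x)) = F x
    simp [w, normalized_sphereCoord]
  · change sphereCoord (normalized (w (1, x))) 0 = -1 at h
    rw [sphereCoord_normalized (hw0 _)] at h
    have hpos : 0 < ‖w (1, x)‖ := by linarith [hw (1, x)]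
    have h0 : w (1, x) 0 = -‖w (1, x)‖ := by
      simp only [PiLp.smul_apply, smul_eq_mul] at h
      field_simp at h
      linarith
    -- At the antipode the first coordinate of `w` would be `-‖w‖ < -3/4`. Where the cutoff is `1`,
    -- `w` is the approximation, and its other coordinates do not all vanish. Elsewhere the first
    -- coordinate exceeds `-1/2 - 1/4`.
    by_cases hs : sphereCoord (F x) 0 ≤ -1 / 2
    · have hcs : c (sphereCoord (F x) 0) = 1 := by
        simp only [c]
        rw [min_eq_left (by linarith), max_eq_right zero_le_one]
      have hwG : w (1, x) = G x := by simp [w, hcs]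
      rw [hwG] at h0
      obtain ⟨j, hj⟩ := hG' x
      have hn := EuclideanSpace.norm_sq_eq (G x)
      rw [Fin.sum_univ_succ, h0, norm_neg, norm_norm] at hn
      have hz : ∑ j : Fin d, ‖G x j.succ‖ ^ 2 = 0 := by linarith
      have := (Finset.sum_eq_zero_iff_of_nonneg (fun _ _ => sq_nonneg _)).1 hz j (Finset.mem_univ j)
      exact hj (by simpa using this)
    · push Not at hs
      have h2 := hu (1, x)
      have h3 : w (1, x) 0 = sphereCoord (F x) 0 + (((1 : I) : ℝ) * c (sphereCoord (F x) 0)) *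
        (G x - sphereCoord (F x)) 0 := by simp [w]
      have h4 := hw (1, x)
      have h5 := abs_coord_le ((((1 : I) : ℝ) * c (sphereCoord (F x) 0)) •
        (G x - sphereCoord (F x))) 0
      simp only [PiLp.smul_apply, smul_eq_mul] at h5
      have h6 := neg_le_of_abs_le h5
      simp only at h2
      linarith
  · change normalized (w (t, x)) = F x
    have hcs : c (sphereCoord (F x) 0) = 0 := by
      simp only [c]
      rw [min_eq_right (by linarith), max_eq_left (by linarith)]
    simp [w, hcs, normalized_sphereCoord]

/-- The constant pointed map. -/
def ptdZeroMap (X Y : PtdSpace) : PtdMap X Y := ⟨ContinuousMap.const _ Y.pt, rfl⟩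

/-! ### Projection of a wedge to one summand, and collapse of that summand -/

section Collapse

variable {ι : Type} [DecidableEq ι] (X : ι → PtdSpace) (l : ι)

/-- The projection of a wedge to a summand. -/
def wedgeProj : C((wedge X).carrier, (X l).carrier) :=
  wedgeLift (X l).pt
    (fun i => if h : i = l then h ▸ ContinuousMap.id _ else ContinuousMap.const _ (X l).pt)
    fun i => by
      split_ifs with h
      · subst h; rfl
      · rfl

/-- The map that collapses a summand of a wedge. -/
def wedgeCollapse : PtdMap (wedge X) (wedge X) :=
  wedgeDescMap fun i => if i = l then ptdZeroMap _ _ else wedgeInclMap X i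

theorem wedgeProj_incl (x : (X l).carrier) : wedgeProj X l ((wedgeInclMap X l).1 x) = x := by
  change (if h : l = l then h ▸ ContinuousMap.id _ else ContinuousMap.const _ (X l).pt :
    C((X l).carrier, (X l).carrier)) x = x
  simp

theorem wedgeCollapse_incl (x : (X l).carrier) :
    (wedgeCollapse X l).1 ((wedgeInclMap X l).1 x) = (wedge X).pt :=
  congrArg (fun m : PtdMap (X l) (wedge X) => m.1 x) (if_pos rfl)

/-- A point lies in the chosen summand or in the union of the others. Homotopies that move only one
summand are pasted along this dichotomy. -/
theorem wedge_cases (v : (wedge X).carrier) :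
    ((wedgeCollapse X l).1 v = (wedge X).pt ∧ (wedgeInclMap X l).1 (wedgeProj X l v) = v) ∨
      (wedgeProj X l v = (X l).pt ∧ (wedgeCollapse X l).1 v = v) := by
  induction v using wedge_ind with
  | h0 => exact Or.inr ⟨rfl, rfl⟩
  | h i x =>
    by_cases h : i = l
    · subst h
      rw [wedgeCollapse_incl, wedgeProj_incl]
      exact Or.inl ⟨rfl, rfl⟩
    · refine Or.inr ⟨?_, ?_⟩
      · change (if h : i = l then h ▸ ContinuousMap.id _ else ContinuousMap.const _ (X l).pt :
          C((X i).carrier, (X l).carrier)) x = _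
        rw [dif_neg h]; rfl
      · exact congrArg (fun m : PtdMap (X i) (wedge X) => m.1 x) (if_neg h)

/-- The preimage in each summand is the base point alone, as the projections to the summands show.
This closedness is needed to paste along the part of a cube that maps to one summand. -/
theorem isClosed_wedge_pt [∀ i, T1Space (X i).carrier] : IsClosed {(wedge X).pt} := by
  have hsep : ∀ i (x : (X i).carrier), (wedgeInclMap X i).1 x = (wedge X).pt → x = (X i).pt := by
    classical
    intro i x h
    have := congrArg (wedgeProj X i) h
    rwa [wedgeProj_incl] at this
  refine (isQuotientMap_quot_mk (r := WedgeRel X)).isClosed_preimage.1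
    (isClosed_sum_iff.2 ⟨?_, ?_⟩)
  · convert! isClosed_univ
    ext ⟨⟩
    exact iff_of_true rfl trivial
  · rw [isClosed_sigma_iff]
    intro i
    convert! isClosed_singleton (x := (X i).pt)
    ext x
    constructor
    · exact fun h => hsep i x h
    · rintro rfl
      exact (wedgeInclMap X i).2

end Collapse

/-- Maps from spheres to wedges of spheres do not see the summands of higher dimension. -/
theorem comp_wedgeCollapse {ι : Type} [DecidableEq ι] (n : ι → ℕ) (l : ι) {k : ℕ} [NeZero k]
    (hk : k < n l) (f : wedgeSphere k ⟶ wedge fun i => sphere (n i)) :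
    f ≫ (wedgeCollapse (fun i => sphere (n i)) l).toHom = f := by
  classical
  obtain ⟨f, rfl⟩ := PtdMap.toHom_surjective f
  let X : ι → PtdSpace := fun i => sphere (n i)
  obtain ⟨p, hp⟩ : ∃ p, p = toGenLoop k (wedge X) f := ⟨_, rfl⟩
  let π : C((wedge X).carrier, (sphere (n l)).carrier) := wedgeProj X l
  let j : C((sphere (n l)).carrier, (wedge X).carrier) := (wedgeInclMap X l).1
  let κ : C((wedge X).carrier, (wedge X).carrier) := (wedgeCollapse X l).1
  have hj : j (sphere (n l)).pt = (wedge X).pt := (wedgeInclMap X l).2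
  have hπj : ∀ x, π (j x) = x := wedgeProj_incl X l
  have hκj : ∀ x, κ (j x) = (wedge X).pt := wedgeCollapse_incl X l
  have hcases : ∀ v, (κ v = (wedge X).pt ∧ j (π v) = v) ∨ (π v = (sphere (n l)).pt ∧ κ v = v) :=
    wedge_cases X l
  have hpt0 : sphereCoord (sphere (n l)).pt 0 = 1 := by simp [sphereCoord_pt]
  have hjπ : ∀ v, sphereCoord (π v) 0 ≤ 0 → j (π v) = v := fun v hv =>
    (hcases v).elim (fun h => h.2) fun h => by
      rw [h.1, hpt0] at hv; linarith
  have hcoord := continuous_sphereCoord (d := n l)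
  obtain ⟨H, H0, H1, HF⟩ := exists_deformation hk (π.comp p.1)
  -- deform away from the antipode of the base point
  let K : C(I × (Fin k → I), (wedge X).carrier) :=
    ⟨fun q => if q ∈ {q : I × (Fin k → I) | 0 ≤ sphereCoord (π (p.1 q.2)) 0} then p.1 q.2
      else j (H q), by
      refine continuous_ite_of_isClosed (A := {q : I × (Fin k → I) | 0 ≤ sphereCoord (π (p.1 q.2)) 0})
        (B := {q : I × (Fin k → I) | sphereCoord (π (p.1 q.2)) 0 ≤ 0})
        (isClosed_le continuous_const (by fun_prop)) (isClosed_le (by fun_prop) continuous_const)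
        (fun q => (le_total 0 (sphereCoord (π (p.1 q.2)) 0) :)) (by fun_prop) (by fun_prop) fun q hq hq' => ?_
      rw [HF q.1 q.2 hq]
      exact (hjπ _ hq').symm⟩
  have hK : ∀ t x, 0 ≤ sphereCoord (π (p.1 x)) 0 → K (t, x) = p.1 x := fun t x h => if_pos h
  have hK' : ∀ t x, ¬ 0 ≤ sphereCoord (π (p.1 x)) 0 → K (t, x) = j (H (t, x)) :=
    fun t x h => if_neg h
  have hKb : ∀ t, ∀ x ∈ Cube.boundary (Fin k), K (t, x) = (wedge X).pt := fun t x hx => by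
    have : p.1 x = (wedge X).pt := p.2 x hx
    rw [hK, this]
    rw [this]
    change 0 ≤ sphereCoord (sphere (n l)).pt 0
    rw [hpt0]; exact zero_le_one
  let p' : Ω^ (Fin k) (wedge X).carrier (wedge X).pt :=
    ⟨K.comp ⟨fun x => (1, x), by fun_prop⟩, fun x hx => hKb 1 x hx⟩
  have hpp' : GenLoop.Homotopic p p' := by
    refine ⟨⟨⟨K, fun x => ?_, fun x => rfl⟩, fun t x hx => (hKb t x hx).trans (p.2 x hx).symm⟩⟩
    by_cases h : 0 ≤ sphereCoord (π (p.1 x)) 0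
    · exact hK 0 x h
    · refine (hK' 0 x h).trans ?_
      rw [H0]
      exact hjπ _ (not_le.1 h).le
  have hp'1 : ∀ x, sphereCoord (π (p'.1 x)) 0 ≠ -1 := fun x => by
    change sphereCoord (π (K (1, x))) 0 ≠ -1
    by_cases h : 0 ≤ sphereCoord (π (p.1 x)) 0
    · rw [hK 1 x h]; linarith
    · rw [hK' 1 x h, hπj]; exact H1 x
  -- contract the rest of the summand
  let L : C(I × (Fin k → I), (wedge X).carrier) :=
    ⟨fun q => if q ∈ {q : I × (Fin k → I) | κ (p'.1 q.2) = (wedge X).pt}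
      then j (contractFun (q.1, π (p'.1 q.2))) else p'.1 q.2, by
      refine continuous_ite_of_isClosed (B := {q | π (p'.1 q.2) = (sphere (n l)).pt})
        ((isClosed_wedge_pt X).preimage (by fun_prop : Continuous fun q : I × (Fin k → I) =>
          κ (p'.1 q.2)))
        (isClosed_eq (by fun_prop) continuous_const)
        (fun q => (hcases _).imp (fun h => h.1) fun h => h.1) ?_ (by fun_prop) fun q hq hq' => ?_
      · refine j.continuous.comp_continuousOn (Continuous.continuousOn ?_)
        exact continuousOn_contractFun.comp_continuous (by fun_prop) fun q => hp'1 q.2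
      · simp only [Set.mem_ofPred_eq] at hq hq'
        rw [hq', contractFun_pt, hj]
        rcases hcases (p'.1 q.2) with h | h
        · rw [← h.2, hq', hj]
        · exact (show κ (p'.1 q.2) = _ from hq).symm.trans h.2⟩
  have hL : ∀ t x, κ (p'.1 x) = (wedge X).pt → L (t, x) = j (contractFun (t, π (p'.1 x))) :=
    fun t x h => if_pos h
  have hL' : ∀ t x, ¬ κ (p'.1 x) = (wedge X).pt → L (t, x) = p'.1 x := fun t x h => if_neg h
  have hκ : ∀ v, κ v ≠ (wedge X).pt → κ v = v := fun v hv =>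
    (hcases v).elim (fun h => (hv h.1).elim) fun h => h.2
  let p'' : Ω^ (Fin k) (wedge X).carrier (wedge X).pt :=
    ⟨κ.comp p'.1, fun x hx => by
      rw [ContinuousMap.comp_apply, p'.2 x hx]; rfl⟩
  have hp'p'' : GenLoop.Homotopic p' p'' := by
    refine ⟨⟨⟨L, fun x => ?_, fun x => ?_⟩, fun t x hx => ?_⟩⟩
    · by_cases h : κ (p'.1 x) = (wedge X).pt
      · refine (hL 0 x h).trans ?_
        rw [contractFun_zero]
        rcases hcases (p'.1 x) with h' | h'
        · exact h'.2
        · rw [h'.1, hj]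
          exact h.symm.trans h'.2
      · exact hL' 0 x h
    · by_cases h : κ (p'.1 x) = (wedge X).pt
      · refine (hL 1 x h).trans ?_
        rw [contractFun_one, hj]
        exact h.symm
      · exact (hL' 1 x h).trans (hκ _ h).symm
    · have e : p'.1 x = (wedge X).pt := p'.2 x hx
      change L (t, x) = p'.1 x
      rw [hL t x (by rw [e]; rfl), e]
      change j (contractFun (t, (sphere (n l)).pt)) = _
      rw [contractFun_pt, hj]
  -- The collapse applied to the first deformation, run backwards, leads from the collapse of `p'`
  -- to the collapse of the original loop.
  have hκp : GenLoop.Homotopic p'' (toGenLoop k (wedge X) (f.comp (wedgeCollapse X l))) := by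
    obtain ⟨F⟩ := hpp'.symm
    subst hp
    refine ⟨⟨⟨κ.comp F.toContinuousMap, fun x => congrArg κ (F.apply_zero x),
      fun x => congrArg κ (F.apply_one x)⟩, fun t x hx => congrArg κ (F.eq_fst t hx)⟩⟩
  subst hp
  exact (toHom_eq_of_toGenLoop_homotopic (hpp'.trans (hp'p''.trans hκp))).symm

end PiAlgebra

end

end

section

open CategoryTheory Opposite

noncomputable section

namespace PiAlgebra

/-! ### Subwedges -/

section Subwedge

variable {ι κ : Type} (X : ι → PtdSpace) (e : κ → ι)

/-- The inclusion of a subwedge. -/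
def subwedgeIncl : wedge (fun k => X (e k)) ⟶ wedge X := wedgeDesc fun k => wedgeIncl X (e k)

@[simp]
theorem wedgeIncl_subwedgeIncl (k : κ) :
    wedgeIncl (fun k => X (e k)) k ≫ subwedgeIncl X e = wedgeIncl X (e k) :=
  wedgeIncl_desc _ k

theorem wedgeIncl_subwedgeIncl_assoc (k : κ) {W : PtdSpace} (g : wedge X ⟶ W) :
    wedgeIncl (fun k => X (e k)) k ≫ subwedgeIncl X e ≫ g = wedgeIncl X (e k) ≫ g := by
  rw [← Category.assoc, wedgeIncl_subwedgeIncl]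

open Classical in
/-- The component of the retraction to a subwedge at a summand. -/
def subwedgeRetrAux (i : ι) : X i ⟶ wedge (fun k => X (e k)) :=
  if h : ∃ k, e k = i then h.choose_spec ▸ wedgeIncl (fun k => X (e k)) h.choose else ptdZero _ _

/-- The retraction to a subwedge that collapses the other summands. -/
def subwedgeRetr : wedge X ⟶ wedge (fun k => X (e k)) := wedgeDesc (subwedgeRetrAux X e)

variable {e}

theorem wedgeIncl_subwedgeRetr (he : Function.Injective e) (k : κ) :
    wedgeIncl X (e k) ≫ subwedgeRetr X e = wedgeIncl (fun k => X (e k)) k := by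
  rw [subwedgeRetr, wedgeIncl_desc, subwedgeRetrAux, dif_pos ⟨k, rfl⟩]
  have : ∀ k' (h : e k' = e k),
      (h ▸ wedgeIncl (fun k => X (e k)) k' : X (e k) ⟶ wedge (fun k => X (e k))) =
        wedgeIncl (fun k => X (e k)) k := by
    intro k' h
    obtain rfl := he h
    rfl
  exact this _ _

theorem wedgeIncl_subwedgeRetr_of_notMem {i : ι} (hi : ∀ k, e k ≠ i) :
    wedgeIncl X i ≫ subwedgeRetr X e = ptdZero _ _ := by
  rw [subwedgeRetr, wedgeIncl_desc, subwedgeRetrAux, dif_neg (by simpa using hi)]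

theorem subwedge_incl_retr (he : Function.Injective e) :
    subwedgeIncl X e ≫ subwedgeRetr X e = 𝟙 _ :=
  wedge_hom_ext fun k => by
    rw [wedgeIncl_subwedgeIncl_assoc, wedgeIncl_subwedgeRetr X he, Category.comp_id]

end Subwedge

/-! ### Collapse of several high-dimensional summands -/

section

variable {ι : Type} (n : ι → ℕ)

open Classical in
/-- The map that collapses the summands in a set. -/
def collapseOn (s : Finset ι) : wedge (fun i => sphere (n i)) ⟶ wedge fun i => sphere (n i) :=
  wedgeDesc fun i => if i ∈ s then ptdZero _ _ else wedgeIncl (fun i => sphere (n i)) i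

theorem wedgeIncl_wedgeCollapse [DecidableEq ι] (X : ι → PtdSpace) (i l : ι) :
    wedgeIncl X i ≫ (wedgeCollapse X l).toHom =
      if i = l then ptdZero _ _ else wedgeIncl X i := by
  have : (wedgeInclMap X i).comp (wedgeCollapse X l) =
      if i = l then ptdZeroMap _ _ else wedgeInclMap X i := rfl
  refine (congrArg PtdMap.toHom this).trans ?_
  split_ifs <;> rfl

/-- The summands are collapsed one at a time, each by `comp_wedgeCollapse`. -/
theorem comp_collapseOn {k : ℕ} [NeZero k] (s : Finset ι) (hs : ∀ i ∈ s, k < n i)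
    (f : wedgeSphere k ⟶ wedge fun i => sphere (n i)) : f ≫ collapseOn n s = f := by
  classical
  induction s using Finset.induction_on with
  | empty =>
    have : collapseOn n ∅ = 𝟙 _ := wedge_hom_ext fun i => by simp [collapseOn]
    rw [this, Category.comp_id]
  | insert l s hl ih =>
    have : collapseOn n (insert l s) =
        collapseOn n s ≫ (wedgeCollapse (fun i => sphere (n i)) l).toHom := by
      refine wedge_hom_ext fun i => ?_
      simp only [collapseOn, wedgeIncl_desc, wedgeIncl_desc_assoc, Finset.mem_insert]
      by_cases h1 : i ∈ s
      · rw [if_pos (Or.inr h1), if_pos h1, ptdZero_comp]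
      · rw [if_neg h1, wedgeIncl_wedgeCollapse]
        simp [h1]
    rw [this, ← Category.assoc, ih fun i hi => hs i (Finset.mem_insert_of_mem hi)]
    exact comp_wedgeCollapse n l (hs l (Finset.mem_insert_self l s)) f

/-- A morphism from the sphere, as a morphism from the wedge with one summand. -/
def sphereDesc {k : ℕ} {Z : PtdSpace} (f : sphere k ⟶ Z) : wedgeSphere k ⟶ Z :=
  wedgeDesc (X := fun _ : Fin 1 => sphere k) fun _ => f

theorem wedgeSphereIncl_sphereDesc {k : ℕ} {Z : PtdSpace} (f : sphere k ⟶ Z) :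
    (wedgeSphereIncl k).toHom ≫ sphereDesc f = f :=
  wedgeIncl_desc (X := fun _ : Fin 1 => sphere k) (fun _ => f) 0

/-- Maps from spheres to wedges of spheres factor through the subwedge of summands of at most
the same dimension. -/
theorem comp_subwedge_retr_incl [Finite ι] {κ : Type} {e : κ → ι} (he : Function.Injective e)
    {k : ℕ} [NeZero k] (hk : ∀ i, (∀ j, e j ≠ i) → k < n i)
    (f : sphere k ⟶ wedge fun i => sphere (n i)) :
    f ≫ subwedgeRetr (fun i => sphere (n i)) e ≫ subwedgeIncl (fun i => sphere (n i)) e = f := by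
  classical
  have := Fintype.ofFinite ι
  let s : Finset ι := Finset.univ.filter fun i => ∀ j, e j ≠ i
  -- Retracting to the subwedge and including it again is the collapse of the summands left out, all
  -- of which have dimension above `k`.
  have hs : subwedgeRetr (fun i => sphere (n i)) e ≫ subwedgeIncl (fun i => sphere (n i)) e =
      collapseOn n s := by
    refine wedge_hom_ext fun i => ?_
    rw [collapseOn, wedgeIncl_desc]
    by_cases h : ∃ j, e j = i
    · obtain ⟨j, rfl⟩ := h
      rw [if_neg (by simp [s]), reassoc_of% (wedgeIncl_subwedgeRetr (fun i => sphere (n i)) he j)]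
      exact wedgeIncl_subwedgeIncl (fun i => sphere (n i)) (e := e) j
    · have h' : ∀ j, e j ≠ i := by simpa using h
      rw [if_pos (by simpa [s] using h'),
        reassoc_of% (wedgeIncl_subwedgeRetr_of_notMem (fun i => sphere (n i)) h'), ptdZero_comp]
  rw [hs]
  have key := comp_collapseOn n s (fun i hi => hk i (by simpa [s] using hi)) (sphereDesc f)
  rw [← wedgeSphereIncl_sphereDesc f, Category.assoc, key]

/-- With the empty subwedge in `comp_subwedge_retr_incl`, the map factors through a point. -/
theorem eq_ptdZero_of_lt [Finite ι] {k : ℕ} [NeZero k] (hk : ∀ i, k < n i)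
    (f : sphere k ⟶ wedge fun i => sphere (n i)) : f = ptdZero _ _ := by
  have h := comp_subwedge_retr_incl n (e := (Empty.elim : Empty → ι)) (fun i => i.elim)
    (fun i _ => hk i) f
  have h0 : subwedgeIncl (fun i => sphere (n i)) (Empty.elim : Empty → ι) = ptdZero _ _ :=
    wedge_hom_ext fun i => i.elim
  rw [← h, h0, comp_ptdZero, comp_ptdZero]

end

/-! ### The objects of `Π` -/

namespace SphereWedge

variable {a : ℕ} {b : ℕ∞}

/-- The dimension of a summand. -/
def deg (U : SphereWedge a b) (j : Fin U.card) : ℕ := (U.dim j).1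

instance (U : SphereWedge a b) (j : Fin U.card) : NeZero (U.deg j) :=
  ⟨Nat.one_le_iff_ne_zero.1 (U.dim j).2.1⟩

/-- The summands. -/
abbrev family (U : SphereWedge a b) (j : Fin U.card) : PtdSpace := PiAlgebra.sphere (U.deg j)

/-- A morphism of `Π` as a morphism of the homotopy category. -/
def toWedge {U V : SphereWedge a b} (f : U ⟶ V) : wedge U.family ⟶ wedge V.family := f

/-- A morphism of the homotopy category as a morphism of `Π`. -/
def ofWedge {U V : SphereWedge a b} (f : wedge U.family ⟶ wedge V.family) : U ⟶ V := f

theorem toWedge_injective {U V : SphereWedge a b} {f g : U ⟶ V} (h : toWedge f = toWedge g) :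
    f = g := h

theorem wedgeIncl_toWedge_summand (U : SphereWedge a b) (j : Fin U.card) (i) :
    wedgeIncl (sphere (U.dim j)).family i ≫ toWedge (U.summand j) = wedgeIncl U.family j := rfl

theorem wedgeIncl_toWedge_summand_comp {U V : SphereWedge a b} (j : Fin U.card) (f : U ⟶ V) (i) :
    wedgeIncl (sphere (U.dim j)).family i ≫ toWedge (U.summand j ≫ f) =
      wedgeIncl U.family j ≫ toWedge f :=
  (Category.assoc (wedgeIncl (sphere (U.dim j)).family i) (toWedge (U.summand j))
    (toWedge f)).symm

theorem comp_hom_ext {U V W : SphereWedge a b} {u : U ⟶ V} {v : V ⟶ W} {w : U ⟶ W}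
    (h : ∀ i, (wedgeIncl U.family i ≫ toWedge u) ≫ toWedge v = wedgeIncl U.family i ≫ toWedge w) :
    u ≫ v = w :=
  toWedge_injective (wedge_hom_ext fun i => (Category.assoc _ _ _).symm.trans (h i))

end SphereWedge

/-! ### Subwedges cut out by a condition on dimensions, and extension of algebras -/

section Sub

variable {a a' : ℕ} {b b' : ℕ∞} (p : ℕ → Prop)
  (hp : ∀ i : ℕ, 1 ≤ i → a ≤ i → (i : ℕ∞) ≤ b → p i → a' ≤ i ∧ (i : ℕ∞) ≤ b')

open Classical in
/-- The enumeration of the summands with property `p`. -/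
def subEquiv (U : SphereWedge a b) :
    Fin (Fintype.card {j : Fin U.card // p (U.deg j)}) ≃ {j : Fin U.card // p (U.deg j)} :=
  (Fintype.equivFin _).symm

include hp in
theorem sub_dim_mem (U : SphereWedge a b) (j : {j : Fin U.card // p (U.deg j)}) :
    1 ≤ U.deg j.1 ∧ a' ≤ U.deg j.1 ∧ (U.deg j.1 : ℕ∞) ≤ b' :=
  ⟨(U.dim j.1).2.1, hp _ (U.dim j.1).2.1 (U.dim j.1).2.2.1 (U.dim j.1).2.2.2 j.2⟩

open Classical in
/-- The subwedge of the summands whose dimension has property `p`. -/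
def sub (U : SphereWedge a b) : SphereWedge a' b' :=
  ⟨Fintype.card {j : Fin U.card // p (U.deg j)}, fun i =>
    ⟨U.deg (subEquiv p U i).1, sub_dim_mem p hp U (subEquiv p U i)⟩⟩

/-- The index in `U` of a summand of `sub U`. -/
def subIndex (U : SphereWedge a b) (i : Fin (sub p hp U).card) : Fin U.card := (subEquiv p U i).1

theorem subIndex_injective (U : SphereWedge a b) : Function.Injective (subIndex p hp U) :=
  Subtype.val_injective.comp (subEquiv p U).injective

theorem subIndex_mem (U : SphereWedge a b) (i : Fin (sub p hp U).card) :
    p (U.deg (subIndex p hp U i)) := (subEquiv p U i).2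

theorem exists_subIndex_eq {U : SphereWedge a b} {j : Fin U.card} (hj : p (U.deg j)) :
    ∃ i, subIndex p hp U i = j :=
  ⟨(subEquiv p U).symm ⟨j, hj⟩, congrArg Subtype.val ((subEquiv p U).apply_symm_apply ⟨j, hj⟩)⟩

/-- The inclusion of `sub U` in the homotopy category. -/
def subIncl (U : SphereWedge a b) : wedge (sub p hp U).family ⟶ wedge U.family :=
  subwedgeIncl U.family (subIndex p hp U)

/-- The retraction to `sub U` in the homotopy category. -/
def subRetr (U : SphereWedge a b) : wedge U.family ⟶ wedge (sub p hp U).family :=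
  subwedgeRetr U.family (subIndex p hp U)

theorem subIncl_subRetr (U : SphereWedge a b) : subIncl p hp U ≫ subRetr p hp U = 𝟙 _ :=
  subwedge_incl_retr _ (subIndex_injective p hp U)

theorem wedgeIncl_subIncl (U : SphereWedge a b) (i : Fin (sub p hp U).card) :
    wedgeIncl (sub p hp U).family i ≫ subIncl p hp U = wedgeIncl U.family (subIndex p hp U i) :=
  wedgeIncl_subwedgeIncl U.family (e := subIndex p hp U) i

theorem wedgeIncl_subRetr (U : SphereWedge a b) (i : Fin (sub p hp U).card) :
    wedgeIncl U.family (subIndex p hp U i) ≫ subRetr p hp U = wedgeIncl (sub p hp U).family i :=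
  wedgeIncl_subwedgeRetr _ (subIndex_injective p hp U) i

variable (ha : a ≤ a') (hb : b' ≤ b)

theorem map_map_eq (A : (SphereWedge a b)ᵒᵖ ⥤ Type) {U V W : SphereWedge a b} (f : U ⟶ V)
    (g : V ⟶ W) (x : A.obj (op W)) : A.map f.op (A.map g.op x) = A.map (f ≫ g).op x :=
  (congrArg (fun h => h x) (A.map_comp g.op f.op)).symm

/-- Every dimension of the smaller range has the property `p`, so nothing is collapsed. -/
theorem subRetr_subIncl_widen (hp' : ∀ i : ℕ, a' ≤ i → (i : ℕ∞) ≤ b' → p i)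
    (V : SphereWedge a' b') :
    subRetr p hp ((SphereWedge.widen ha hb).obj V) ≫ subIncl p hp _ = 𝟙 _ := by
  refine wedge_hom_ext fun j => ?_
  obtain ⟨i, rfl⟩ := exists_subIndex_eq p hp (U := (SphereWedge.widen ha hb).obj V) (j := j)
    (hp' _ (V.dim j).2.2.1 (V.dim j).2.2.2)
  refine (Category.assoc _ _ _).symm.trans ((congrArg (· ≫ subIncl p hp _)
    (wedgeIncl_subRetr p hp ((SphereWedge.widen ha hb).obj V) i)).trans ?_)
  exact (wedgeIncl_subIncl p hp _ i).trans (Category.comp_id _).symm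

/-- Passing to a subwedge and back does not lose information on composites. -/
def SubComp : Prop := ∀ (U V W : SphereWedge a b) (f : wedge U.family ⟶ wedge V.family)
  (g : wedge V.family ⟶ wedge W.family),
  (subIncl p hp U ≫ f ≫ subRetr p hp V) ≫ (subIncl p hp V ≫ g ≫ subRetr p hp W) =
    subIncl p hp U ≫ (f ≫ g) ≫ subRetr p hp W

variable {p hp}

/-- The functor that restricts to the summands with property `p`. -/
def subFunctor (H : SubComp p hp) : SphereWedge a b ⥤ SphereWedge a' b' where
  obj U := sub p hp U
  map {U V} f := SphereWedge.ofWedge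
    (subIncl p hp U ≫ SphereWedge.toWedge f ≫ subRetr p hp V)
  map_id U := by
    refine SphereWedge.toWedge_injective ?_
    change subIncl p hp U ≫ 𝟙 _ ≫ subRetr p hp U = 𝟙 _
    rw [Category.id_comp, subIncl_subRetr]
  map_comp {U V W} f g := SphereWedge.toWedge_injective (H U V W _ _).symm

/-- The passage to subwedges preserves the inclusions of the summands that are kept. The index `t`
appears because the subwedge of a single sphere carries its own enumeration. -/
theorem summand_subFunctor_map (H : SubComp p hp) (U : SphereWedge a b)
    (i : Fin (sub p hp U).card)
    (t : Fin (sub p hp (SphereWedge.sphere (U.dim (subIndex p hp U i)))).card) :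
    (SphereWedge.summand ((subFunctor H).obj (SphereWedge.sphere (U.dim (subIndex p hp U i)))) t :
      _ ⟶ (subFunctor H).obj _) ≫
      (subFunctor H).map (U.summand (subIndex p hp U i)) = (sub p hp U).summand i := by
  refine SphereWedge.comp_hom_ext (U := SphereWedge.sphere ((sub p hp U).dim i)) fun r => ?_
  refine (congrArg (· ≫ subIncl p hp _ ≫ SphereWedge.toWedge (U.summand (subIndex p hp U i)) ≫
    subRetr p hp U) (SphereWedge.wedgeIncl_toWedge_summand
      (sub p hp (SphereWedge.sphere (U.dim (subIndex p hp U i)))) t r)).trans ?_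
  refine (Category.assoc _ _ _).symm.trans ((congrArg (· ≫ SphereWedge.toWedge
    (U.summand (subIndex p hp U i)) ≫ subRetr p hp U) (wedgeIncl_subIncl p hp
      (SphereWedge.sphere (U.dim (subIndex p hp U i))) t)).trans ?_)
  refine (Category.assoc _ _ _).symm.trans ((congrArg (· ≫ subRetr p hp U)
    (SphereWedge.wedgeIncl_toWedge_summand U (subIndex p hp U i) _)).trans ?_)
  exact (wedgeIncl_subRetr p hp U i).trans
    (SphereWedge.wedgeIncl_toWedge_summand (sub p hp U) i r).symm

/-- A sphere that is kept contributes its own value, while one that is discarded contributes the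
value at the empty wedge, a singleton. So the product over all summands is the product over the kept
ones. -/
theorem sends_subFunctor (H : SubComp p hp) (B : PiAlg a' b') :
    SendsWedgesToProducts a b ((subFunctor H).op ⋙ B.obj) := by
  intro U
  have hmap : ∀ (i : Fin (sub p hp U).card) (t) (x : B.obj.obj (op (sub p hp U))),
      B.obj.map ((sub p hp (SphereWedge.sphere (U.dim (subIndex p hp U i)))).summand t).op
        (B.obj.map ((subFunctor H).map (U.summand (subIndex p hp U i))).op x) =
      B.obj.map ((sub p hp U).summand i).op x := by
    intro i t x
    exact (map_map_eq B.obj _ _ x).trans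
      (congrArg (fun f => B.obj.map (Quiver.Hom.op f) x) (summand_subFunctor_map H U i t))
  have hne : ∀ i : Fin (sub p hp U).card,
      ∃ t : Fin (sub p hp (SphereWedge.sphere (U.dim (subIndex p hp U i)))).card, True := fun i =>
    (exists_subIndex_eq p hp (U := SphereWedge.sphere (U.dim (subIndex p hp U i)))
      (j := (0 : Fin 1)) (subIndex_mem p hp U i)).imp fun _ _ => trivial
  choose t _ using hne
  constructor
  · intro x y h
    refine (B.property (sub p hp U)).1 (funext fun i => ?_)
    have h' := congrFun h (subIndex p hp U i)
    exact (hmap i (t i) x).symm.trans ((congrArg _ h').trans (hmap i (t i) y))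
  · intro z
    obtain ⟨x, hx⟩ := (B.property (sub p hp U)).2 fun i =>
      B.obj.map ((sub p hp (SphereWedge.sphere (U.dim (subIndex p hp U i)))).summand (t i)).op
        (z (subIndex p hp U i))
    refine ⟨x, funext fun j => ?_⟩
    refine (B.property (sub p hp (SphereWedge.sphere (U.dim j)))).1 (funext fun s => ?_)
    obtain ⟨i, rfl⟩ := exists_subIndex_eq p hp (U := U) (j := j)
      (subIndex_mem p hp (SphereWedge.sphere (U.dim j)) s)
    have hs : s = t i := by
      apply subIndex_injective p hp
      exact Subsingleton.elim (α := Fin 1) _ _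
    subst hs
    exact (hmap i (t i) x).trans (congrFun hx i)

/-- Extension of algebras by their values on subwedges. -/
def extension (H : SubComp p hp) : PiAlg a' b' ⥤ PiAlg a b where
  obj B := ⟨(subFunctor H).op ⋙ B.obj, sends_subFunctor H B⟩
  map f := ObjectProperty.homMk (Functor.whiskerLeft (subFunctor H).op f.hom)

/-- A subwedge of an object of `Π_a'^b'` is everything. -/
def widenSubIso (H : SubComp p hp) (hp' : ∀ i : ℕ, a' ≤ i → (i : ℕ∞) ≤ b' → p i) :
    SphereWedge.widen ha hb ⋙ subFunctor H ≅ 𝟭 (SphereWedge a' b') :=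
  NatIso.ofComponents (fun V =>
    { hom := SphereWedge.ofWedge (V := V) (subIncl p hp ((SphereWedge.widen ha hb).obj V))
      inv := SphereWedge.ofWedge (U := V) (subRetr p hp ((SphereWedge.widen ha hb).obj V))
      hom_inv_id := subIncl_subRetr p hp _
      inv_hom_id := subRetr_subIncl_widen p hp ha hb hp' V })
    (fun {V W} f => by
      change (subIncl p hp ((SphereWedge.widen ha hb).obj V) ≫ SphereWedge.toWedge f ≫
        subRetr p hp ((SphereWedge.widen ha hb).obj W)) ≫
          subIncl p hp ((SphereWedge.widen ha hb).obj W) =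
        subIncl p hp ((SphereWedge.widen ha hb).obj V) ≫ SphereWedge.toWedge f
      rw [Category.assoc, Category.assoc]
      refine congrArg _ ?_
      exact (congrArg _ (subRetr_subIncl_widen p hp ha hb hp' W)).trans (Category.comp_id _))

/-- Restricting an extension gives the algebra back. -/
def extensionRestrictionIso (H : SubComp p hp) (hp' : ∀ i : ℕ, a' ≤ i → (i : ℕ∞) ≤ b' → p i) :
    extension H ⋙ restriction ha hb ≅ 𝟭 (PiAlg a' b') :=
  NatIso.ofComponents (fun B => (SendsWedgesToProducts a' b').fullyFaithfulι.preimageIso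
    (Functor.isoWhiskerRight (NatIso.op (widenSubIso ha hb H hp').symm) B.obj ≪≫
      Functor.leftUnitor _))
    (fun {B B'} f => by
      refine ObjectProperty.hom_ext _ (NatTrans.ext (funext fun V => ?_))
      exact (f.hom.naturality (SphereWedge.ofWedge (U := V.unop)
        (subRetr p hp ((SphereWedge.widen ha hb).obj V.unop))).op).symm)

/-- Discarded spheres carry no information since `X` is trivial there, which gives injectivity. The
retraction to the subwedge gives surjectivity. -/
theorem bijective_map_subIncl (X : PiAlg a b)
    (hX : ∀ d : Dim a b, ¬ p d.1 → Subsingleton (X.obj.obj (op (SphereWedge.sphere d))))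
    (U : SphereWedge a b) :
    Function.Bijective (X.obj.map (SphereWedge.ofWedge
      (U := (SphereWedge.widen ha hb).obj (sub p hp U)) (V := U) (subIncl p hp U)).op) := by
  set i := SphereWedge.ofWedge (U := (SphereWedge.widen ha hb).obj (sub p hp U)) (V := U)
    (subIncl p hp U)
  constructor
  · intro x y h
    refine (X.property U).1 (funext fun j => ?_)
    by_cases hj : p (U.dim j).1
    · obtain ⟨t, rfl⟩ := exists_subIndex_eq p hp (U := U) (j := j) hj
      have e : ((SphereWedge.widen ha hb).obj (sub p hp U)).summand t ≫ i =
          U.summand (subIndex p hp U t) := by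
        refine SphereWedge.toWedge_injective (wedge_hom_ext fun r => ?_)
        exact (SphereWedge.wedgeIncl_toWedge_summand_comp
          (U := (SphereWedge.widen ha hb).obj (sub p hp U)) t i r).trans
            ((wedgeIncl_subIncl p hp U t).trans
              (SphereWedge.wedgeIncl_toWedge_summand U _ r).symm)
      change X.obj.map (U.summand _).op x = X.obj.map (U.summand _).op y
      rw [← e]
      exact (map_map_eq X.obj _ i x).symm.trans
        ((congrArg (X.obj.map (((SphereWedge.widen ha hb).obj (sub p hp U)).summand t).op) h).trans
          (map_map_eq X.obj _ i y))
    · exact (hX _ hj).elim _ _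
  · intro z
    refine ⟨X.obj.map (SphereWedge.ofWedge (U := U)
      (V := (SphereWedge.widen ha hb).obj (sub p hp U)) (subRetr p hp U)).op z, ?_⟩
    refine (map_map_eq X.obj _ _ z).trans ?_
    have : i ≫ SphereWedge.ofWedge (U := U) (V := (SphereWedge.widen ha hb).obj (sub p hp U))
      (subRetr p hp U) = 𝟙 _ := subIncl_subRetr p hp U
    rw [this]
    exact congrArg (fun f => f z) (X.obj.map_id _)

theorem subsingleton_extension (H : SubComp p hp) (B : PiAlg a' b') (d : Dim a b)
    (hd : ¬ p d.1) :
    Subsingleton (((extension H).obj B).obj.obj (op (SphereWedge.sphere d))) := by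
  refine ⟨fun x y => (B.property (sub p hp (SphereWedge.sphere d))).1 (funext fun i => ?_)⟩
  exact (hd (subIndex_mem p hp (SphereWedge.sphere d) i)).elim

theorem subsingleton_of_iso {X Y : PiAlg a b} (e : X ≅ Y) (U : SphereWedge a b)
    [h : Subsingleton (X.obj.obj (op U))] : Subsingleton (Y.obj.obj (op U)) := by
  refine ⟨fun x y => ?_⟩
  have hx : ∀ z : Y.obj.obj (op U), e.hom.hom.app (op U) (e.inv.hom.app (op U) z) = z := by
    intro z
    have := congrArg (fun f : Y ⟶ Y => f.hom.app (op U) z) e.inv_hom_id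
    exact this
  rw [← hx x, ← hx y, Subsingleton.elim (e.inv.hom.app (op U) x)]

end Sub

end PiAlgebra

end

end

section

open CategoryTheory Opposite

noncomputable section

namespace PiAlgebra

/-! ### Reflections and coreflections of algebras -/

section

variable {a a' : ℕ} {b b' : ℕ∞} {p : ℕ → Prop}
  {hp : ∀ i : ℕ, 1 ≤ i → a ≤ i → (i : ℕ∞) ≤ b → p i → a' ≤ i ∧ (i : ℕ∞) ≤ b'}
  (ha : a ≤ a') (hb : b' ≤ b)

theorem comp_regroup {C : Type*} [Category* C] {X₁ X₂ X₃ X₄ X₅ X₆ : C} (f₁ : X₁ ⟶ X₂)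
    (f₂ : X₂ ⟶ X₃) (f₃ : X₃ ⟶ X₄) (f₄ : X₄ ⟶ X₅) (f₅ : X₅ ⟶ X₆) :
    f₁ ≫ f₂ ≫ f₃ ≫ f₄ ≫ f₅ = (f₁ ≫ f₂ ≫ f₃) ≫ f₄ ≫ f₅ := by
  simp only [Category.assoc]

theorem comp_regroup' {C : Type*} [Category* C] {X₁ X₂ X₃ X₄ X₅ : C} (f₁ : X₁ ⟶ X₂)
    (f₂ : X₂ ⟶ X₃) (f₃ : X₃ ⟶ X₄) (f₄ : X₄ ⟶ X₅) :
    (f₁ ≫ f₂ ≫ f₃) ≫ f₄ = (f₁ ≫ f₂) ≫ f₃ ≫ f₄ := by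
  simp only [Category.assoc]

variable (hp) in
/-- Maps from objects of `Π_a'^b'` factor through subwedges. -/
def FactorsThroughSub : Prop := ∀ (U : SphereWedge a' b') (V : SphereWedge a b)
  (f : wedge U.family ⟶ wedge V.family), f ≫ subRetr p hp V ≫ subIncl p hp V = f

variable (hp) in
/-- Maps to objects of `Π_a'^b'` factor through the retractions to subwedges. -/
def FactorsThroughRetr : Prop := ∀ (U : SphereWedge a b) (V : SphereWedge a' b')
  (f : wedge U.family ⟶ wedge V.family), subRetr p hp U ≫ subIncl p hp U ≫ f = f

/-- The idempotent on the middle wedge is absorbed by the map before it, whose source is a subwedge.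
-/
theorem FactorsThroughSub.subComp (h : FactorsThroughSub hp) : SubComp p hp := by
  intro U V W f g
  have := congrArg (· ≫ g ≫ subRetr p hp W) (h (sub p hp U) V (subIncl p hp U ≫ f))
  simpa only [Category.assoc] using this

/-- Here the idempotent on the middle wedge is absorbed by the map after it, whose target is a
subwedge. -/
theorem FactorsThroughRetr.subComp (h : FactorsThroughRetr hp) : SubComp p hp := by
  intro U V W f g
  have := congrArg (fun k => subIncl p hp U ≫ f ≫ k) (h V (sub p hp W) (g ≫ subRetr p hp W))
  simpa only [Category.assoc] using this

/-- The inclusion is left adjoint to the passage to subwedges. -/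
def FactorsThroughSub.adj (h : FactorsThroughSub hp) :
    SphereWedge.widen ha hb ⊣ subFunctor h.subComp :=
  Adjunction.mkOfHomEquiv
    { homEquiv := fun U V =>
        { toFun := fun f => SphereWedge.ofWedge (U := U) (V := sub p hp V)
            ((SphereWedge.toWedge f : wedge U.family ⟶ wedge V.family) ≫ subRetr p hp V)
          invFun := fun g => SphereWedge.ofWedge (U := (SphereWedge.widen ha hb).obj U) (V := V)
            (SphereWedge.toWedge g ≫ subIncl p hp V : wedge U.family ⟶ _)
          left_inv := fun f => (Category.assoc _ _ _).trans (h U V _)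
          right_inv := fun g => (Category.assoc _ _ _).trans
            ((congrArg (SphereWedge.toWedge g ≫ ·) (subIncl_subRetr p hp V)).trans
              (Category.comp_id _)) }
      homEquiv_naturality_left_symm := fun {U U' V} f g =>
        Category.assoc (SphereWedge.toWedge f) (SphereWedge.toWedge g) (subIncl p hp V)
      homEquiv_naturality_right := fun {U V V'} f g => by
        refine (Category.assoc _ _ _).trans ((congrArg
          (· ≫ SphereWedge.toWedge g ≫ subRetr p hp V') (h U V f)).symm.trans ?_)
        exact comp_regroup' (X₁ := wedge U.family) f (subRetr p hp V) (subIncl p hp V) _ }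

/-- The inclusion is right adjoint to the passage to subwedges. -/
def FactorsThroughRetr.adj (h : FactorsThroughRetr hp) :
    subFunctor h.subComp ⊣ SphereWedge.widen ha hb :=
  Adjunction.mkOfHomEquiv
    { homEquiv := fun U V =>
        { toFun := fun f => SphereWedge.ofWedge (U := U) (V := (SphereWedge.widen ha hb).obj V)
            (subRetr p hp U ≫ SphereWedge.toWedge f : _ ⟶ wedge V.family)
          invFun := fun g => SphereWedge.ofWedge (U := sub p hp U) (V := V)
            (subIncl p hp U ≫ SphereWedge.toWedge g : _ ⟶ wedge V.family)
          left_inv := fun f => (Category.assoc _ _ _).symm.trans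
            ((congrArg (· ≫ SphereWedge.toWedge f) (subIncl_subRetr p hp U)).trans
              (Category.id_comp _))
          right_inv := fun g => h U V _ }
      homEquiv_naturality_left_symm := fun {U U' V} f g => by
        refine (congrArg (fun k => subIncl p hp U ≫ SphereWedge.toWedge f ≫ k)
          (h U' V g)).symm.trans ?_
        exact comp_regroup (subIncl p hp U) (SphereWedge.toWedge f) (subRetr p hp U') _ _
      homEquiv_naturality_right := fun {U V V'} f g =>
        (Category.assoc (subRetr p hp U) (SphereWedge.toWedge f) (SphereWedge.toWedge g)).symm }

/-- The restriction of algebras is left adjoint to the extension. -/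
def FactorsThroughSub.algAdj (h : FactorsThroughSub hp) :
    restriction ha hb ⊣ extension h.subComp :=
  -- Passing to opposites and precomposing each exchange left and right adjoints, so the side is the
  -- same as before.
  (((h.adj ha hb).op.whiskerLeft Type).restrictFullyFaithful
    (SendsWedgesToProducts a b).fullyFaithfulι (SendsWedgesToProducts a' b').fullyFaithfulι
    (Iso.refl _) (Iso.refl _))

/-- The restriction of algebras is right adjoint to the extension. -/
def FactorsThroughRetr.algAdj (h : FactorsThroughRetr hp) :
    extension h.subComp ⊣ restriction ha hb :=
  (((h.adj ha hb).op.whiskerLeft Type).restrictFullyFaithful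
    (SendsWedgesToProducts a' b').fullyFaithfulι (SendsWedgesToProducts a b).fullyFaithfulι
    (Iso.refl _) (Iso.refl _))

variable (hp' : ∀ i : ℕ, a' ≤ i → (i : ℕ∞) ≤ b' → p i)

theorem subsingleton_of_essImage_extension (H : SubComp p hp) {X : PiAlg a b}
    (hX : (extension H).essImage X) (d : Dim a b) (hd : ¬ p d.1) :
    Subsingleton (X.obj.obj (op (SphereWedge.sphere d))) := by
  obtain ⟨B, ⟨e⟩⟩ := hX
  have := subsingleton_extension H B d hd
  exact subsingleton_of_iso e _

-- Restriction along the inclusions of subwedges identifies `X` with the extension of its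
-- restriction; naturality holds because maps from a subwedge factor through a subwedge.
include ha hb in
theorem FactorsThroughSub.mem_essImage (h : FactorsThroughSub hp) {X : PiAlg a b}
    (hX : ∀ d : Dim a b, ¬ p d.1 → Subsingleton (X.obj.obj (op (SphereWedge.sphere d)))) :
    (extension h.subComp).essImage X := by
  let e (U : (SphereWedge a b)ᵒᵖ) :
      X.obj.obj U ≅ ((extension h.subComp).obj ((restriction ha hb).obj X)).obj.obj U :=
    (Equiv.ofBijective _ (bijective_map_subIncl (hp := hp) ha hb X hX U.unop)).toIso
  refine ⟨(restriction ha hb).obj X, ⟨((SendsWedgesToProducts a b).fullyFaithfulι.preimageIso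
    (X := X) (Y := (extension h.subComp).obj ((restriction ha hb).obj X))
    (NatIso.ofComponents e ?_)).symm⟩⟩
  intro U V f
  ext x
  refine (map_map_eq X.obj _ _ x).trans (Eq.trans ?_ (map_map_eq X.obj _ _ x).symm)
  refine congrArg (fun k => X.obj.map (Quiver.Hom.op k) x) ?_
  have := h (sub p hp V.unop) U.unop (subIncl p hp V.unop ≫ SphereWedge.toWedge f.unop)
  exact this.symm.trans (comp_regroup' (subIncl p hp V.unop) (SphereWedge.toWedge f.unop)
    (subRetr p hp U.unop) (subIncl p hp U.unop)).symm

/-- The retraction induces a one-sided inverse of the bijection induced by the inclusion. -/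
theorem bijective_map_subRetr (X : PiAlg a b)
    (hX : ∀ d : Dim a b, ¬ p d.1 → Subsingleton (X.obj.obj (op (SphereWedge.sphere d))))
    (U : SphereWedge a b) :
    Function.Bijective (X.obj.map (SphereWedge.ofWedge
      (U := U) (V := (SphereWedge.widen ha hb).obj (sub p hp U)) (subRetr p hp U)).op) := by
  have h := bijective_map_subIncl ha hb (hp := hp) X hX U
  have hs : ∀ z, X.obj.map (SphereWedge.ofWedge (U := (SphereWedge.widen ha hb).obj (sub p hp U))
      (V := U) (subIncl p hp U)).op (X.obj.map (SphereWedge.ofWedge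
      (U := U) (V := (SphereWedge.widen ha hb).obj (sub p hp U)) (subRetr p hp U)).op z) = z := by
    intro z
    refine (map_map_eq X.obj _ _ z).trans ?_
    refine (congrArg (fun k => X.obj.map (Quiver.Hom.op k) z) (subIncl_subRetr p hp U)).trans ?_
    exact congrArg (fun f => f z) (X.obj.map_id _)
  exact ⟨Function.LeftInverse.injective hs, fun x => ⟨_, h.1 (hs _)⟩⟩

include ha hb in
theorem FactorsThroughRetr.mem_essImage (h : FactorsThroughRetr hp) {X : PiAlg a b}
    (hX : ∀ d : Dim a b, ¬ p d.1 → Subsingleton (X.obj.obj (op (SphereWedge.sphere d)))) :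
    (extension h.subComp).essImage X := by
  let e (U : (SphereWedge a b)ᵒᵖ) :
      ((extension h.subComp).obj ((restriction ha hb).obj X)).obj.obj U ≅ X.obj.obj U :=
    (Equiv.ofBijective _ (bijective_map_subRetr (hp := hp) ha hb X hX U.unop)).toIso
  refine ⟨(restriction ha hb).obj X, ⟨(SendsWedgesToProducts a b).fullyFaithfulι.preimageIso
    (NatIso.ofComponents e ?_)⟩⟩
  intro U V f
  ext x
  refine (map_map_eq X.obj _ _ x).trans (Eq.trans ?_ (map_map_eq X.obj _ _ x).symm)
  refine congrArg (fun k => X.obj.map (Quiver.Hom.op k) x) ?_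
  exact h V.unop (sub p hp U.unop) (SphereWedge.toWedge f.unop ≫ subRetr p hp U.unop)

-- The extension is fully faithful because restricting an extension returns the original algebra.
include ha hb hp' in
theorem FactorsThroughSub.isReflectionOnto (h : FactorsThroughSub hp) :
    IsReflectionOnto (restriction ha hb)
      (fun X : PiAlg a b => ∀ d : Dim a b, ¬ p d.1 →
        Subsingleton (X.obj.obj (op (SphereWedge.sphere d)))) := by
  have ff := (h.algAdj ha hb).fullyFaithfulROfCompIsoId
    (extensionRestrictionIso ha hb h.subComp hp')
  exact ⟨_, ⟨h.algAdj ha hb⟩, ff.full, ff.faithful, fun X =>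
    ⟨fun hX => subsingleton_of_essImage_extension _ hX, h.mem_essImage ha hb⟩⟩

include ha hb hp' in
theorem FactorsThroughRetr.isCoreflectionOnto (h : FactorsThroughRetr hp) :
    IsCoreflectionOnto (restriction ha hb)
      (fun X : PiAlg a b => ∀ d : Dim a b, ¬ p d.1 →
        Subsingleton (X.obj.obj (op (SphereWedge.sphere d)))) := by
  have ff := (h.algAdj ha hb).fullyFaithfulLOfCompIsoId
    (extensionRestrictionIso ha hb h.subComp hp')
  exact ⟨_, ⟨h.algAdj ha hb⟩, ff.full, ff.faithful, fun X =>
    ⟨fun hX => subsingleton_of_essImage_extension _ hX, h.mem_essImage ha hb⟩⟩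

end

/-- On each sphere of dimension at most `n` this is `comp_subwedge_retr_incl`: the discarded
summands have larger dimension. -/
theorem factorsThroughSub_truncation (a n : ℕ) :
    FactorsThroughSub (a := a) (b := ⊤) (a' := a) (b' := n) (p := fun i => i ≤ n)
      (fun i _ h _ hn => ⟨h, by exact_mod_cast hn⟩) := by
  intro U V f
  refine wedge_hom_ext fun j => ?_
  refine Eq.trans (Category.assoc _ _ _).symm ?_
  have h := comp_subwedge_retr_incl (k := U.deg j) V.deg
    (subIndex_injective (fun i => i ≤ n) (a' := a) (b' := n)
      (fun i _ h _ hn => ⟨h, by exact_mod_cast hn⟩) V) (fun i hi => ?_)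
    (wedgeIncl U.family j ≫ f)
  · exact h
  · by_contra hlt
    have hj : U.deg j ≤ n := by exact_mod_cast (U.dim j).2.2.2
    obtain ⟨t, ht⟩ := exists_subIndex_eq (fun i => i ≤ n) (a' := a) (b' := n)
      (fun i _ h _ hn => ⟨h, by exact_mod_cast hn⟩) (U := V) (j := i) (by omega)
    exact hi t ht

/-- On the summands that are kept nothing changes; on the others, of dimension at most `m`, every
map to a wedge of spheres of dimension above `m` is trivial. -/
theorem factorsThroughRetr_cover (m : ℕ) (b : ℕ∞) :
    FactorsThroughRetr (a := 1) (b := b) (a' := m + 1) (b' := b) (p := fun i => m < i)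
      (fun _ _ _ h hn => ⟨hn, h⟩) := by
  intro U V f
  refine wedge_hom_ext fun j => ?_
  by_cases hj : m < U.deg j
  · obtain ⟨t, rfl⟩ := exists_subIndex_eq (fun i => m < i) (a' := m + 1) (b' := b)
      (fun _ _ _ h hn => ⟨hn, h⟩) (U := U) (j := j) hj
    refine (Category.assoc _ _ _).symm.trans ((congrArg (· ≫ subIncl _ _ U ≫ f)
      (wedgeIncl_subRetr _ _ U t)).trans ?_)
    exact (Category.assoc _ _ _).symm.trans (congrArg (· ≫ f) (wedgeIncl_subIncl _ _ U t))
  · have key : ∀ g : PiAlgebra.sphere (U.deg j) ⟶ wedge V.family, g = ptdZero _ _ := fun g =>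
      eq_ptdZero_of_lt V.deg (fun i => lt_of_le_of_lt (not_lt.1 hj) (V.dim i).2.2.1) g
    exact (key _).trans (key _).symm

theorem truncation_isReflectionOnto (a n : ℕ) :
    IsReflectionOnto (truncation a n) (IsTruncated n) := by
  obtain ⟨ι, h1, h2, h3, h4⟩ := (factorsThroughSub_truncation a n).isReflectionOnto le_rfl le_top
    (fun i _ h => by exact_mod_cast h)
  exact ⟨ι, h1, h2, h3, fun X => (h4 X).trans ⟨fun h d hd => h d (not_le.2 hd), fun h d hd => h d (not_le.1 hd)⟩⟩

theorem cover_isCoreflectionOnto (m : ℕ) (b : ℕ∞) :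
    IsCoreflectionOnto (cover m b) (IsConnected m) := by
  obtain ⟨ι, h1, h2, h3, h4⟩ := (factorsThroughRetr_cover m b).isCoreflectionOnto
    (Nat.le_add_left 1 m) le_rfl (fun _ h _ => h)
  exact ⟨ι, h1, h2, h3, fun X => (h4 X).trans ⟨fun h d hd => h d (not_lt.2 hd), fun h d hd => h d (not_lt.1 hd)⟩⟩

end PiAlgebra

end

end

section

open CategoryTheory Opposite Limits Simplicial

noncomputable section

namespace PiAlgebra

/-! ### Cofibrant replacements -/

/-- In a locally presentable category each source is presentable for some cardinal, and a regular
cardinal above all of these serves the whole set of maps. -/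
theorem hasSmallObjectArgument_ofHoms {C : Type 1} [Category.{0} C] [IsLocallyPresentable.{0} C]
    {ι : Type} {S T : ι → C} (f : ∀ i, S i ⟶ T i) :
    MorphismProperty.HasSmallObjectArgument.{0} (MorphismProperty.ofHoms f) := by
  have (i : ι) : ∃ (κ : Cardinal.{0}) (_ : Fact κ.IsRegular), IsCardinalPresentable (S i) κ := by
    obtain ⟨κ, h1, h2⟩ := Functor.IsAccessible.exists_cardinal.{0} (F := coyoneda.obj (op (S i)))
    exact ⟨κ, h1, h2⟩
  choose κ h1 h2 using this
  obtain ⟨κ', hκ', h⟩ := HasCardinalLT.exists_regular_cardinal_forall.{0} (fun i => (κ i).ord.ToType)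
  have : Fact κ'.IsRegular := ⟨hκ'⟩
  have : Nonempty κ'.ord.ToType := by simpa using hκ'.ne_zero
  have := WellFoundedLT.toOrderBot κ'.ord.ToType
  have hS : MorphismProperty.IsSmall.{0} (MorphismProperty.ofHoms f) :=
    MorphismProperty.isSmall_ofHoms f
  have : HasColimitsOfSize.{0, 0} C := by
    obtain ⟨κ, _, _⟩ := IsLocallyPresentable.exists_cardinal.{0} C
    infer_instance
  refine ⟨κ', inferInstance, inferInstance, { preservesColimit := ?_ }⟩
  rintro A B Z W i hi g hg
  obtain ⟨j⟩ := hi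
  have hle : κ j ≤ κ' := by
    have := (h j).le
    simpa using this
  have := isCardinalPresentable_of_le (S j) hle
  have := preservesColimitsOfShape_of_isCardinalPresentable (S j) κ' κ'.ord.ToType
  infer_instance

variable {a : ℕ} {b : ℕ∞}

/-- The comparison from the coproduct of the presheaves represented by the summands of a wedge. -/
def wedgeCell (U : SphereWedge a b) :
    (∐ fun j : Fin U.card => yoneda.obj (SphereWedge.sphere (U.dim j))) ⟶ yoneda.obj U :=
  Sigma.desc fun j => yoneda.map (U.summand j)

variable (a b) in
/-- The comparison maps of presheaves that are inverted by algebras. -/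
abbrev wedgeCells : MorphismProperty ((SphereWedge a b)ᵒᵖ ⥤ Type) :=
  MorphismProperty.ofHoms (wedgeCell (a := a) (b := b))

/-- By the Yoneda lemma, maps out of the coproduct of representables are tuples of elements at the
summands. -/
theorem bijective_wedgeCell_comp_iff (U : SphereWedge a b) (A : (SphereWedge a b)ᵒᵖ ⥤ Type) :
    Function.Bijective (fun g : yoneda.obj U ⟶ A => wedgeCell U ≫ g) ↔
      Function.Bijective fun (x : A.obj (op U)) (j : Fin U.card) => A.map (U.summand j).op x := by
  let e : ((∐ fun j : Fin U.card => yoneda.obj (SphereWedge.sphere (U.dim j))) ⟶ A) ≃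
      ∀ j : Fin U.card, A.obj (op (SphereWedge.sphere (U.dim j))) :=
    { toFun := fun g j => yonedaEquiv
        (Sigma.ι (fun j => yoneda.obj (SphereWedge.sphere (U.dim j))) j ≫ g)
      invFun := fun x => Sigma.desc fun j => yonedaEquiv.symm (x j)
      left_inv := fun g => by
        refine Sigma.hom_ext _ _ fun j => ?_
        simp
      right_inv := fun x => by
        funext j
        simp }
  rw [← Function.Bijective.of_comp_iff' e.bijective, ← Function.Bijective.of_comp_iff _
    (yonedaEquiv (X := U) (F := A)).bijective]
  refine iff_of_eq (congrArg Function.Bijective (funext fun g => funext fun j => ?_))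
  have : Sigma.ι (fun j => yoneda.obj (SphereWedge.sphere (U.dim j))) j ≫ wedgeCell U ≫ g = yoneda.map (U.summand j) ≫ g := by
    rw [← Category.assoc, wedgeCell, colimit.ι_desc]
    rfl
  refine (congrArg yonedaEquiv this).trans ?_
  exact (yonedaEquiv_naturality g (U.summand j)).symm

/-- This exhibits algebras as a class of local presheaves, from which local presentability, the
reflection of presheaves and closure under limits all follow. -/
theorem sendsWedgesToProducts_eq_isLocal :
    SendsWedgesToProducts a b = (wedgeCells a b).isLocal := by
  ext A
  constructor
  · rintro h _ _ _ ⟨U⟩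
    exact (bijective_wedgeCell_comp_iff U A).2 (h U)
  · intro h U
    exact (bijective_wedgeCell_comp_iff U A).1 (h _ ⟨U⟩)

attribute [local instance] Cardinal.fact_isRegular_aleph0

/-- Maps out of a representable are evaluation at an object, which preserves all colimits. -/
instance (U : SphereWedge a b) : IsCardinalPresentable (yoneda.obj U) Cardinal.aleph0.{0} where
  preservesColimitOfShape J _ _ := by
    let e : (coyoneda.obj (op (yoneda.obj U))) ≅ (CategoryTheory.evaluation _ Type).obj (op U) :=
      NatIso.ofComponents (fun P ↦ Equiv.toIso yonedaEquiv)
    exact preservesColimitsOfShape_of_natIso e.symm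

theorem wedgeCells_presentable ⦃X Y : (SphereWedge a b)ᵒᵖ ⥤ Type⦄ (f : X ⟶ Y)
    (hf : wedgeCells a b f) :
    IsCardinalPresentable X Cardinal.aleph0.{0} ∧ IsCardinalPresentable Y Cardinal.aleph0.{0} := by
  obtain ⟨U⟩ := hf
  refine ⟨?_, inferInstance⟩
  have (k : Discrete (Fin U.card)) : IsCardinalPresentable ((Discrete.functor fun j : Fin U.card =>
      yoneda.obj (SphereWedge.sphere (U.dim j))).obj k) Cardinal.aleph0.{0} :=
    inferInstanceAs (IsCardinalPresentable (yoneda.obj (SphereWedge.sphere (U.dim k.as))) _)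
  refine isCardinalPresentable_of_isColimit _ (colimit.isColimit (Discrete.functor
    fun j : Fin U.card => yoneda.obj (SphereWedge.sphere (U.dim j)))) _ ?_
  exact hasCardinalLT_of_finite _ _ le_rfl

instance : IsLocallyPresentable.{0} (PiAlg a b) := by
  unfold PiAlg
  rw [sendsWedgesToProducts_eq_isLocal]
  exact ⟨_, inferInstance, (wedgeCells a b).isLocallyPresentable_isLocal Cardinal.aleph0.{0}
    wedgeCells_presentable⟩

instance : (SendsWedgesToProducts a b).ι.IsRightAdjoint := by
  rw [sendsWedgesToProducts_eq_isLocal]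
  exact (wedgeCells a b).isRightAdjoint_ι_isLocal Cardinal.aleph0.{0} wedgeCells_presentable

instance (U : SphereWedge a b) : (evaluation U).IsRightAdjoint := by
  unfold evaluation
  infer_instance

instance (J : Type) [Category.{0} J] :
    (SendsWedgesToProducts a b).IsClosedUnderLimitsOfShape J := by
  rw [sendsWedgesToProducts_eq_isLocal]
  infer_instance

instance : HasPullbacks (PiAlg a b) := inferInstance

instance : IsLocallyPresentable.{0} (SimplicialObject (PiAlg a b)) :=
  inferInstanceAs (IsLocallyPresentable.{0} (SimplexCategoryᵒᵖ ⥤ PiAlg a b))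

/-- The functor that is left adjoint to the evaluation at a sphere. -/
def freeOn (d : Dim a b) : SSet.{0} ⥤ SimplicialObject (PiAlg a b) :=
  ((SimplicialObject.whiskering _ _).obj (evaluation (SphereWedge.sphere d)).leftAdjoint)

/-- Free simplicial algebras. -/
def freeOnAdj (d : Dim a b) : freeOn d ⊣
    (SimplicialObject.whiskering _ _).obj (evaluation (SphereWedge.sphere d)) :=
  (Adjunction.ofIsRightAdjoint (evaluation (SphereWedge.sphere d))).whiskerRight SimplexCategoryᵒᵖ

/-- The generating cofibrations of simplicial algebras. -/
def generatingCofibration (x : Dim a b × ℕ) :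
    (freeOn x.1).obj (SSet.boundary x.2 : SSet.{0}) ⟶ (freeOn x.1).obj (SSet.stdSimplex.obj ⦋x.2⦌) :=
  (freeOn x.1).map (SSet.boundary x.2).ι

/-- Lifting problems transpose along the adjunction between free simplicial algebras and evaluation
at a sphere. -/
theorem isAcyclicFibration_iff {X Y : SimplicialObject (PiAlg a b)} (f : X ⟶ Y) :
    IsAcyclicFibration f ↔ (MorphismProperty.ofHoms
      (generatingCofibration (a := a) (b := b))).rlp f := by
  constructor
  · rintro h _ _ _ ⟨d, n⟩
    exact ((freeOnAdj d).hasLiftingProperty_iff _ _).2 (h d _ ⟨n⟩)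
  · rintro h d _ _ _ ⟨n⟩
    exact ((freeOnAdj d).hasLiftingProperty_iff _ _).1 (h _ ⟨(d, n)⟩)

instance : MorphismProperty.HasSmallObjectArgument.{0}
    (MorphismProperty.ofHoms (generatingCofibration (a := a) (b := b))) :=
  hasSmallObjectArgument_ofHoms _

/-- A simplicial object with a map to a constant object, as a simplicial object over it. -/
def overOfAugmentation {A : PiAlg a b} {C : SimplicialObject (PiAlg a b)}
    (p : C ⟶ (SimplicialObject.const (PiAlg a b)).obj A) : SimplicialObject (Over A) where
  obj k := Over.mk (p.app k)
  map f := Over.homMk (C.map f) ((p.naturality f).trans (Category.comp_id _))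

/-- The map from the initial object to the constant object `A` is factored by the small object
argument; its second factor serves as the augmentation. -/
theorem nonempty_cofibrantReplacement (A : PiAlg a b) : Nonempty (CofibrantReplacement A) := by
  have : HasColimitsOfSize.{0, 0} (SimplicialObject (PiAlg a b)) := by
    obtain ⟨κ, _, _⟩ := IsLocallyPresentable.exists_cardinal.{0} (SimplicialObject (PiAlg a b))
    infer_instance
  let I := MorphismProperty.ofHoms (generatingCofibration (a := a) (b := b))
  let h := MorphismProperty.factorizationData I.rlp.llp I.rlp
    (initial.to ((SimplicialObject.const (PiAlg a b)).obj A))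
  refine ⟨⟨overOfAugmentation h.p, ?_, (isAcyclicFibration_iff h.p).2 h.hp⟩⟩
  intro X Y p hp g
  have : HasLiftingProperty h.i p := h.hi p ((isAcyclicFibration_iff p).1 hp)
  have sq : CommSq (initial.to X) h.i p (show h.Z ⟶ Y from g) := ⟨initial.hom_ext _ _⟩
  exact ⟨sq.lift, sq.fac_right⟩

end PiAlgebra

end

end

section

open CategoryTheory Opposite Limits Simplicial MonoidalCategory

noncomputable section

namespace PiAlgebra

/-! ### Homotopies of simplicial sets over a discrete simplicial set -/

section Simplicial

/-- A simplicial homotopy to a constant object is constant. -/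
theorem homotopy_const_h {D : Type*} [Category* D] {X : SimplicialObject D} {A : D}
    {f g : X ⟶ (SimplicialObject.const D).obj A} (H : SimplicialObject.Homotopy f g) (n : ℕ)
    (i : Fin (n + 1)) : H.h i = f.app (op ⦋n⦌) := by
  have hδ : ∀ (k : ℕ) (j : Fin (k + 2)), ((SimplicialObject.const D).obj A).δ j = 𝟙 A :=
    fun _ _ => rfl
  -- Consecutive components share a face, and the faces of a constant object are identities, so all
  -- components equal the last one.
  induction i using Fin.reverseInduction with
  | last =>
    have := H.h_last_comp_δ_last n
    exact (Category.comp_id _).symm.trans this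
  | cast j ih =>
    cases n with
    | zero => exact j.elim0
    | succ n =>
      have := H.h_succ_comp_δ_castSucc_succ j
      exact ((Category.comp_id _).symm.trans this.symm).trans ((Category.comp_id _).trans ih)

theorem homotopy_const_eq {D : Type*} [Category* D] {X : SimplicialObject D} {A : D}
    {f g : X ⟶ (SimplicialObject.const D).obj A} (H : SimplicialObject.Homotopy f g) : f = g := by
  ext n
  obtain ⟨n⟩ := n
  induction n using SimplexCategory.rec with | _ n
  exact (homotopy_const_h H n 0).symm.trans
    ((Category.comp_id _).symm.trans (H.h_zero_comp_δ_zero n))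

/-- The homotopy given by a map from a cylinder. -/
def cylinderHomotopy {K Y : SSet.{0}} (H : K ⊗ Δ[1] ⟶ Y) :
    SSet.Homotopy (SSet.ι₀ ≫ H) (SSet.ι₁ ≫ H) where
  h := H
  h₀ := rfl
  h₁ := rfl
  rel := by
    ext m ⟨⟨_, hx⟩, _⟩
    exact hx.elim

theorem cylinder_ends_eq {K : SSet.{0}} {T : Type}
    (H : K ⊗ Δ[1] ⟶ (SimplicialObject.const Type).obj T) : SSet.ι₀ ≫ H = SSet.ι₁ ≫ H :=
  homotopy_const_eq (cylinderHomotopy H).toSimplicialObjectHomotopy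

/-- The constant simplex of `Δ[1]` at a vertex. -/
abbrev endpoint (e : Fin 2) (m : SimplexCategoryᵒᵖ) : (Δ[1] : SSet.{0}).obj m :=
  SSet.stdSimplex.const 1 e m

theorem endpoint_injective (m : SimplexCategoryᵒᵖ) : Function.Injective (endpoint · m) := by
  intro e e' h
  exact congrArg (fun s : (Δ[1] : SSet.{0}).obj m => SSet.stdSimplex.asOrderHom s 0) h

/-- A simplex of a discrete simplicial set is determined by any of its vertices. A vertex of `Δ[1]`
is one of the two ends, and the ends of a homotopy to a discrete object agree. -/
theorem cylinder_const {K : SSet.{0}} {T : Type}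
    (H : K ⊗ Δ[1] ⟶ (SimplicialObject.const Type).obj T) {m : SimplexCategoryᵒᵖ} (k : K.obj m)
    (s s' : (Δ[1] : SSet.{0}).obj m) : H.app m (k, s) = H.app m (k, s') := by
  have hv : ∀ s : (Δ[1] : SSet.{0}).obj m, H.app m (k, s) = H.app (op ⦋0⦌)
      (K.map (SimplexCategory.const ⦋0⦌ m.unop 0).op k,
        (Δ[1] : SSet.{0}).map (SimplexCategory.const ⦋0⦌ m.unop 0).op s) := fun s =>
    (congrArg (fun f => f (k, s)) (H.naturality (SimplexCategory.const ⦋0⦌ m.unop 0).op)).symm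
  have h0 : ∀ t : (Δ[1] : SSet.{0}).obj (op ⦋0⦌), ∀ x : K.obj (op ⦋0⦌),
      H.app (op ⦋0⦌) (x, t) = H.app (op ⦋0⦌) (x, endpoint 0 _) := by
    intro t x
    obtain ⟨e, rfl⟩ := SSet.stdSimplex.obj₀Equiv.symm.surjective t
    obtain rfl | rfl : e = 0 ∨ e = 1 := by fin_cases e <;> simp
    · rfl
    · exact (congrArg (fun f => f.app (op ⦋0⦌) x) (cylinder_ends_eq H)).symm
  exact (hv s).trans ((h0 _ _).trans ((h0 _ _).symm.trans (hv s').symm))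

/-- This lifts against the inclusion of `K × Δ[1] ∪ L × ∂Δ[1]` in `L × Δ[1]`, a monomorphism. That
the target is discrete makes the homotopy on `K` automatically one over `T`. -/
theorem exists_homotopy_extension {K L Y : SSet.{0}} {T : Type}
    (p : Y ⟶ (SimplicialObject.const Type).obj T) (hp : SSet.modelCategoryQuillen.I.{0}.rlp p)
    (i : K ⟶ L) [hi : Mono i] (G : K ⊗ Δ[1] ⟶ Y) (u : Fin 2 → (L ⟶ Y))
    (hu : ∀ e m k, (u e).app m (i.app m k) = G.app m (k, endpoint e m))
    (huv : u 0 ≫ p = u 1 ≫ p) :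
    ∃ H : L ⊗ Δ[1] ⟶ Y, (∀ m k s, H.app m (i.app m k, s) = G.app m (k, s)) ∧
      ∀ e m l, H.app m (l, endpoint e m) = (u e).app m l := by
  have hinj : ∀ m, Function.Injective (i.app m) := fun m =>
    (mono_iff_injective _).1 ((NatTrans.mono_iff_mono_app i).1 hi m)
  let B : (L ⊗ Δ[1] : SSet.{0}).Subcomplex :=
    { obj := fun m => {b | (∃ k, i.app m k = b.1) ∨ ∃ e, b.2 = endpoint e m}
      map := by
        rintro m m' θ ⟨l, s⟩ (⟨k, hk⟩ | ⟨e, he⟩)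
        · exact Or.inl ⟨K.map θ k, (NatTrans.naturality_apply i θ k).trans (congrArg _ hk)⟩
        · exact Or.inr ⟨e, congrArg (Δ[1].map θ) he⟩ }
  -- The value required on the union: `G` on the part over `K`, and `u` at the two ends. The
  -- hypothesis `hu` makes the requirements compatible on the overlap.
  let R (m : SimplexCategoryᵒᵖ) (b : (L ⊗ Δ[1] : SSet.{0}).obj m) (y : Y.obj m) : Prop :=
    (∀ k, i.app m k = b.1 → y = G.app m (k, b.2)) ∧ ∀ e, b.2 = endpoint e m → y = (u e).app m b.1
  have hR : ∀ m (b : B.toFunctor.obj m), ∃ y, R m b.1 y := by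
    intro m b
    by_cases hk : ∃ k, i.app m k = b.1.1
    · obtain ⟨k, hk⟩ := hk
      refine ⟨G.app m (k, b.1.2), fun k' h' => ?_, fun e he => ?_⟩
      · rw [hinj m (hk.trans h'.symm)]
      · rw [← hk, he]
        exact (hu e m k).symm
    · obtain ⟨e, he⟩ := b.2.resolve_left hk
      refine ⟨(u e).app m b.1.1, fun k' h' => (hk ⟨k', h'⟩).elim, fun e' he' => ?_⟩
      rw [endpoint_injective m (he.symm.trans he')]
  choose F hF using hR
  let φ : B.toFunctor ⟶ Y :=
    { app := fun m => TypeCat.ofHom (F m)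
      naturality := fun m m' θ => by
        ext b
        change F m' (B.toFunctor.map θ b) = Y.map θ (F m b)
        rcases b.2 with ⟨k, hk⟩ | ⟨e, he⟩
        · refine ((hF m' _).1 (K.map θ k) ?_).trans ?_
          · exact (NatTrans.naturality_apply i θ k).trans (congrArg (L.map θ) hk)
          · refine Eq.trans ?_ (congrArg (Y.map θ) ((hF m b).1 k hk)).symm
            exact congrArg (fun f => f (k, b.1.2)) (G.naturality θ)
        · refine ((hF m' _).2 e (congrArg (Δ[1].map θ) he)).trans ?_
          refine Eq.trans ?_ (congrArg (Y.map θ) ((hF m b).2 e he)).symm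
          exact NatTrans.naturality_apply (u e) θ b.1.1 }
  -- Lifting against the boundary inclusions implies lifting against all monomorphisms of simplicial
  -- sets.
  have : HasLiftingProperty B.ι p := by
    rw [← SSet.rlp_monomorphisms] at hp
    exact hp _ (MorphismProperty.monomorphisms.infer_property _)
  -- The bottom map ignores the coordinate in `Δ[1]`; `huv` and `cylinder_const` make the square
  -- commute.
  have sq : CommSq φ B.ι p (CartesianMonoidalCategory.fst L Δ[1] ≫ u 0 ≫ p) := ⟨by
    ext m b
    have h0 : ∀ e l, p.app m ((u e).app m l) = p.app m ((u 0).app m l) := by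
      intro e l
      obtain rfl | rfl : e = 0 ∨ e = 1 := by fin_cases e <;> simp
      · rfl
      · exact (congrArg (fun f => f.app m l) huv).symm
    change p.app m (F m b) = p.app m ((u 0).app m b.1.1)
    rcases b.2 with ⟨k, hk⟩ | ⟨e, he⟩
    · rw [(hF m b).1 k hk, ← hk, hu 0 m k]
      exact cylinder_const (G ≫ p) k _ _
    · rw [(hF m b).2 e he]
      exact h0 e _⟩
  refine ⟨sq.lift, fun m k s => ?_, fun e m l => ?_⟩
  · let b : B.toFunctor.obj m := ⟨(i.app m k, s), Or.inl ⟨k, rfl⟩⟩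
    exact (congrArg (fun f => f.app m b) sq.fac_left).trans ((hF m b).1 k rfl)
  · let b : B.toFunctor.obj m := ⟨(l, endpoint e m), Or.inr ⟨e, rfl⟩⟩
    exact (congrArg (fun f => f.app m b) sq.fac_left).trans ((hF m b).2 e rfl)

/-- The simplicial set of paths. -/
abbrev pathSSet (Y : SSet.{0}) : SSet.{0} :=
  (SSet.stdSimplex ⋙ tensorRight Δ[1]).op ⋙ yoneda.obj Y

/-- The tautological simplex of a standard simplex. -/
abbrev tautSimplex (m : SimplexCategoryᵒᵖ) : (SSet.stdSimplex.{0}.obj m.unop).obj m :=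
  SSet.stdSimplex.objEquiv.symm (𝟙 m.unop)

theorem tautSimplex_eq {m m' : SimplexCategoryᵒᵖ} (θ : m ⟶ m') :
    (SSet.stdSimplex.{0}.map θ.unop).app m' (tautSimplex m') =
      (SSet.stdSimplex.{0}.obj m.unop).map θ (tautSimplex m) :=
  congrArg SSet.stdSimplex.objEquiv.symm ((Category.id_comp θ.unop).trans
    (Category.comp_id θ.unop).symm)

theorem map_tautSimplex {m m' : SimplexCategoryᵒᵖ} (θ : m ⟶ m') :
    (SSet.stdSimplex.{0}.obj m.unop).map θ (tautSimplex m) =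
      SSet.stdSimplex.objEquiv.symm θ.unop :=
  congrArg SSet.stdSimplex.objEquiv.symm (Category.comp_id θ.unop)

/-- The map out of a cylinder that corresponds to a map to the paths. -/
def cylinderOfPath {K Y : SSet.{0}} (φ : K ⟶ pathSSet Y) : K ⊗ Δ[1] ⟶ Y where
  app m := TypeCat.ofHom fun x => NatTrans.app (φ.app m x.1) m (tautSimplex m, x.2)
  naturality m m' θ := by
    ext ⟨k, s⟩
    have h1 := congrArg (fun f => f k) (φ.naturality θ)
    have h2 : φ.app m' (K.map θ k) = (SSet.stdSimplex.map θ.unop ▷ Δ[1]) ≫ φ.app m k := h1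
    change NatTrans.app (φ.app m' (K.map θ k)) m' (tautSimplex m', Δ[1].map θ s) =
      Y.map θ (NatTrans.app (φ.app m k) m (tautSimplex m, s))
    rw [h2]
    refine Eq.trans ?_ (congrArg (fun f => f (tautSimplex m, s))
      (NatTrans.naturality (φ.app m k) θ))
    exact congrArg (fun x => NatTrans.app (φ.app m k) m' (x, Δ[1].map θ s)) (tautSimplex_eq θ)

theorem cylinderOfPath_apply {K Y : SSet.{0}} (φ : K ⟶ pathSSet Y) {m m' : SimplexCategoryᵒᵖ}
    (k : K.obj m) (θ : m ⟶ m') (s : (Δ[1] : SSet.{0}).obj m') :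
    (cylinderOfPath φ).app m' (K.map θ k, s) =
      NatTrans.app (φ.app m k) m' (SSet.stdSimplex.objEquiv.symm θ.unop, s) := by
  have h1 := congrArg (fun f => f k) (φ.naturality θ)
  have h2 : φ.app m' (K.map θ k) = (SSet.stdSimplex.map θ.unop ▷ Δ[1]) ≫ φ.app m k := h1
  change NatTrans.app (φ.app m' (K.map θ k)) m' (tautSimplex m', s) = _
  rw [h2]
  exact congrArg (fun x => NatTrans.app (φ.app m k) m' (x, s))
    ((tautSimplex_eq θ).trans (map_tautSimplex θ))

/-- The evaluation of paths at an end. -/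
def pathEval (e : Fin 2) (Y : SSet.{0}) : pathSSet Y ⟶ Y where
  app m := TypeCat.ofHom fun g => NatTrans.app g m (tautSimplex m, endpoint e m)
  naturality m m' θ := by
    ext g
    refine Eq.trans ?_ (congrArg (fun f => f (tautSimplex m, endpoint e m))
      (NatTrans.naturality g θ))
    exact congrArg (fun x => NatTrans.app g m' (x, endpoint e m')) (tautSimplex_eq θ)

/-- The extension of a homotopy over a discrete simplicial set, in terms of paths. -/
theorem exists_path_lift {Y : SSet.{0}} {T : Type}
    (p : Y ⟶ (SimplicialObject.const Type).obj T) (hp : SSet.modelCategoryQuillen.I.{0}.rlp p)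
    {K : SSet.{0}} {n : ℕ} (i : K ⟶ Δ[n]) [Mono i] (t : K ⟶ pathSSet Y) (u : Fin 2 → (Δ[n] ⟶ Y))
    (hu : ∀ e, i ≫ u e = t ≫ pathEval e Y) (huv : u 0 ≫ p = u 1 ≫ p) :
    ∃ l : Δ[n] ⟶ pathSSet Y, i ≫ l = t ∧ ∀ e, l ≫ pathEval e Y = u e := by
  obtain ⟨H, h1, h2⟩ := exists_homotopy_extension p hp i (cylinderOfPath t) u
    (fun e m k => congrArg (fun f => f.app m k) (hu e)) huv
  let l : Δ[n] ⟶ pathSSet Y := (SSet.yonedaEquiv (X := pathSSet Y) (n := ⦋n⦌)).symm H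
  have hl : ∀ m (x : (Δ[n] : SSet.{0}).obj m) m' (y : (SSet.stdSimplex.{0}.obj m.unop).obj m') s,
      NatTrans.app (l.app m x) m' (y, s) =
        H.app m' ((Δ[n] : SSet.{0}).map (SSet.stdSimplex.objEquiv y).op x, s) := by
    intro m x m' y s
    rfl
  refine ⟨l, ?_, fun e => ?_⟩
  · ext m k
    refine NatTrans.ext (funext fun m' => ?_)
    ext ⟨y, s⟩
    refine (hl m (i.app m k) m' y s).trans ?_
    have := h1 m' (K.map (SSet.stdSimplex.objEquiv y).op k) s
    refine Eq.trans (congrArg (fun x => H.app m' (x, s))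
      (NatTrans.naturality_apply i (SSet.stdSimplex.objEquiv y).op k).symm) (this.trans ?_)
    refine (cylinderOfPath_apply t k _ s).trans ?_
    exact congrArg (fun y => NatTrans.app (t.app m k) m' (y, s))
      (SSet.stdSimplex.objEquiv.symm_apply_apply y)
  · ext m x
    refine (hl m x m _ _).trans (Eq.trans ?_ (h2 e m x))
    refine congrArg (fun x => H.app m (x, endpoint e m)) ?_
    exact congrArg (fun f => f x) ((Δ[n] : SSet.{0}).map_id m)

end Simplicial

/-! ### Path objects of simplicial algebras -/

section

variable {a : ℕ} {b : ℕ∞}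

/-- The underlying simplicial set of a simplicial algebra at an object. -/
abbrev sectionsAt (Z : SimplicialObject (PiAlg a b)) (U : SphereWedge a b) : SSet.{0} :=
  ((SimplicialObject.whiskering _ _).obj (evaluation U)).obj Z

/-- The map of underlying simplicial sets induced by a morphism of objects. -/
def sectionsMap (Z : SimplicialObject (PiAlg a b)) {U V : SphereWedge a b} (f : U ⟶ V) :
    sectionsAt Z V ⟶ sectionsAt Z U where
  app n := (Z.obj n).obj.map f.op
  naturality _ _ θ := ((Z.map θ).hom.naturality f.op).symm

/-- In each simplicial degree the value at `U` is a product over the summands, hence so are the maps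
into it. This makes the path object an algebra in each degree. -/
theorem bijective_sectionsMap (Z : SimplicialObject (PiAlg a b)) (K : SSet.{0})
    (U : SphereWedge a b) : Function.Bijective
      fun (x : K ⟶ sectionsAt Z U) (j : Fin U.card) => x ≫ sectionsMap Z (U.summand j) := by
  constructor
  · intro x y h
    ext m k
    exact ((Z.obj m).property U).1 (funext fun j => congrArg (fun f => f.app m k) (congrFun h j))
  · intro y
    choose x hx using fun m k => ((Z.obj m).property U).2 fun j => (y j).app m k
    refine ⟨{ app := fun m => TypeCat.ofHom (x m), naturality := fun m m' θ => ?_ },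
      funext fun j => ?_⟩
    · ext k
      refine ((Z.obj m').property U).1 ((hx m' _).trans (funext fun j => ?_))
      refine (NatTrans.naturality_apply (y j) θ k).trans ?_
      refine (congrArg ((sectionsAt Z _).map θ) (congrFun (hx m k) j)).symm.trans ?_
      exact (NatTrans.naturality_apply (sectionsMap Z (U.summand j)) θ (x m k)).symm
    · ext m k
      exact congrFun (hx m k) j

/-- The path object. -/
def pathObject (Z : SimplicialObject (PiAlg a b)) : SimplicialObject (PiAlg a b) where
  obj n := ⟨
    { obj := fun U => (SSet.stdSimplex.{0}.obj n.unop ⊗ Δ[1] : SSet.{0}) ⟶ sectionsAt Z U.unop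
      map := fun f => TypeCat.ofHom fun g => g ≫ sectionsMap Z f.unop
      map_id := fun U => by
        ext g m x
        exact congrArg (fun f => f (NatTrans.app g m x)) ((Z.obj m).obj.map_id U)
      map_comp := fun f f' => by
        ext g m x
        exact congrArg (fun h => h (NatTrans.app g m x)) ((Z.obj m).obj.map_comp f f') },
    fun U => bijective_sectionsMap Z _ U⟩
  map θ := ObjectProperty.homMk
    { app := fun U => TypeCat.ofHom fun g => (SSet.stdSimplex.map θ.unop ▷ Δ[1]) ≫ g
      naturality := fun U V f => by
        ext g
        rfl }
  map_id n := by
    refine ObjectProperty.hom_ext _ (NatTrans.ext (funext fun U => ?_))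
    exact (pathSSet (sectionsAt Z U.unop)).map_id n
  map_comp θ θ' := by
    refine ObjectProperty.hom_ext _ (NatTrans.ext (funext fun U => ?_))
    exact (pathSSet (sectionsAt Z U.unop)).map_comp θ θ'

/-- The evaluation of the path object at an end. -/
def pathObjectEval (e : Fin 2) (Z : SimplicialObject (PiAlg a b)) : pathObject Z ⟶ Z where
  app n := ObjectProperty.homMk
    { app := fun U => (pathEval e (sectionsAt Z U.unop)).app n
      naturality := fun U V f => by
        ext g
        rfl }
  naturality n n' θ := by
    refine ObjectProperty.hom_ext _ (NatTrans.ext (funext fun U => ?_))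
    exact (pathEval e (sectionsAt Z U.unop)).naturality θ

end

end PiAlgebra

end

end

section

open CategoryTheory Opposite Limits Simplicial MonoidalCategory

noncomputable section

namespace PiAlgebra

variable {a : ℕ} {b : ℕ∞}

/-! ### Homotopy invariance -/

section

variable {A : PiAlg a b}

/-- The underlying simplicial object of a simplicial object over `A`. -/
abbrev underlying (C : SimplicialObject (Over A)) : SimplicialObject (PiAlg a b) :=
  ((SimplicialObject.whiskering _ _).obj (Over.forget A)).obj C

/-- The underlying morphism of a morphism of simplicial objects over `A`. -/
abbrev underlyingMap {C Z : SimplicialObject (Over A)} (f : C ⟶ Z) : underlying C ⟶ underlying Z :=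
  ((SimplicialObject.whiskering _ _).obj (Over.forget A)).map f

theorem underlyingMap_augmentation {C Z : SimplicialObject (Over A)} (f : C ⟶ Z) :
    underlyingMap f ≫ augmentation Z = augmentation C := by
  refine NatTrans.ext (funext fun n => ?_)
  exact Over.w (f.app n)

/-- A morphism of underlying simplicial objects that is compatible with the augmentations. -/
def overHom {C Z : SimplicialObject (Over A)} (f : underlying C ⟶ underlying Z)
    (hf : f ≫ augmentation Z = augmentation C) : C ⟶ Z where
  app n := Over.homMk (f.app n) (congrArg (fun g => g.app n) hf)
  naturality n n' θ := by
    ext1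
    exact f.naturality θ

theorem exists_comparison {C Z : SimplicialObject (Over A)} (hC : IsCofibrant (underlying C))
    (hZ : IsAcyclicFibration (augmentation Z)) : Nonempty (C ⟶ Z) := by
  obtain ⟨l, hl⟩ := hC (augmentation Z) hZ (augmentation C)
  exact ⟨overHom l hl⟩

/-- The augmentation, on underlying simplicial sets. -/
def sectionsAug (Z : SimplicialObject (Over A)) (U : SphereWedge a b) :
    sectionsAt (underlying Z) U ⟶ (SimplicialObject.const Type).obj (A.obj.obj (op U)) :=
  ((SimplicialObject.whiskering _ _).obj (evaluation U)).map (augmentation Z)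

/-- A path maps to a constant path in the discrete simplicial set of values of `A`. -/
theorem pathObjectEval_augmentation (Z : SimplicialObject (Over A)) :
    pathObjectEval 0 (underlying Z) ≫ augmentation Z =
      pathObjectEval 1 (underlying Z) ≫ augmentation Z := by
  refine NatTrans.ext (funext fun n => ObjectProperty.hom_ext _ (NatTrans.ext (funext fun U => ?_)))
  ext (g : (SSet.stdSimplex.{0}.obj n.unop ⊗ Δ[1] : SSet.{0}) ⟶ sectionsAt (underlying Z) U.unop)
  exact cylinder_const (g ≫ sectionsAug Z U.unop) (tautSimplex n) _ _

/-- The pairs of simplices with the same augmentation. -/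
abbrev fiberSquare (Z : SimplicialObject (Over A)) : SimplicialObject (PiAlg a b) :=
  Limits.pullback (augmentation Z) (augmentation Z)

/-- The two ends of paths. -/
def pathEnds (Z : SimplicialObject (Over A)) : pathObject (underlying Z) ⟶ fiberSquare Z :=
  Limits.pullback.lift (pathObjectEval 0 _) (pathObjectEval 1 _) (pathObjectEval_augmentation Z)

/-- Evaluation at a sphere is a right adjoint, so it preserves the fibre square. There, lifting
against a boundary inclusion is the extension of a homotopy with prescribed ends. -/
theorem isAcyclicFibration_pathEnds {Z : SimplicialObject (Over A)}
    (hZ : IsAcyclicFibration (augmentation Z)) : IsAcyclicFibration (pathEnds Z) := by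
  rintro d _ _ _ ⟨n⟩
  let E := (SimplicialObject.whiskering _ _).obj (evaluation (SphereWedge.sphere d))
  have : PreservesLimitsOfSize.{0, 0} E := (freeOnAdj d).rightAdjoint_preservesLimits
  have hpb : IsPullback (E.map (Limits.pullback.fst (augmentation Z) (augmentation Z)))
      (E.map (Limits.pullback.snd (augmentation Z) (augmentation Z))) (E.map (augmentation Z))
      (E.map (augmentation Z)) := (IsPullback.of_hasPullback _ _).map E
  refine ⟨fun {t w} sq => ?_⟩
  let u : Fin 2 → ((Δ[n] : SSet.{0}) ⟶ sectionsAt (underlying Z) (SphereWedge.sphere d)) :=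
    ![w ≫ E.map (Limits.pullback.fst _ _), w ≫ E.map (Limits.pullback.snd _ _)]
  have e0 : E.map (pathEnds Z) ≫ E.map (Limits.pullback.fst _ _) =
      pathEval 0 (sectionsAt (underlying Z) (SphereWedge.sphere d)) := by
    rw [← E.map_comp, pathEnds, Limits.pullback.lift_fst]
    rfl
  have e1 : E.map (pathEnds Z) ≫ E.map (Limits.pullback.snd _ _) =
      pathEval 1 (sectionsAt (underlying Z) (SphereWedge.sphere d)) := by
    rw [← E.map_comp, pathEnds, Limits.pullback.lift_snd]
    rfl
  obtain ⟨l, hl, hl'⟩ := exists_path_lift (sectionsAug Z (SphereWedge.sphere d)) (hZ d)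
    (SSet.boundary n).ι t u (fun e => by
      fin_cases e
      · refine ((Category.assoc _ _ _).symm.trans (congrArg (· ≫ _) sq.w.symm)).trans ?_
        exact (Category.assoc _ _ _).trans (congrArg (t ≫ ·) e0)
      · refine ((Category.assoc _ _ _).symm.trans (congrArg (· ≫ _) sq.w.symm)).trans ?_
        exact (Category.assoc _ _ _).trans (congrArg (t ≫ ·) e1)) (by
      refine (Category.assoc _ _ _).trans ((congrArg (w ≫ ·) hpb.w).trans
        (Category.assoc _ _ _).symm))
  refine ⟨⟨⟨l, hl, hpb.hom_ext ?_ ?_⟩⟩⟩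
  · exact (Category.assoc _ _ _).trans ((congrArg (l ≫ ·) e0).trans (hl' 0))
  · exact (Category.assoc _ _ _).trans ((congrArg (l ≫ ·) e1).trans (hl' 1))

/-- A map to the path object, on underlying simplicial sets. -/
abbrev sectionsPath {C Z : SimplicialObject (PiAlg a b)} (l : C ⟶ pathObject Z)
    (U : SphereWedge a b) : sectionsAt C U ⟶ pathSSet (sectionsAt Z U) :=
  ((SimplicialObject.whiskering _ _).obj (evaluation U)).map l

theorem cylinderOfPath_naturality {C Z : SimplicialObject (PiAlg a b)} (l : C ⟶ pathObject Z)
    {U V : SphereWedge a b} (f : U ⟶ V) :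
    (sectionsMap C f ▷ Δ[1]) ≫ cylinderOfPath (sectionsPath l U) =
      cylinderOfPath (sectionsPath l V) ≫ sectionsMap Z f := by
  ext m ⟨x, s⟩
  have h : (sectionsPath l U).app m ((sectionsMap C f).app m x) =
      (sectionsPath l V).app m x ≫ sectionsMap Z f :=
    congrArg (fun g => g x) ((l.app m).hom.naturality f.op)
  exact congrArg (fun g : (SSet.stdSimplex.{0}.obj m.unop ⊗ Δ[1] : SSet.{0}) ⟶ sectionsAt Z U =>
    NatTrans.app g m (tautSimplex m, s)) h

/-- The homotopy given by a map to the path object, on underlying simplicial sets. -/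
def sectionsHomotopy {C Z : SimplicialObject (PiAlg a b)} (l : C ⟶ pathObject Z)
    (U : SphereWedge a b) : SimplicialObject.Homotopy
      (SSet.ι₀ ≫ cylinderOfPath (sectionsPath l U)) (SSet.ι₁ ≫ cylinderOfPath (sectionsPath l U)) :=
  (cylinderHomotopy (cylinderOfPath (sectionsPath l U))).toSimplicialObjectHomotopy

/-- The components at the various wedges thereby form maps of algebras, which is the naturality
needed in `pathHomotopy`. -/
theorem cylinderHomotopy_naturality {K K' Y Y' : SSet.{0}} {p : K ⟶ K'} {r : Y ⟶ Y'}
    {H : K ⊗ Δ[1] ⟶ Y} {H' : K' ⊗ Δ[1] ⟶ Y'} (h : p ▷ Δ[1] ≫ H' = H ≫ r) {n : ℕ}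
    (i : Fin (n + 1)) :
    p.app (op ⦋n⦌) ≫ (cylinderHomotopy H').toSimplicialObjectHomotopy.h i =
      (cylinderHomotopy H).toSimplicialObjectHomotopy.h i ≫ r.app (op ⦋n + 1⦌) := by
  ext x
  have hy : SSet.yonedaEquiv.symm (p.app (op ⦋n⦌) x) = SSet.yonedaEquiv.symm x ≫ p :=
    (SSet.yonedaEquiv_symm_comp _ _).symm
  have key : SSet.yonedaEquiv.symm (p.app (op ⦋n⦌) x) ▷ Δ[1] ≫ H' =
      (SSet.yonedaEquiv.symm x ▷ Δ[1] ≫ H) ≫ r := by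
    rw [hy, comp_whiskerRight, Category.assoc, h, Category.assoc]
  exact congrArg (fun g : (Δ[n] ⊗ Δ[1] : SSet.{0}) ⟶ Y' => NatTrans.app g (op ⦋n + 1⦌)
    (SSet.prodStdSimplex.nonDegenerateEquiv₁.{0} i).1) key

/-- The homotopy given by a map to the path object. -/
def pathHomotopy {C Z : SimplicialObject (PiAlg a b)} (l : C ⟶ pathObject Z) :
    SimplicialObject.Homotopy (l ≫ pathObjectEval 0 Z) (l ≫ pathObjectEval 1 Z) where
  h i := ObjectProperty.homMk
    { app := fun U => (sectionsHomotopy l U.unop).h i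
      naturality := fun _ _ f => cylinderHomotopy_naturality (cylinderOfPath_naturality l f.unop) i }
  h_zero_comp_δ_zero n := ObjectProperty.hom_ext _ (NatTrans.ext (funext fun U =>
    (sectionsHomotopy l U.unop).h_zero_comp_δ_zero n))
  h_last_comp_δ_last n := ObjectProperty.hom_ext _ (NatTrans.ext (funext fun U =>
    (sectionsHomotopy l U.unop).h_last_comp_δ_last n))
  h_succ_comp_δ_castSucc_of_lt i j h := ObjectProperty.hom_ext _ (NatTrans.ext (funext fun U =>
    (sectionsHomotopy l U.unop).h_succ_comp_δ_castSucc_of_lt i j h))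
  h_succ_comp_δ_castSucc_succ j := ObjectProperty.hom_ext _ (NatTrans.ext (funext fun U =>
    (sectionsHomotopy l U.unop).h_succ_comp_δ_castSucc_succ j))
  h_castSucc_comp_δ_succ_of_lt i j h := ObjectProperty.hom_ext _ (NatTrans.ext (funext fun U =>
    (sectionsHomotopy l U.unop).h_castSucc_comp_δ_succ_of_lt i j h))
  h_comp_σ_castSucc_of_le i j h := ObjectProperty.hom_ext _ (NatTrans.ext (funext fun U =>
    (sectionsHomotopy l U.unop).h_comp_σ_castSucc_of_le i j h))
  h_comp_σ_succ_of_lt i j h := ObjectProperty.hom_ext _ (NatTrans.ext (funext fun U =>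
    (sectionsHomotopy l U.unop).h_comp_σ_succ_of_lt i j h))

/-- Any two maps over `A` from a cofibrant object to an acyclic one are homotopic. -/
theorem nonempty_homotopy {C Z : SimplicialObject (Over A)} (hC : IsCofibrant (underlying C))
    (hZ : IsAcyclicFibration (augmentation Z)) (f g : C ⟶ Z) :
    Nonempty (SimplicialObject.Homotopy (underlyingMap f) (underlyingMap g)) := by
  obtain ⟨l, hl⟩ := hC (pathEnds Z) (isAcyclicFibration_pathEnds hZ)
    (Limits.pullback.lift (underlyingMap f) (underlyingMap g)
      ((underlyingMap_augmentation f).trans (underlyingMap_augmentation g).symm))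
  have h0 : l ≫ pathObjectEval 0 _ = underlyingMap f := by
    have := congrArg (· ≫ Limits.pullback.fst _ _) hl
    simpa only [Category.assoc, pathEnds, Limits.pullback.lift_fst] using this
  have h1 : l ≫ pathObjectEval 1 _ = underlyingMap g := by
    have := congrArg (· ≫ Limits.pullback.snd _ _) hl
    simpa only [Category.assoc, pathEnds, Limits.pullback.lift_snd] using this
  exact ⟨h0 ▸ h1 ▸ pathHomotopy l⟩

/-- A homotopy between maps over `A` respects the projections to `A`. -/
def overHomotopy {C Z : SimplicialObject (Over A)} {f g : C ⟶ Z}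
    (H : SimplicialObject.Homotopy (underlyingMap f) (underlyingMap g)) :
    SimplicialObject.Homotopy f g where
  h {n} i := Over.homMk (H.h i) ((homotopy_const_h (H.postcomp (augmentation Z)) n i).trans
    (Over.w (f.app (op ⦋n⦌))))
  h_zero_comp_δ_zero n := Over.OverMorphism.ext (H.h_zero_comp_δ_zero n)
  h_last_comp_δ_last n := Over.OverMorphism.ext (H.h_last_comp_δ_last n)
  h_succ_comp_δ_castSucc_of_lt i j h :=
    Over.OverMorphism.ext (H.h_succ_comp_δ_castSucc_of_lt i j h)
  h_succ_comp_δ_castSucc_succ j := Over.OverMorphism.ext (H.h_succ_comp_δ_castSucc_succ j)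
  h_castSucc_comp_δ_succ_of_lt i j h :=
    Over.OverMorphism.ext (H.h_castSucc_comp_δ_succ_of_lt i j h)
  h_comp_σ_castSucc_of_le i j h := Over.OverMorphism.ext (H.h_comp_σ_castSucc_of_le i j h)
  h_comp_σ_succ_of_lt i j h := Over.OverMorphism.ext (H.h_comp_σ_succ_of_lt i j h)

/-- A homotopy of maps of cochain complexes, given by its nonzero components. -/
def cochainHomotopy {V : Type*} [Category* V] [Preadditive V] {K L : CochainComplex V ℕ}
    (f g : K ⟶ L) (s : ∀ i j, K.X i ⟶ L.X j) (hs : ∀ i j, j + 1 ≠ i → s i j = 0)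
    (h0 : f.f 0 = K.d 0 1 ≫ s 1 0 + g.f 0)
    (h1 : ∀ n, f.f (n + 1) = K.d (n + 1) (n + 2) ≫ s (n + 2) (n + 1) +
      s (n + 1) n ≫ L.d n (n + 1) + g.f (n + 1)) : Homotopy f g where
  hom := s
  zero i j hij := hs i j hij
  comm i := by
    cases i with
    | zero => rw [h0, dNext_eq _ (i' := 1) (by simp), prevD_eq_zero _ _ (by simp), add_zero]
    | succ n => rw [h1, dNext_eq _ (i' := n + 2) (by simp), prevD_eq _ (j' := n) (by simp)]

theorem alternatingCofaceMapComplex_obj_d {V : Type*} [Category* V] [Preadditive V]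
    (X : CosimplicialObject V) (n : ℕ) :
    ((AlgebraicTopology.alternatingCofaceMapComplex V).obj X).d n (n + 1) =
      AlgebraicTopology.AlternatingCofaceMapComplex.objD X n := by
  simp [AlgebraicTopology.alternatingCofaceMapComplex,
    AlgebraicTopology.AlternatingCofaceMapComplex.obj]

theorem pullback_eq_of_homotopy {C Z : SimplicialObject (Over A)} {f g : C ⟶ Z}
    (H : SimplicialObject.Homotopy f g) (M : BeckModule A) (q : ℕ) :
    pullback f M q = pullback g M q := by
  -- Derivations are contravariant, so the homotopy becomes simplicial in the opposite category of
  -- abelian groups. The chain homotopy obtained there is read backwards as a cochain homotopy.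
  let h := (H.whiskerRight M.derivations.rightOp).toChainHomotopy
  have hd (W : SimplicialObject (Over A)) (k : ℕ) :
      ((AlgebraicTopology.alternatingCofaceMapComplex AddCommGrpCat.{0}).obj
        (cosimplicialDerivations W M)).d k (k + 1) =
      (((AlgebraicTopology.alternatingFaceMapComplex AddCommGrpCat.{0}ᵒᵖ).obj
        (((SimplicialObject.whiskering _ _).obj M.derivations.rightOp).obj W)).d (k + 1) k).unop := by
    refine (alternatingCofaceMapComplex_obj_d _ k).trans ?_
    refine (AlgebraicTopology.AlternatingCofaceMapComplex.d_eq_unop_d _ k).trans ?_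
    exact congrArg Quiver.Hom.unop (AlgebraicTopology.alternatingFaceMapComplex_obj_d _ k).symm
  refine Homotopy.homologyMap_eq (cochainHomotopy _ _ (fun i j => (h.hom j i).unop)
    (fun i j hij => congrArg Quiver.Hom.unop (h.zero j i hij)) ?_ fun n => ?_) q
  · have hc := h.comm 0
    rw [dNext_eq_zero _ _ (by simp), prevD_eq _ (j' := 1) (by simp), zero_add] at hc
    refine (congrArg Quiver.Hom.unop hc).trans (congrArg (· + _) ?_)
    exact congrArg (· ≫ _) (hd Z 0).symm
  · have hc := h.comm (n + 1)
    rw [dNext_eq _ (i' := n) (by simp), prevD_eq _ (j' := n + 2) (by simp), add_comm (_ ≫ _)] at hc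
    refine (congrArg Quiver.Hom.unop hc).trans (congrArg (· + _) ?_)
    exact congrArg₂ (· + ·) (congrArg (· ≫ _) (hd Z _).symm) (congrArg (_ ≫ ·) (hd C _).symm)

/-- All maps over `A` from a cofibrant object to an acyclic one induce the same map in
cohomotopy. -/
theorem pullback_eq {C Z : SimplicialObject (Over A)} (hC : IsCofibrant (underlying C))
    (hZ : IsAcyclicFibration (augmentation Z)) (f g : C ⟶ Z) (M : BeckModule A) (q : ℕ) :
    pullback f M q = pullback g M q :=
  (nonempty_homotopy hC hZ f g).elim fun H => pullback_eq_of_homotopy (overHomotopy H) M q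

theorem pullback_comp {C D Z : SimplicialObject (Over A)} (f : C ⟶ D) (g : D ⟶ Z)
    (M : BeckModule A) (q : ℕ) : pullback (f ≫ g) M q = pullback g M q ≫ pullback f M q := by
  refine Eq.trans ?_ (HomologicalComplex.homologyMap_comp _ _ q)
  refine congrArg (fun φ => HomologicalComplex.homologyMap φ q) ?_
  refine Eq.trans ?_ ((AlgebraicTopology.alternatingCofaceMapComplex _).map_comp _ _)
  refine congrArg _ (NatTrans.ext (funext fun n => ?_))
  exact M.derivations.map_comp (g.app (op n)).op (f.app (op n)).op

theorem pullback_id (C : SimplicialObject (Over A)) (M : BeckModule A) (q : ℕ) :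
    pullback (𝟙 C) M q = 𝟙 _ := by
  refine Eq.trans ?_ (HomologicalComplex.homologyMap_id _ q)
  refine congrArg (fun φ => HomologicalComplex.homologyMap φ q) ?_
  refine Eq.trans ?_ ((AlgebraicTopology.alternatingCofaceMapComplex _).map_id _)
  refine congrArg _ (NatTrans.ext (funext fun n => ?_))
  exact M.derivations.map_id (op (C.obj (op n)))

/-- Maps over `A` between cofibrant acyclic objects induce isomorphisms in cohomotopy. -/
theorem isIso_pullback {C Z : SimplicialObject (Over A)} (hC : IsCofibrant (underlying C))
    (hC' : IsAcyclicFibration (augmentation C)) (hZ : IsCofibrant (underlying Z))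
    (hZ' : IsAcyclicFibration (augmentation Z)) (f : C ⟶ Z) (M : BeckModule A) (q : ℕ) :
    IsIso (pullback f M q) := by
  obtain ⟨g⟩ := exists_comparison hZ hC'
  refine ⟨pullback g M q, ?_, ?_⟩
  -- Either composite of comparisons is a self-map over `A` of a cofibrant acyclic object, so it
  -- acts like the identity.
  · rw [← pullback_comp, pullback_eq hZ hZ' (g ≫ f) (𝟙 Z), pullback_id]
  · rw [← pullback_comp, pullback_eq hC hC' (f ≫ g) (𝟙 C), pullback_id]

end

end PiAlgebra

end

end

section

open CategoryTheory Opposite Limits Simplicial MonoidalCategory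

noncomputable section

namespace PiAlgebra

variable {a : ℕ} {b : ℕ∞}

/-! ### Group operations on the values of algebras at spheres -/

namespace SphereWedge

/-- The morphism out of a wedge with given restrictions to the summands. -/
def desc {U V : SphereWedge a b} (f : ∀ j, sphere (U.dim j) ⟶ V) : U ⟶ V :=
  ofWedge (wedgeDesc fun j => wedgeIncl (sphere (U.dim j)).family (0 : Fin 1) ≫ toWedge (f j))

theorem summand_desc {U V : SphereWedge a b} (f : ∀ j, sphere (U.dim j) ⟶ V) (j : Fin U.card) :
    U.summand j ≫ desc f = f j := by
  refine toWedge_injective (wedge_hom_ext fun i => ?_)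
  refine (wedgeIncl_toWedge_summand_comp j (desc f) i).trans ?_
  obtain rfl : i = (0 : Fin 1) := Subsingleton.elim (α := Fin 1) _ _
  exact wedgeIncl_desc _ j

instance (d : Dim a b) : NeZero d.1 := ⟨Nat.one_le_iff_ne_zero.1 d.2.1⟩

instance homGroup (d : Dim a b) (V : SphereWedge a b) : Group (sphere d ⟶ V) :=
  sphereHomGroup d.1 V.space

theorem mul_comp {d : Dim a b} {V W : SphereWedge a b} (f g : sphere d ⟶ V) (h : V ⟶ W) :
    (f * g) ≫ h = (f ≫ h) * (g ≫ h) :=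
  sphereHom_mul_comp (d := d.1) f g h

theorem inv_comp {d : Dim a b} {V W : SphereWedge a b} (f : sphere d ⟶ V) (h : V ⟶ W) :
    f⁻¹ ≫ h = (f ≫ h)⁻¹ :=
  sphereHom_inv_comp (d := d.1) f h

/-- The inclusion of the base point. -/
def fromPoint (V : SphereWedge a b) : point a b ⟶ V :=
  ofWedge (U := point a b) (V := V) (ptdZero _ _)

theorem one_eq (d : Dim a b) (V : SphereWedge a b) :
    (1 : sphere d ⟶ V) = (sphere d).toPoint ≫ fromPoint V :=
  (sphereHom_one d.1 V.space).trans (comp_ptdZero _).symm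

/-- The wedge of two spheres of the same dimension. -/
def double (d : Dim a b) : SphereWedge a b := ⟨2, fun _ => d⟩

/-- The summands of the wedge of two spheres. -/
def doubleIncl (d : Dim a b) (e : Fin 2) : sphere d ⟶ double d := (double d).summand e

/-- The morphism out of the wedge of two spheres. -/
def doubleDesc {d : Dim a b} {V : SphereWedge a b} (f : Fin 2 → (sphere d ⟶ V)) : double d ⟶ V :=
  desc (U := double d) f

theorem doubleIncl_desc {d : Dim a b} {V : SphereWedge a b} (f : Fin 2 → (sphere d ⟶ V))
    (e : Fin 2) : doubleIncl d e ≫ doubleDesc f = f e :=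
  summand_desc (U := double d) f e

end SphereWedge

open SphereWedge

section Fibers

variable {A : PiAlg a b}

theorem exists_pair (E : PiAlg a b) {d : Dim a b} (x : Fin 2 → E.obj.obj (op (SphereWedge.sphere d))) :
    ∃ y : E.obj.obj (op (double d)), ∀ e, E.obj.map (doubleIncl d e).op y = x e :=
  ((E.property (double d)).2 x).imp fun _ h => congrFun h

theorem pair_ext (E : PiAlg a b) {d : Dim a b} {x y : E.obj.obj (op (double d))}
    (h : ∀ e, E.obj.map (doubleIncl d e).op x = E.obj.map (doubleIncl d e).op y) : x = y :=
  (E.property (double d)).1 (funext h)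

/-- If the kernel of a map of algebras at a sphere is trivial, then the map is injective there. -/
theorem injective_of_kernel {E : PiAlg a b} (p : E ⟶ A) (d : Dim a b)
    (h : ∀ (z : A.obj.obj (op (point a b))), Subsingleton (Fiber p (SphereWedge.sphere d)
      (A.obj.map (SphereWedge.sphere d).toPoint.op z))) :
    Function.Injective (p.hom.app (op (SphereWedge.sphere d))) := by
  intro x y hxy
  -- `v` and `w` are the universal quotient `x y⁻¹` and product `x y`; `q` represents `(x, y) ↦ (x
  -- y⁻¹, y)`, so that `w ≫ q` recovers `x`.
  let v : SphereWedge.sphere d ⟶ double d := doubleIncl d 0 * (doubleIncl d 1)⁻¹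
  let w : SphereWedge.sphere d ⟶ double d := doubleIncl d 0 * doubleIncl d 1
  let q : double d ⟶ double d := doubleDesc ![v, doubleIncl d 1]
  let fold : double d ⟶ SphereWedge.sphere d := doubleDesc fun _ => 𝟙 _
  have hv : v ≫ fold = (SphereWedge.sphere d).toPoint ≫ fromPoint _ := by
    rw [← one_eq, mul_comp, inv_comp, doubleIncl_desc, doubleIncl_desc, mul_inv_cancel]
  have hw : w ≫ q = doubleIncl d 0 := by
    rw [mul_comp, doubleIncl_desc, doubleIncl_desc]
    exact inv_mul_cancel_right _ _
  obtain ⟨s, hs⟩ := exists_pair E ![x, y]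
  obtain ⟨t, ht⟩ := exists_pair E fun _ : Fin 2 => y
  have hp : ∀ r : E.obj.obj (op (double d)), (∀ e, p.hom.app _ (E.obj.map (doubleIncl d e).op r) =
      p.hom.app _ y) → p.hom.app _ (E.obj.map v.op r) = A.obj.map (SphereWedge.sphere d).toPoint.op
        (A.obj.map (fromPoint _).op (p.hom.app _ y)) := by
    intro r hr
    have h1 : p.hom.app _ r = A.obj.map fold.op (p.hom.app _ y) := by
      refine pair_ext A fun e => ?_
      refine (NatTrans.naturality_apply p.hom (doubleIncl d e).op r).symm.trans ((hr e).trans ?_)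
      refine Eq.trans ?_ (map_map_eq A.obj _ _ _).symm
      rw [doubleIncl_desc]
      exact (congrArg (fun f => f (p.hom.app _ y)) (A.obj.map_id _)).symm
    rw [NatTrans.naturality_apply p.hom v.op r, h1]
    refine (map_map_eq A.obj _ _ _).trans (Eq.trans ?_ (map_map_eq A.obj _ _ _).symm)
    rw [hv]
  -- The quotients of `(x, y)` and `(y, y)` both lie over the trivial element, since `x` and `y`
  -- have the same projection; so they agree by triviality of the kernel.
  have hst : E.obj.map v.op s = E.obj.map v.op t := by
    refine congrArg Subtype.val ((h (A.obj.map (fromPoint _).op (p.hom.app _ y))).elim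
      ⟨E.obj.map v.op s, hp s fun e => ?_⟩ ⟨E.obj.map v.op t, hp t fun e => ?_⟩)
    · rw [hs]
      obtain rfl | rfl : e = 0 ∨ e = 1 := by fin_cases e <;> simp
      exacts [hxy, rfl]
    · rw [ht]
  have hq : E.obj.map q.op s = E.obj.map q.op t := by
    refine pair_ext E fun e => ?_
    refine (map_map_eq E.obj _ _ _).trans (Eq.trans ?_ (map_map_eq E.obj _ _ _).symm)
    rw [doubleIncl_desc]
    obtain rfl | rfl : e = 0 ∨ e = 1 := by fin_cases e <;> simp
    · exact hst
    · exact (hs 1).trans (ht 1).symm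
  have hr : ∀ r, E.obj.map w.op (E.obj.map q.op r) = E.obj.map (doubleIncl d 0).op r := fun r =>
    (map_map_eq E.obj _ _ _).trans (by rw [hw])
  exact (hs 0).symm.trans ((hr s).symm.trans ((congrArg _ hq).trans ((hr t).trans (ht 0))))

end Fibers

/-! ### Restriction of derivations -/

section Restriction

variable {a' : ℕ} {b' : ℕ∞} (ha : a ≤ a') (hb : b' ≤ b) {A : PiAlg a b}

/-- Bijectivity in each degree makes restriction an isomorphism of cosimplicial groups. -/
theorem isIso_restrictCohomotopy (C : SimplicialObject (Over A)) (M : BeckModule A)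
    (h : ∀ n, Function.Bijective fun f : C.obj n ⟶ M.toOver => M.restrictHom ha hb f) (q : ℕ) :
    IsIso (restrictCohomotopy ha hb C M q) := by
  have h1 : ∀ n, IsIso ((M.restrictDerivations ha hb).app ((Functor.rightOp C).obj n)) := fun n =>
    (ConcreteCategory.isIso_iff_bijective _).2 (h (op n))
  have : IsIso (Functor.whiskerLeft (Functor.rightOp C) (M.restrictDerivations ha hb)) :=
    (NatTrans.isIso_iff_isIso_app _).2 h1
  let F := AlgebraicTopology.alternatingCofaceMapComplex AddCommGrpCat.{0} ⋙
    HomologicalComplex.homologyFunctor _ _ q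
  have h2 : @IsIso (CosimplicialObject AddCommGrpCat.{0}) _ (cosimplicialDerivations C M)
    (cosimplicialDerivations (restrictSimplicial ha hb C) (M.restrict ha hb))
    (Functor.whiskerLeft (Functor.rightOp C) (M.restrictDerivations ha hb)) := this
  exact @Functor.map_isIso _ _ _ _ _ _ F _ h2

/-- Restriction of maps of simplicial objects over `A`. -/
def restrictSimplicialMap {C D : SimplicialObject (Over A)} (f : C ⟶ D) :
    restrictSimplicial ha hb C ⟶ restrictSimplicial ha hb D :=
  ((SimplicialObject.whiskering _ _).obj (Over.post (restriction ha hb))).map f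

theorem pullback_restrictCohomotopy {C D : SimplicialObject (Over A)} (f : C ⟶ D)
    (M : BeckModule A) (q : ℕ) :
    pullback f M q ≫ restrictCohomotopy ha hb C M q =
      restrictCohomotopy ha hb D M q ≫
        pullback (restrictSimplicialMap ha hb f) (M.restrict ha hb) q := by
  refine (HomologicalComplex.homologyMap_comp _ _ q).symm.trans
    (Eq.trans ?_ (HomologicalComplex.homologyMap_comp _ _ q))
  refine congrArg (fun φ => HomologicalComplex.homologyMap φ q) ?_
  refine ((AlgebraicTopology.alternatingCofaceMapComplex _).map_comp _ _).symm.trans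
    (Eq.trans ?_ ((AlgebraicTopology.alternatingCofaceMapComplex _).map_comp _ _))
  refine congrArg _ (NatTrans.ext (funext fun n => ?_))
  exact (M.restrictDerivations ha hb).naturality (f.app (op n)).op

/-- Acyclic fibrations are tested one sphere at a time, so a smaller range of dimensions only
imposes fewer conditions. -/
theorem isAcyclicFibration_restrictSimplicial {C : SimplicialObject (Over A)}
    (h : IsAcyclicFibration (augmentation C)) :
    IsAcyclicFibration (augmentation (restrictSimplicial ha hb C)) := fun d =>
  h ⟨d.1, d.2.1, ha.trans d.2.2.1, d.2.2.2.trans hb⟩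

end Restriction

end PiAlgebra

end

end

section

open CategoryTheory Opposite Limits Simplicial MonoidalCategory

noncomputable section

namespace PiAlgebra

variable {a a' : ℕ} {b b' : ℕ∞}

/-! ### Derivations into truncated modules -/

section

variable {p : ℕ → Prop}
  {hp : ∀ i : ℕ, 1 ≤ i → a ≤ i → (i : ℕ∞) ≤ b → p i → a' ≤ i ∧ (i : ℕ∞) ≤ b'}
  (ha : a ≤ a') (hb : b' ≤ b)

variable (hp) in
/-- The inclusion of a subwedge. -/
def subInclHom (U : SphereWedge a b) : (SphereWedge.widen ha hb).obj (sub p hp U) ⟶ U :=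
  SphereWedge.ofWedge (U := (SphereWedge.widen ha hb).obj (sub p hp U)) (V := U) (subIncl p hp U)

variable (hp) in
/-- The retraction to a subwedge. -/
def subRetrHom (U : SphereWedge a b) : U ⟶ (SphereWedge.widen ha hb).obj (sub p hp U) :=
  SphereWedge.ofWedge (U := U) (V := (SphereWedge.widen ha hb).obj (sub p hp U)) (subRetr p hp U)

theorem subInclHom_subRetrHom (U : SphereWedge a b) :
    subInclHom hp ha hb U ≫ subRetrHom hp ha hb U = 𝟙 _ := subIncl_subRetr p hp U

variable (hp) in
/-- The inclusion of a summand of a subwedge. -/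
def subSummand (U : SphereWedge a b) (i : Fin (sub p hp U).card) :
    SphereWedge.sphere (U.dim (subIndex p hp U i)) ⟶ (SphereWedge.widen ha hb).obj (sub p hp U) :=
  ((SphereWedge.widen ha hb).obj (sub p hp U)).summand i

theorem subSummand_subInclHom (U : SphereWedge a b) (i : Fin (sub p hp U).card) :
    subSummand hp ha hb U i ≫ subInclHom hp ha hb U = U.summand (subIndex p hp U i) := by
  refine SphereWedge.toWedge_injective (wedge_hom_ext fun r => ?_)
  exact (SphereWedge.wedgeIncl_toWedge_summand_comp
    (U := (SphereWedge.widen ha hb).obj (sub p hp U)) i (subInclHom hp ha hb U) r).trans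
      ((wedgeIncl_subIncl p hp U i).trans (SphereWedge.wedgeIncl_toWedge_summand U _ r).symm)

theorem summand_subRetrHom (U : SphereWedge a b) (i : Fin (sub p hp U).card) :
    U.summand (subIndex p hp U i) ≫ subRetrHom hp ha hb U = subSummand hp ha hb U i := by
  rw [← subSummand_subInclHom ha hb, Category.assoc, subInclHom_subRetrHom, Category.comp_id]

variable {A : PiAlg a b} {E : PiAlg a b} (π : E ⟶ A)

/-- Kept summands are detected by the restriction, discarded ones by the projection, which is
injective there. -/
theorem eq_of_subInclHom {U : SphereWedge a b} (hπ : ∀ d : Dim a b, ¬ p d.1 →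
      Function.Injective (π.hom.app (op (SphereWedge.sphere d))))
    {e e' : E.obj.obj (op U)}
    (h : E.obj.map (subInclHom hp ha hb U).op e = E.obj.map (subInclHom hp ha hb U).op e')
    (h' : π.hom.app (op U) e = π.hom.app (op U) e') : e = e' := by
  refine (E.property U).1 (funext fun j => ?_)
  by_cases hj : p (U.deg j)
  · obtain ⟨i, rfl⟩ := exists_subIndex_eq p hp (U := U) (j := j) hj
    change E.obj.map (U.summand _).op e = E.obj.map (U.summand _).op e'
    rw [← subSummand_subInclHom ha hb]
    exact (map_map_eq E.obj _ _ e).symm.trans ((congrArg _ h).trans (map_map_eq E.obj _ _ e'))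
  · refine hπ _ hj ?_
    rw [NatTrans.naturality_apply π.hom, NatTrans.naturality_apply π.hom, h']

/-- The components are prescribed by `z` on kept summands and by lifts of `x` on discarded ones;
compatibility over `A` is checked summand by summand. -/
theorem exists_subInclHom_eq {U : SphereWedge a b} (hπ : ∀ d : Dim a b, ¬ p d.1 →
      Function.Surjective (π.hom.app (op (SphereWedge.sphere d))))
    (z : E.obj.obj (op ((SphereWedge.widen ha hb).obj (sub p hp U)))) (x : A.obj.obj (op U))
    (h : A.obj.map (subInclHom hp ha hb U).op x = π.hom.app _ z) :
    ∃ e, E.obj.map (subInclHom hp ha hb U).op e = z ∧ π.hom.app (op U) e = x := by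
  let e₀ := E.obj.map (subRetrHom hp ha hb U).op z
  have hcomp : ∀ j : Fin U.card, ∃ y : E.obj.obj (op (SphereWedge.sphere (U.dim j))),
      π.hom.app _ y = A.obj.map (U.summand j).op x ∧
      (p (U.deg j) → y = E.obj.map (U.summand j).op e₀) := by
    intro j
    by_cases hj : p (U.deg j)
    · refine ⟨E.obj.map (U.summand j).op e₀, ?_, fun _ => rfl⟩
      obtain ⟨i, rfl⟩ := exists_subIndex_eq p hp (U := U) (j := j) hj
      refine (congrArg (π.hom.app _) (map_map_eq E.obj _ _ z)).trans ?_
      refine (NatTrans.naturality_apply π.hom _ z).trans ?_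
      rw [← h]
      refine (map_map_eq A.obj _ _ x).trans ?_
      rw [summand_subRetrHom, subSummand_subInclHom]
    · obtain ⟨y, hy⟩ := hπ (U.dim j) hj (A.obj.map (U.summand j).op x)
      exact ⟨y, hy, fun h => (hj h).elim⟩
  choose y hy hy' using hcomp
  obtain ⟨e, he⟩ := (E.property U).2 y
  replace he : ∀ j, E.obj.map (U.summand j).op e = y j := congrFun he
  refine ⟨e, ?_, ?_⟩
  · refine (E.property ((SphereWedge.widen ha hb).obj (sub p hp U))).1
      (funext fun (i : Fin (sub p hp U).card) => ?_)
    have hi := subIndex_mem p hp U i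
    change E.obj.map (subSummand hp ha hb U i).op _ = E.obj.map (subSummand hp ha hb U i).op z
    refine (map_map_eq E.obj _ _ e).trans ?_
    rw [subSummand_subInclHom]
    refine (he _).trans ((hy' _ hi).trans ?_)
    refine (map_map_eq E.obj _ _ z).trans ?_
    rw [summand_subRetrHom]
  · refine (A.property U).1 (funext fun j => ?_)
    exact (NatTrans.naturality_apply π.hom _ e).symm.trans
      ((congrArg (π.hom.app _) (he j)).trans (hy j))

include ha hb in
/-- Derivations into a module are determined by their restriction to the dimensions in which the
module is nontrivial. -/
theorem FactorsThroughSub.bijective_restrictHom (h : FactorsThroughSub hp) (M : BeckModule A)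
    (hM : ∀ d : Dim a b, ¬ p d.1 →
      Function.Injective (M.proj.hom.app (op (SphereWedge.sphere d)))) (Y : Over A) :
    Function.Bijective fun f : Y ⟶ M.toOver => M.restrictHom ha hb f := by
  constructor
  · intro f g hfg
    refine M.hom_ext fun U y => eq_of_subInclHom (hp := hp) ha hb M.proj hM ?_
      ((M.value f U y).2.trans (M.value g U y).2.symm)
    have h1 := congrArg (fun k : (Over.post (restriction ha hb)).obj Y ⟶
      (M.restrict ha hb).toOver => k.left.hom.app (op (sub p hp U))
        (Y.left.obj.map (subInclHom hp ha hb U).op y)) hfg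
    exact (NatTrans.naturality_apply f.left.hom _ y).symm.trans
      (h1.trans (NatTrans.naturality_apply g.left.hom _ y))
  · intro g
    -- The restriction to the kept summands that the extended derivation must have at `y`.
    let gv (U : SphereWedge a b) (y : Y.left.obj.obj (op U)) :
        M.total.obj.obj (op ((SphereWedge.widen ha hb).obj (sub p hp U))) :=
      g.left.hom.app (op (sub p hp U)) (Y.left.obj.map (subInclHom hp ha hb U).op y)
    have hgv : ∀ U (y : Y.left.obj.obj (op U)), M.proj.hom.app _ (gv U y) =
        A.obj.map (subInclHom hp ha hb U).op (Y.hom.hom.app (op U) y) := by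
      intro U y
      have h1 := ((M.restrict ha hb).value g (sub p hp U)
        (Y.left.obj.map (subInclHom hp ha hb U).op y)).2
      exact h1.trans (NatTrans.naturality_apply Y.hom.hom (subInclHom hp ha hb U).op y)
    -- On discarded summands the zero section provides elements over the given projection.
    have hex : ∀ U (y : Y.left.obj.obj (op U)), ∃ e : M.total.obj.obj (op U),
        M.total.obj.map (subInclHom hp ha hb U).op e = gv U y ∧
          M.proj.hom.app (op U) e = Y.hom.hom.app (op U) y := fun U y =>
      exists_subInclHom_eq ha hb M.proj (fun d _ x => ⟨(0 : Fiber M.proj _ x).1,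
        (0 : Fiber M.proj _ x).2⟩) (gv U y) (Y.hom.hom.app (op U) y) (hgv U y).symm
    choose e he he' using hex
    -- The chosen values are determined by their restriction and projection, so naturality may be
    -- tested on these. `h` factors the restricted map through the subwedge of `V`, and naturality
    -- of `g` applies.
    have hnat : ∀ (U V : SphereWedge a b) (f : U ⟶ V) (y : Y.left.obj.obj (op V)),
        e U (Y.left.obj.map f.op y) = M.total.obj.map f.op (e V y) := by
      intro U V f y
      refine eq_of_subInclHom (hp := hp) ha hb M.proj hM ?_ ?_
      · let k : sub p hp U ⟶ sub p hp V := SphereWedge.ofWedge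
          (subIncl p hp U ≫ SphereWedge.toWedge f ≫ subRetr p hp V)
        have hk : subInclHom hp ha hb U ≫ f =
            (SphereWedge.widen ha hb).map k ≫ subInclHom hp ha hb V := by
          have := h (sub p hp U) V (subIncl p hp U ≫ SphereWedge.toWedge f)
          exact this.symm.trans (comp_regroup' (subIncl p hp U) (SphereWedge.toWedge f)
            (subRetr p hp V) (subIncl p hp V)).symm
        refine (he U _).trans (Eq.trans ?_ (map_map_eq M.total.obj _ _ (e V y)).symm)
        rw [hk]
        refine Eq.trans ?_ (map_map_eq M.total.obj _ _ (e V y))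
        rw [he]
        refine Eq.trans ?_ (NatTrans.naturality_apply g.left.hom k.op _)
        refine congrArg (g.left.hom.app (op (sub p hp U))) ?_
        refine (map_map_eq Y.left.obj _ _ y).trans ?_
        rw [hk]
        exact (map_map_eq Y.left.obj _ _ y).symm
      · rw [he', NatTrans.naturality_apply M.proj.hom, he']
        exact NatTrans.naturality_apply Y.hom.hom f.op y
    refine ⟨Over.homMk (ObjectProperty.homMk
      { app := fun U => TypeCat.ofHom (e U.unop)
        naturality := fun V U f => by
          ext y
          exact hnat U.unop V.unop f.unop y }) ?_, ?_⟩
    · refine ObjectProperty.hom_ext _ (NatTrans.ext (funext fun U => ?_))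
      ext y
      exact he' U.unop y
    · refine (M.restrict ha hb).hom_ext fun V y => ?_
      change e ((SphereWedge.widen ha hb).obj V) y = g.left.hom.app (op V) y
      refine eq_of_subInclHom (hp := hp) ha hb M.proj hM ?_ ?_
      · refine (he _ y).trans ?_
        let k : sub p hp ((SphereWedge.widen ha hb).obj V) ⟶ V :=
          SphereWedge.ofWedge (V := V) (subIncl p hp ((SphereWedge.widen ha hb).obj V))
        exact NatTrans.naturality_apply g.left.hom k.op y
      · exact (he' _ y).trans ((M.restrict ha hb).value g V y).2.symm

end

/-! ### Derivations on connected objects -/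

/-- An invertible counit identifies `Y` with `L (R Y)`, so maps out of `Y` correspond by adjunction
to maps out of `R Y`; compatibility with the base is naturality of the counit. -/
theorem bijective_post_of_isIso_counit {C D : Type*} [Category* C] [Category* D] {L : D ⥤ C}
    {R : C ⥤ D} (adj : L ⊣ R) {A Y T : C} (y : Y ⟶ A) (t : T ⟶ A) [IsIso (adj.counit.app Y)] :
    Function.Bijective fun f : Over.mk y ⟶ Over.mk t => (Over.post R).map f := by
  have key : ∀ (f : Y ⟶ T), (adj.homEquiv _ _) (adj.counit.app Y ≫ f) = R.map f := fun f => by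
    simp [Adjunction.homEquiv_unit]
  constructor
  · intro f g h
    refine Over.OverMorphism.ext ?_
    have h1 : R.map f.left = R.map g.left := congrArg CommaMorphism.left h
    exact (cancel_epi (adj.counit.app Y)).1 ((adj.homEquiv _ _).injective
      ((key f.left).trans (h1.trans (key g.left).symm)))
  · intro g
    let g' : R.obj Y ⟶ R.obj T := g.left
    have hg : g' ≫ R.map t = R.map y := Over.w g
    refine ⟨Over.homMk (inv (adj.counit.app Y) ≫ (adj.homEquiv (R.obj Y) T).symm g') ?_, ?_⟩
    · change (inv (adj.counit.app Y) ≫ (adj.homEquiv (R.obj Y) T).symm g') ≫ t = y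
      rw [Category.assoc, IsIso.inv_comp_eq, ← Adjunction.homEquiv_naturality_right_symm, hg,
        Adjunction.homEquiv_counit]
      exact adj.counit.naturality y
    · refine Over.OverMorphism.ext ?_
      change R.map (inv (adj.counit.app Y) ≫ (adj.homEquiv (R.obj Y) T).symm g') = g'
      rw [← key, IsIso.hom_inv_id_assoc, Equiv.apply_symm_apply]

theorem bijective_restrictHom_of_isIso_counit {ha : a ≤ a'} {hb : b' ≤ b}
    {ι : PiAlg a' b' ⥤ PiAlg a b} (adj : ι ⊣ restriction ha hb) {A : PiAlg a b}
    (M : BeckModule A) (Y : Over A) [IsIso (adj.counit.app Y.left)] :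
    Function.Bijective fun f : Y ⟶ M.toOver => M.restrictHom ha hb f :=
  bijective_post_of_isIso_counit adj Y.hom M.proj

end PiAlgebra

end

end

section

open CategoryTheory Opposite Limits Simplicial MonoidalCategory

noncomputable section

namespace PiAlgebra

variable {a a' : ℕ} {b b' : ℕ∞}

/-! ### Cofibrant objects and adjunctions -/

/-- Apply a functor to a simplicial object. -/
abbrev mapSimplicial {C D : Type 1} [Category.{0} C] [Category.{0} D] (F : C ⥤ D) :
    SimplicialObject C ⥤ SimplicialObject D :=
  (SimplicialObject.whiskering _ _).obj F

/-- A left adjoint functor preserves cofibrant objects if its right adjoint preserves acyclic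
fibrations. -/
theorem isCofibrant_of_adj {F : PiAlg a b ⥤ PiAlg a' b'} {G : PiAlg a' b' ⥤ PiAlg a b}
    (adj : F ⊣ G) (hG : ∀ ⦃X Y : SimplicialObject (PiAlg a' b')⦄ (p : X ⟶ Y),
      IsAcyclicFibration p → IsAcyclicFibration ((mapSimplicial G).map p))
    {C : SimplicialObject (PiAlg a b)} (hC : IsCofibrant C) :
    IsCofibrant ((mapSimplicial F).obj C) := by
  intro X Y p hp g
  let adj' : mapSimplicial F ⊣ mapSimplicial G := adj.whiskerRight SimplexCategoryᵒᵖ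
  obtain ⟨l, hl⟩ := hC _ (hG p hp) ((adj'.homEquiv _ _) g)
  refine ⟨(adj'.homEquiv _ _).symm l, ?_⟩
  rw [← adj'.homEquiv_naturality_right_symm, hl, Equiv.symm_apply_apply]

theorem isAcyclicFibration_restriction (ha : a ≤ a') (hb : b' ≤ b)
    ⦃X Y : SimplicialObject (PiAlg a b)⦄ (p : X ⟶ Y) (hp : IsAcyclicFibration p) :
    IsAcyclicFibration ((mapSimplicial (restriction ha hb)).map p) := fun d =>
  hp ⟨d.1, d.2.1, ha.trans d.2.2.1, d.2.2.2.trans hb⟩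

theorem IsAcyclicFibration.comp_isIso {X Y Z : SimplicialObject (PiAlg a b)} {f : X ⟶ Y}
    (hf : IsAcyclicFibration f) (g : Y ⟶ Z) [IsIso g] : IsAcyclicFibration (f ≫ g) := fun d => by
  rw [Functor.map_comp]
  exact (MorphismProperty.cancel_right_of_respectsIso _ _ _).2 (hf d)

section

variable {p : ℕ → Prop}
  {hp : ∀ i : ℕ, 1 ≤ i → a ≤ i → (i : ℕ∞) ≤ b → p i → a' ≤ i ∧ (i : ℕ∞) ≤ b'}

-- At a sphere that is kept, the extension has the values of the original objects. At a discarded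
-- one all values are singletons, so the map is an isomorphism there.
include hp in
theorem isAcyclicFibration_extension (ha : a ≤ a') (hb : b' ≤ b) (H : SubComp p hp)
    (hp' : ∀ i : ℕ, a' ≤ i → (i : ℕ∞) ≤ b' → p i)
    ⦃X Y : SimplicialObject (PiAlg a' b')⦄ (f : X ⟶ Y) (hf : IsAcyclicFibration f) :
    IsAcyclicFibration ((mapSimplicial (extension H)).map f) := by
  intro d
  by_cases hd : p d.1
  · let d' : Dim a' b' := ⟨d.1, d.2.1, hp _ d.2.1 d.2.2.1 d.2.2.2 hd⟩
    let e : extension H ⋙ evaluation (SphereWedge.sphere d) ≅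
        evaluation (SphereWedge.sphere d') :=
      Functor.isoWhiskerRight (extensionRestrictionIso ha hb H hp')
        (evaluation (SphereWedge.sphere d')) ≪≫ Functor.leftUnitor _
    let e' := (SimplicialObject.whiskering _ _).mapIso e
    exact (MorphismProperty.arrow_mk_iso_iff _ (Arrow.isoMk (e'.app X) (e'.app Y)
      (e'.hom.naturality f).symm)).2 (hf d')
  · have hb : ∀ n, IsIso ((((SimplicialObject.whiskering _ _).obj
        (evaluation (SphereWedge.sphere d))).map ((mapSimplicial (extension H)).map f)).app n) := by
      intro n
      refine (isIso_iff_bijective _).2 ⟨fun x y _ => ?_, fun y => ?_⟩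
      · exact (subsingleton_extension H (X.obj n) d hd).elim x y
      -- The value at the empty wedge is an empty product, hence inhabited, and supplies an element
      -- at the sphere.
      · obtain ⟨x, -⟩ := ((((extension H).obj (X.obj n)).property
          (SphereWedge.point a b)).2 fun j => j.elim0)
        exact ⟨((extension H).obj (X.obj n)).obj.map (SphereWedge.sphere d).toPoint.op x,
          (subsingleton_extension H (Y.obj n) d hd).elim _ _⟩
    have : IsIso (((SimplicialObject.whiskering _ _).obj
        (evaluation (SphereWedge.sphere d))).map ((mapSimplicial (extension H)).map f)) :=
      (NatTrans.isIso_iff_isIso_app _).2 hb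
    intro _ _ _ _
    infer_instance

variable (ha : a ≤ a') (hb : b' ≤ b) {A : PiAlg a b}

/-- Restriction is here a left adjoint whose right adjoint, the extension, preserves acyclic
fibrations. -/
theorem FactorsThroughSub.isCofibrant_restrictSimplicial (h : FactorsThroughSub hp)
    (hp' : ∀ i : ℕ, a' ≤ i → (i : ℕ∞) ≤ b' → p i) {C : SimplicialObject (Over A)}
    (hC : IsCofibrant (underlying C)) : IsCofibrant (underlying (restrictSimplicial ha hb C)) :=
  isCofibrant_of_adj (h.algAdj ha hb) (isAcyclicFibration_extension ha hb h.subComp hp') hC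

theorem isIso_pullback_of_isIso {C D : SimplicialObject (Over A)} (f : C ⟶ D) [IsIso f]
    (M : BeckModule A) (q : ℕ) : IsIso (pullback f M q) :=
  ⟨pullback (inv f) M q, by rw [← pullback_comp, IsIso.inv_hom_id, pullback_id],
    by rw [← pullback_comp, IsIso.hom_inv_id, pullback_id]⟩

/-- The simplicial object over `A` that corresponds to a simplicial object over the restriction
of `A`. -/
def extendSimplicial {ι : PiAlg a' b' ⥤ PiAlg a b} (adj : ι ⊣ restriction ha hb)
    (C : SimplicialObject (Over ((restriction ha hb).obj A))) : SimplicialObject (Over A) :=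
  ((SimplicialObject.whiskering _ _).obj (Over.post ι ⋙ Over.map (adj.counit.app A))).obj C

/-- The unit of the adjunction, as a map of simplicial objects over the restriction of `A`. -/
def extendSimplicialUnit {ι : PiAlg a' b' ⥤ PiAlg a b} (adj : ι ⊣ restriction ha hb)
    (C : SimplicialObject (Over ((restriction ha hb).obj A))) :
    C ⟶ restrictSimplicial ha hb (extendSimplicial ha hb adj C) where
  app n := Over.homMk (adj.unit.app (C.obj n).left) (by
    have h1 := adj.unit.naturality (C.obj n).hom
    have h2 := adj.right_triangle_components A
    change adj.unit.app (C.obj n).left ≫ (restriction ha hb).map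
      (ι.map (C.obj n).hom ≫ adj.counit.app A) = (C.obj n).hom
    rw [Functor.map_comp]
    refine (Category.assoc _ _ _).symm.trans ((congrArg (· ≫ _) h1.symm).trans ?_)
    exact (Category.assoc _ _ _).trans ((congrArg ((C.obj n).hom ≫ ·) h2).trans
      (Category.comp_id _)))
  naturality n n' θ := Over.OverMorphism.ext (adj.unit.naturality (C.map θ).left)

theorem isIso_extendSimplicialUnit {ι : PiAlg a' b' ⥤ PiAlg a b} (adj : ι ⊣ restriction ha hb)
    [ι.Full] [ι.Faithful] (C : SimplicialObject (Over ((restriction ha hb).obj A))) :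
    IsIso (extendSimplicialUnit ha hb adj C) := by
  refine (NatTrans.isIso_iff_isIso_app _).2 fun n => ?_
  have : IsIso ((Over.forget _).map ((extendSimplicialUnit ha hb adj C).app n)) :=
    inferInstanceAs (IsIso (adj.unit.app (C.obj n).left))
  exact isIso_of_reflects_iso _ (Over.forget _)

-- The augmentation is the extension of an acyclic fibration followed by the counit at `A`, an
-- isomorphism.
include hp in
theorem isAcyclicFibration_extendSimplicial (H : SubComp p hp)
    (hp' : ∀ i : ℕ, a' ≤ i → (i : ℕ∞) ≤ b' → p i) (adj : extension H ⊣ restriction ha hb)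
    (hA : IsIso (adj.counit.app A)) {C : SimplicialObject (Over ((restriction ha hb).obj A))}
    (hC : IsAcyclicFibration (augmentation C)) :
    IsAcyclicFibration (augmentation (extendSimplicial ha hb adj C)) := by
  have : IsIso ((SimplicialObject.const (PiAlg a b)).map (adj.counit.app A)) :=
    Functor.map_isIso _ _
  exact @IsAcyclicFibration.comp_isIso _ _ _ _ _ _ (isAcyclicFibration_extension ha hb H hp' _ hC)
    ((SimplicialObject.const (PiAlg a b)).map (adj.counit.app A)) this

/-- Quillen cohomology of connected algebras may be computed after passing to a connected
cover. -/
theorem FactorsThroughRetr.isIso_comparison (h : FactorsThroughRetr hp)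
    (hp' : ∀ i : ℕ, a' ≤ i → (i : ℕ∞) ≤ b' → p i)
    (hA : ∀ d : Dim a b, ¬ p d.1 → Subsingleton (A.obj.obj (op (SphereWedge.sphere d))))
    (C : CofibrantReplacement A) (C' : CofibrantReplacement ((restriction ha hb).obj A))
    (M : BeckModule A) (q : ℕ) (k : C'.obj ⟶ restrictSimplicial ha hb C.obj) :
    IsIso (restrictCohomotopy ha hb C.obj M q ≫ pullback k (M.restrict ha hb) q) := by
  let adj := h.algAdj ha hb
  have ff := adj.fullyFaithfulLOfCompIsoId (extensionRestrictionIso ha hb h.subComp hp')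
  have := ff.full
  have := ff.faithful
  have hA' : IsIso (adj.counit.app A) :=
    adj.isIso_counit_app_iff_mem_essImage.2 (h.mem_essImage ha hb hA)
  -- The replacement of the cover, extended, is again a cofibrant replacement of `A`: its cofibrancy
  -- uses that restriction preserves acyclic fibrations, its acyclicity that `A` lies in the
  -- essential image.
  let D := extendSimplicial ha hb adj C'.obj
  have hD : IsCofibrant (underlying D) :=
    isCofibrant_of_adj adj (isAcyclicFibration_restriction ha hb) C'.cofibrant
  have hD' : IsAcyclicFibration (augmentation D) :=
    isAcyclicFibration_extendSimplicial ha hb h.subComp hp' adj hA' C'.acyclic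
  obtain ⟨r⟩ := exists_comparison hD C.acyclic
  -- The given comparison may be exchanged for the unit followed by the restriction of a comparison
  -- `D ⟶ C.obj`, since all comparisons induce the same map.
  have hk : pullback k (M.restrict ha hb) q =
      pullback (restrictSimplicialMap ha hb r) (M.restrict ha hb) q ≫
        pullback (extendSimplicialUnit ha hb adj C'.obj) (M.restrict ha hb) q := by
    rw [← pullback_comp]
    exact pullback_eq C'.cofibrant (isAcyclicFibration_restrictSimplicial ha hb C.acyclic) _ _ _ _
  have i1 : IsIso (restrictCohomotopy ha hb D M q) := by
    refine isIso_restrictCohomotopy ha hb D M (fun n => ?_) q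
    have : IsIso (adj.counit.app (D.obj n).left) :=
      inferInstanceAs (IsIso (adj.counit.app ((extension h.subComp).obj _)))
    exact bijective_restrictHom_of_isIso_counit adj M (D.obj n)
  have i2 := isIso_pullback hD hD' C.cofibrant C.acyclic r M q
  have i3 := isIso_extendSimplicialUnit ha hb adj C'.obj
  have i4 := isIso_pullback_of_isIso (extendSimplicialUnit ha hb adj C'.obj) (M.restrict ha hb) q
  have := pullback_restrictCohomotopy ha hb r M q
  rw [hk, ← Category.assoc, ← this]
  infer_instance

/-- Quillen cohomology with coefficients in a truncated module may be computed after truncation. -/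
theorem FactorsThroughSub.isIso_pullback_comparison (h : FactorsThroughSub hp)
    (hp' : ∀ i : ℕ, a' ≤ i → (i : ℕ∞) ≤ b' → p i)
    (C : CofibrantReplacement A) (C' : CofibrantReplacement ((restriction ha hb).obj A))
    (N : BeckModule ((restriction ha hb).obj A)) (q : ℕ)
    (k : restrictSimplicial ha hb C.obj ⟶ C'.obj) : IsIso (pullback k N q) :=
  isIso_pullback (h.isCofibrant_restrictSimplicial ha hb hp' C.cofibrant)
    (isAcyclicFibration_restrictSimplicial ha hb C.acyclic) C'.cofibrant C'.acyclic k N q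

end

end PiAlgebra

end

end

section

open CategoryTheory Opposite Limits Simplicial MonoidalCategory

noncomputable section

namespace PiAlgebra

/-! ### The comparison maps -/

section

variable {D : Type*} [Category* D]

theorem existsUnique_comp_eq {X Y Z : D} (r : Y ⟶ Z) [IsIso r] (p : X ⟶ Z) :
    ∃! t, t ≫ r = p :=
  ⟨p ≫ inv r, by simp, fun t ht => by simp [← ht]⟩

theorem isIso_of_comp_eq {X Y Z : D} {r : Y ⟶ Z} {t : X ⟶ Y} {p : X ⟶ Z} (h : t ≫ r = p)
    [IsIso r] [IsIso p] : IsIso t := by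
  subst h
  exact IsIso.of_isIso_comp_right t r

/-- The square may be tested after the truncation `rnm`, a monomorphism; there the two sides are
related by naturality of restriction and by the agreement `e4` of composite comparisons. -/
theorem square_of_restrictions {Hn H Hm Hmn Pn Pm R Rn PR : D} {t : Hn ⟶ H} {rn : H ⟶ Pn}
    {pk : Hn ⟶ Pn} (hk : t ≫ rn = pk) {rm : H ⟶ R} {pl : R ⟶ Hm} {rnm : Hm ⟶ Pm} [Mono rnm]
    {t' : Hmn ⟶ Hm} {pk' : Hmn ⟶ Pm} (hk' : t' ≫ rnm = pk') {rmn : Hn ⟶ Rn} {pl' : Rn ⟶ Hmn}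
    {rnR : R ⟶ PR} {ppl : PR ⟶ Pm} (e1 : pl ≫ rnm = rnR ≫ ppl) {rmP : Pn ⟶ PR}
    (e3 : rm ≫ rnR = rn ≫ rmP) {rpk : Rn ⟶ PR} (e2 : pk ≫ rmP = rmn ≫ rpk)
    (e4 : pl' ≫ pk' = rpk ≫ ppl) : t ≫ rm ≫ pl = (rmn ≫ pl') ≫ t' := by
  rw [← cancel_mono rnm]
  simp only [Category.assoc]
  rw [e1, hk', e4, reassoc_of% e3, reassoc_of% hk, reassoc_of% e2]

end

section

variable {a n : ℕ} {A : PiAlg a ⊤} {C : CofibrantReplacement A}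
  {C' : CofibrantReplacement ((truncation a n).obj A)} {M : BeckModule A} {q : ℕ}

/-- The projection of a truncated module is injective at the spheres of high dimension. -/
theorem BeckModule.IsTruncated.injective (h : M.IsTruncated n) (d : Dim a ⊤) (hd : n < d.1) :
    Function.Injective (M.proj.hom.app (op (SphereWedge.sphere d))) :=
  injective_of_kernel M.proj d (h d hd)

theorem isIso_restrictCohomotopy_truncation (hM : ∀ d : Dim a ⊤, n < d.1 →
      Function.Injective (M.proj.hom.app (op (SphereWedge.sphere d))))
    (C : SimplicialObject (Over A)) (q : ℕ) :
    IsIso (restrictCohomotopy (le_refl a) (le_top (a := (n : ℕ∞))) C M q) :=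
  isIso_restrictCohomotopy _ _ C M (fun k => (factorsThroughSub_truncation a n).bijective_restrictHom
    le_rfl le_top M (fun d hd => hM d (not_le.1 hd)) (C.obj k)) q

/-- Restriction of derivations is invertible, so each comparison determines one map; and all
comparisons induce the same map because the truncated replacement is cofibrant. -/
theorem existsUnique_truncationMap (hM : ∀ d : Dim a ⊤, n < d.1 →
      Function.Injective (M.proj.hom.app (op (SphereWedge.sphere d))))
    (C : CofibrantReplacement A) (C' : CofibrantReplacement ((truncation a n).obj A)) (q : ℕ) :
    ∃! t, IsTruncationMap C C' M q t := by
  have := isIso_restrictCohomotopy_truncation hM C.obj q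
  have hC := (factorsThroughSub_truncation a n).isCofibrant_restrictSimplicial le_rfl le_top
    (fun i _ h => by exact_mod_cast h) C.cofibrant
  obtain ⟨k⟩ := exists_comparison hC C'.acyclic
  obtain ⟨t, ht, huniq⟩ := existsUnique_comp_eq (restrictCohomotopy (le_refl a)
    (le_top (a := (n : ℕ∞))) C.obj M q) (pullback k (M.restrict _ _) q)
  refine ⟨t, ⟨k, ht⟩, ?_⟩
  rintro t' ⟨k', hk'⟩
  exact huniq t' (hk'.trans (pullback_eq hC C'.acyclic _ _ _ _))

theorem IsTruncationMap.isIso (hM : ∀ d : Dim a ⊤, n < d.1 →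
      Function.Injective (M.proj.hom.app (op (SphereWedge.sphere d)))) {t}
    (ht : IsTruncationMap C C' M q t) : IsIso t := by
  have hr := isIso_restrictCohomotopy_truncation hM C.obj q
  obtain ⟨k, hk⟩ := ht
  have hp := (factorsThroughSub_truncation a n).isIso_pullback_comparison le_rfl le_top
    (fun i _ h => by exact_mod_cast h) C C' (M.restrict _ _) q k
  exact @isIso_of_comp_eq _ _ _ _ _ _ _ _ hk hr hp

end

section

variable {m : ℕ} {b : ℕ∞} {A : PiAlg 1 b} {C : CofibrantReplacement A}
  {C' : CofibrantReplacement ((cover m b).obj A)} {M : BeckModule A} {q : ℕ}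

/-- Existence and independence of the comparison only need the replacement of the cover to be
cofibrant and the restricted one to be acyclic; connectedness of `A` plays no role yet. -/
theorem existsUnique_coverMap (C : CofibrantReplacement A)
    (C' : CofibrantReplacement ((cover m b).obj A)) (M : BeckModule A) (q : ℕ) :
    ∃! c, IsCoverMap C C' M q c := by
  have hC := isAcyclicFibration_restrictSimplicial (Nat.le_add_left 1 m) (le_refl b) C.acyclic
  obtain ⟨k⟩ := exists_comparison C'.cofibrant hC
  refine ⟨_, ⟨k, rfl⟩, ?_⟩
  rintro t ⟨k', rfl⟩
  exact congrArg _ (pullback_eq C'.cofibrant hC _ _ _ _)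

theorem IsCoverMap.isIso (hA : IsConnected m A) {c} (hc : IsCoverMap C C' M q c) : IsIso c := by
  obtain ⟨k, rfl⟩ := hc
  exact (factorsThroughRetr_cover m b).isIso_comparison _ _ (fun _ h _ => h)
    (fun d hd => hA d (not_lt.1 hd)) C C' M q k

end

theorem restrictCohomotopy_comm (m n : ℕ) {A : PiAlg 1 ⊤} (C : SimplicialObject (Over A))
    (M : BeckModule A) (q : ℕ) :
    restrictCohomotopy (Nat.le_add_left 1 m) (le_refl ⊤) C M q ≫
      restrictCohomotopy (le_refl (m + 1)) (le_top (a := (n : ℕ∞)))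
        (restrictSimplicial (Nat.le_add_left 1 m) (le_refl ⊤) C)
        (M.restrict (Nat.le_add_left 1 m) (le_refl ⊤)) q =
    restrictCohomotopy (le_refl 1) (le_top (a := (n : ℕ∞))) C M q ≫
      restrictCohomotopy (Nat.le_add_left 1 m) (le_refl (n : ℕ∞))
        (restrictSimplicial (le_refl 1) (le_top (a := (n : ℕ∞))) C)
        (M.restrict (le_refl 1) (le_top (a := (n : ℕ∞)))) q := by
  refine (HomologicalComplex.homologyMap_comp _ _ q).symm.trans
    (Eq.trans ?_ (HomologicalComplex.homologyMap_comp _ _ q))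
  refine congrArg (fun φ => HomologicalComplex.homologyMap φ q) ?_
  refine ((AlgebraicTopology.alternatingCofaceMapComplex _).map_comp _ _).symm.trans
    (Eq.trans ?_ ((AlgebraicTopology.alternatingCofaceMapComplex _).map_comp _ _))
  rfl

/-- The square of comparison maps commutes. -/
theorem comparison_square {m n : ℕ} {A : PiAlg 1 ⊤} {M : BeckModule A}
    (hM : ∀ d : Dim 1 ⊤, n < d.1 →
      Function.Injective (M.proj.hom.app (op (SphereWedge.sphere d))))
    {C : CofibrantReplacement A} {Cn : CofibrantReplacement ((truncation 1 n).obj A)}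
    {Cm : CofibrantReplacement ((cover m ⊤).obj A)}
    {Cmn : CofibrantReplacement ((truncation (m + 1) n).obj ((cover m ⊤).obj A))} {q : ℕ}
    {t t' c c'} (ht : IsTruncationMap C Cn M q t)
    (ht' : IsTruncationMap Cm Cmn (M.restrict (Nat.le_add_left 1 m) le_rfl) q t')
    (hc : IsCoverMap C Cm M q c)
    (hc' : IsCoverMap (m := m) Cn Cmn (M.restrict le_rfl le_top) q c') :
    t ≫ c = c' ≫ t' := by
  have hR := isIso_restrictCohomotopy_truncation (n := n)
    (M := M.restrict (Nat.le_add_left 1 m) (le_refl ⊤))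
    (fun d hd => hM ⟨d.1, d.2.1, d.2.1, le_top⟩ hd) Cm.obj q
  obtain ⟨k, hk⟩ := ht
  obtain ⟨k', hk'⟩ := ht'
  obtain ⟨l, rfl⟩ := hc
  obtain ⟨l', rfl⟩ := hc'
  have e1 := pullback_restrictCohomotopy (le_refl (m + 1)) (le_top (a := (n : ℕ∞))) l
    (M.restrict (Nat.le_add_left 1 m) (le_refl ⊤)) q
  have e2 := pullback_restrictCohomotopy (Nat.le_add_left 1 m) (le_refl (n : ℕ∞)) k
    (M.restrict (le_refl 1) (le_top (a := (n : ℕ∞)))) q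
  have e3 := restrictCohomotopy_comm m n C.obj M q
  have hX := (factorsThroughSub_truncation (m + 1) n).isCofibrant_restrictSimplicial le_rfl le_top
    (fun i _ h => by exact_mod_cast h) Cm.cofibrant
  have hY := isAcyclicFibration_restrictSimplicial (Nat.le_add_left 1 m) (le_refl (n : ℕ∞))
    Cn.acyclic
  -- Both composites go from the truncation of the replacement of the cover, which is cofibrant, to
  -- the cover of the replacement of the truncation, which is acyclic, so they induce the same map.
  let f : restrictSimplicial (le_refl (m + 1)) (le_top (a := (n : ℕ∞))) Cm.obj ⟶
      restrictSimplicial (Nat.le_add_left 1 m) (le_refl (n : ℕ∞)) Cn.obj := k' ≫ l'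
  let g : restrictSimplicial (le_refl (m + 1)) (le_top (a := (n : ℕ∞))) Cm.obj ⟶
      restrictSimplicial (Nat.le_add_left 1 m) (le_refl (n : ℕ∞)) Cn.obj :=
    restrictSimplicialMap (le_refl (m + 1)) (le_top (a := (n : ℕ∞))) l ≫
      restrictSimplicialMap (Nat.le_add_left 1 m) (le_refl (n : ℕ∞)) k
  have e4 : pullback f _ q = pullback g _ q := pullback_eq hX hY f g
    ((M.restrict (le_refl 1) (le_top (a := (n : ℕ∞)))).restrict (Nat.le_add_left 1 m) (le_refl _)) q
  have hmono : Mono (restrictCohomotopy (le_refl (m + 1)) (le_top (a := (n : ℕ∞))) Cm.obj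
    (M.restrict (Nat.le_add_left 1 m) (le_refl ⊤)) q) := @IsIso.mono_of_iso _ _ _ _ _ hR
  exact @square_of_restrictions _ _ _ _ _ _ _ _ _ _ _ _ _ _ hk _ _ _ hmono _ _ hk' _ _ _ _ e1 _
    e3 _ e2 ((pullback_comp k' l' _ q).symm.trans (e4.trans (pullback_comp _ _ _ q)))

/-- The comparison maps exist, are unique and are isomorphisms. -/
theorem comparison_isos {m n : ℕ} {A : PiAlg 1 ⊤} (hA : IsConnected m A) {M : BeckModule A}
    (hM : M.IsTruncated n) (C : CofibrantReplacement A)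
    (Cn : CofibrantReplacement ((truncation 1 n).obj A))
    (Cm : CofibrantReplacement ((cover m ⊤).obj A))
    (Cmn : CofibrantReplacement ((truncation (m + 1) n).obj ((cover m ⊤).obj A))) (q : ℕ) :
    (∃! t, IsTruncationMap C Cn M q t) ∧
    (∃! t', IsTruncationMap Cm Cmn (M.restrict (Nat.le_add_left 1 m) le_rfl) q t') ∧
    (∃! c, IsCoverMap C Cm M q c) ∧
    (∃! c', IsCoverMap (m := m) Cn Cmn (M.restrict le_rfl le_top) q c') ∧
    ∀ t t' c c', IsTruncationMap C Cn M q t →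
      IsTruncationMap Cm Cmn (M.restrict (Nat.le_add_left 1 m) le_rfl) q t' →
      IsCoverMap C Cm M q c →
      IsCoverMap (m := m) Cn Cmn (M.restrict le_rfl le_top) q c' →
      IsIso t ∧ IsIso t' ∧ IsIso c ∧ IsIso c' ∧ t ≫ c = c' ≫ t' := by
  have hM' : ∀ d : Dim (m + 1) ⊤, n < d.1 → Function.Injective
      ((M.restrict (Nat.le_add_left 1 m) (le_refl ⊤)).proj.hom.app (op (SphereWedge.sphere d))) :=
    fun d hd => hM.injective ⟨d.1, d.2.1, d.2.1, le_top⟩ hd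
  have hAn : IsConnected m ((truncation 1 n).obj A) := fun d hd =>
    hA ⟨d.1, d.2.1, d.2.1, le_top⟩ hd
  refine ⟨existsUnique_truncationMap hM.injective _ _ _, existsUnique_truncationMap hM' _ _ _,
    existsUnique_coverMap _ _ _ _, existsUnique_coverMap _ _ _ _, ?_⟩
  intro t t' c c' ht ht' hc hc'
  exact ⟨ht.isIso hM.injective, ht'.isIso hM', hc.isIso hA, hc'.isIso hAn,
    comparison_square hM.injective ht ht' hc hc'⟩

/-- The comparison isomorphism along the square. -/
theorem exists_comparison_iso {m n : ℕ} {A : PiAlg 1 ⊤} (hA : IsConnected m A) {M : BeckModule A}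
    (hM : M.IsTruncated n) (C : CofibrantReplacement A)
    (Cn : CofibrantReplacement ((truncation 1 n).obj A))
    (Cm : CofibrantReplacement ((cover m ⊤).obj A))
    (Cmn : CofibrantReplacement ((truncation (m + 1) n).obj ((cover m ⊤).obj A))) (q : ℕ) :
    ∃ φ : HQ C M q ≅ HQ Cmn ((M.restrict (Nat.le_add_left 1 m) le_rfl).restrict le_rfl le_top) q,
      ∀ t t' c c', IsTruncationMap C Cn M q t →
        IsTruncationMap Cm Cmn (M.restrict (Nat.le_add_left 1 m) le_rfl) q t' →
        IsCoverMap C Cm M q c →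
        IsCoverMap (m := m) Cn Cmn (M.restrict le_rfl le_top) q c' →
        t ≫ φ.hom = c' ∧ φ.hom ≫ t' = c := by
  obtain ⟨⟨t, ht, hut⟩, ⟨t', ht', -⟩, ⟨c, hc, -⟩, ⟨c', hc', huc'⟩, h⟩ :=
    comparison_isos hA hM C Cn Cm Cmn q
  obtain ⟨i1, -, -, i4, -⟩ := h t t' c c' ht ht' hc hc'
  -- The composite along one side of the square; commutativity shows that the other side gives the
  -- same isomorphism.
  refine ⟨(@asIso _ _ _ _ t i1).symm ≪≫ @asIso _ _ _ _ c' i4, ?_⟩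
  intro s s' d d' hs hs' hd hd'
  have hsq := (h s s' d d' hs hs' hd hd').2.2.2.2
  obtain rfl := hut s hs
  obtain rfl := huc' d' hd'
  have e1 : s ≫ (inv s ≫ d') = d' := IsIso.hom_inv_id_assoc s d'
  refine ⟨e1, (cancel_epi s).1 (Eq.trans ?_ hsq.symm)⟩
  exact (Category.assoc _ _ _).symm.trans (congrArg (· ≫ s') e1)

end PiAlgebra

end

end

section

open CategoryTheory Opposite

noncomputable section

namespace PiAlgebra

open scoped unitInterval

/-! ### Fibrations with a section -/

section Fibration

variable {E B : PtdSpace} (p : PtdMap E B)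

/-- The fibre of a pointed map. -/
def ptdFiber : PtdSpace where
  carrier := {e : E.carrier // p.1 e = B.pt}
  pt := ⟨E.pt, p.2⟩

/-- The inclusion of the fibre. -/
def fiberIncl : PtdMap (ptdFiber p) E :=
  ⟨⟨Subtype.val, continuous_subtype_val⟩, rfl⟩

/-- The homotopy lifting property, relative to the base points. -/
def HasLifting : Prop :=
  ∀ (X : Type) [TopologicalSpace X] (f : C(X, E.carrier)) (h : C(I × X, B.carrier)),
    (∀ x, h (0, x) = p.1 (f x)) → ∃ H : C(I × X, E.carrier), (∀ x, H (0, x) = f x) ∧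
      (∀ y, p.1 (H y) = h y) ∧
      ∀ x, f x = E.pt → (∀ t, h (t, x) = B.pt) → ∀ t, H (t, x) = E.pt

variable {p}

/-- A pointed map to the fibre. -/
def toFiber {X : PtdSpace} (f : C(X.carrier, E.carrier)) (h : ∀ x, p.1 (f x) = B.pt)
    (hpt : f X.pt = E.pt) : PtdMap X (ptdFiber p) :=
  ⟨⟨fun x => ⟨f x, h x⟩, f.continuous.subtype_mk _⟩, Subtype.ext hpt⟩

theorem toFiber_toHom_eq {X : PtdSpace} (H : C(I × X.carrier, E.carrier))
    (h : ∀ y, p.1 (H y) = B.pt) (hpt : ∀ t, H (t, X.pt) = E.pt) (f g : PtdMap X (ptdFiber p))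
    (hf : ∀ x, H (0, x) = (f.1 x).1) (hg : ∀ x, H (1, x) = (g.1 x).1) : f.toHom = g.toHom :=
  PtdMap.toHom_eq (Y := ptdFiber p) ⟨fun y => ⟨H y, h y⟩, H.continuous.subtype_mk _⟩
    (fun x => Subtype.ext (hf x)) (fun x => Subtype.ext (hg x)) fun t => Subtype.ext (hpt t)

theorem fiberIncl_comp : (fiberIncl p).toHom ≫ p.toHom = ptdZero _ _ :=
  congrArg (Quotient.mk _) (Subtype.ext (ContinuousMap.ext fun x => x.2))

/-- A null homotopy of the projection is lifted; the end of the lift is a homotopic map with values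
in the fibre. -/
theorem HasLifting.exists_comp_fiberIncl (hp : HasLifting p) {X : PtdSpace} (a : X ⟶ E)
    (ha : a ≫ p.toHom = ptdZero _ _) : ∃ b : X ⟶ ptdFiber p, b ≫ (fiberIncl p).toHom = a := by
  obtain ⟨a, rfl⟩ := PtdMap.toHom_surjective a
  obtain ⟨F, h0, h1, hF⟩ := PtdMap.exists_homotopy (f := a.comp p)
    (g := ⟨ContinuousMap.const _ B.pt, rfl⟩) ha
  obtain ⟨H, hH0, hH, hpt⟩ := hp X.carrier a.1 F h0
  refine ⟨(toFiber ⟨fun x => H (1, x), by fun_prop⟩ (fun x => (hH _).trans (h1 x))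
    (hpt _ a.2 hF 1)).toHom, ?_⟩
  exact (PtdMap.toHom_eq H hH0 (fun _ => rfl) (hpt _ a.2 hF)).symm

/-- The ascending half of a tent. -/
def tentUp (t : I) : I := Set.projIcc 0 1 zero_le_one (2 * (t : ℝ))

/-- The descending half of a tent. -/
def tentDown (t : I) : I := Set.projIcc 0 1 zero_le_one (2 - 2 * (t : ℝ))

theorem continuous_tentUp : Continuous tentUp := by
  unfold tentUp
  exact continuous_projIcc.comp (by fun_prop)

theorem continuous_tentDown : Continuous tentDown := by
  unfold tentDown
  exact continuous_projIcc.comp (by fun_prop)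

theorem tentUp_eq_one {t : I} (h : 1 / 2 ≤ (t : ℝ)) : tentUp t = 1 :=
  Set.projIcc_of_right_le _ (by linarith)

theorem tentDown_eq_one {t : I} (h : (t : ℝ) ≤ 1 / 2) : tentDown t = 1 :=
  Set.projIcc_of_right_le _ (by linarith)

theorem tentUp_zero : tentUp 0 = 0 := Set.projIcc_of_le_left _ (by simp)

theorem tentDown_one : tentDown 1 = 0 := Set.projIcc_of_le_left _ (by simp)

/-- A null homotopy in `E` projects to loops in `B`. The section allows these loops to be undone,
after which the null homotopy can be moved into the fibre. -/
theorem HasLifting.eq_ptdZero (hp : HasLifting p) (ς : PtdMap B E) (hς : ∀ x, p.1 (ς.1 x) = x)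
    {X : PtdSpace} (b : X ⟶ ptdFiber p) (hb : b ≫ (fiberIncl p).toHom = ptdZero _ _) :
    b = ptdZero _ _ := by
  obtain ⟨b, rfl⟩ := PtdMap.toHom_surjective b
  obtain ⟨K, h0, h1, hK⟩ := PtdMap.exists_homotopy (f := b.comp (fiberIncl p))
    (g := ⟨ContinuousMap.const _ E.pt, rfl⟩) hb
  replace h0 : ∀ x, K (0, x) = (b.1 x).1 := h0
  replace h1 : ∀ x, K (1, x) = E.pt := h1
  have hup := continuous_tentUp
  have hdown := continuous_tentDown
  -- `K` in the first half, followed by the section of its projection run backwards; at the midpoint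
  -- both are at the base point.
  let L : C(I × X.carrier, E.carrier) :=
    ⟨fun y => if (y.1 : ℝ) ≤ 1 / 2 then K (tentUp y.1, y.2)
        else ς.1 (p.1 (K (tentDown y.1, y.2))), by
      refine Continuous.if_le (by fun_prop) (by fun_prop) (by fun_prop) (by fun_prop) ?_
      intro y hy
      rw [tentUp_eq_one hy.ge, tentDown_eq_one hy.le, h1, p.2, ς.2]⟩
  have hL0 : ∀ x, L (0, x) = (b.1 x).1 := fun x => by
    change (if ((0 : I) : ℝ) ≤ 1 / 2 then _ else _) = _
    rw [if_pos (by norm_num)]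
    change K (tentUp 0, x) = _
    rw [tentUp_zero, h0]
  have hL1 : ∀ x, L (1, x) = E.pt := fun x => by
    change (if ((1 : I) : ℝ) ≤ 1 / 2 then _ else _) = _
    rw [if_neg (by norm_num)]
    change ς.1 (p.1 (K (tentDown 1, x))) = _
    rw [tentDown_one, h0, (b.1 x).2, ς.2]
  have hLpt : ∀ τ, L (τ, X.pt) = E.pt := fun τ => by
    change (if (τ : ℝ) ≤ 1 / 2 then K (tentUp τ, X.pt) else ς.1 (p.1 (K (tentDown τ, X.pt)))) = _
    rw [hK, hK, p.2, ς.2, ite_self]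
  have hpL : ∀ τ x, p.1 (L (τ, x)) = p.1 (K (min (tentUp τ) (tentDown τ), x)) := fun τ x => by
    change p.1 (if (τ : ℝ) ≤ 1 / 2 then K (tentUp τ, x) else ς.1 (p.1 (K (tentDown τ, x)))) = _
    split_ifs with h
    · rw [tentDown_eq_one h, min_eq_left unitInterval.le_one']
    · rw [tentUp_eq_one (not_le.1 h).le, min_eq_right unitInterval.le_one', hς]
  -- The projection of `L` runs along a path and back, so it contracts by scaling the time parameter
  -- to `0`. The lift of this contraction starts at `L`.
  obtain ⟨H, hH0, hH, hpt⟩ := hp (I × X.carrier) L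
    ⟨fun y => p.1 (K (unitInterval.symm y.1 * min (tentUp y.2.1) (tentDown y.2.1), y.2.2)),
      by fun_prop⟩ (fun y => by
        obtain ⟨τ, x⟩ := y
        rw [hpL]
        simp)
  replace hH : ∀ t τ x, p.1 (H (t, (τ, x))) =
    p.1 (K (unitInterval.symm t * min (tentUp τ) (tentDown τ), x)) := fun t τ x => hH (t, (τ, x))
  have hHpt : ∀ t τ, H (t, (τ, X.pt)) = E.pt := fun t τ =>
    hpt (τ, X.pt) (hLpt τ) (fun s => by simp [hK, p.2]) t
  have hb0 : ∀ x, p.1 (K (0, x)) = B.pt := fun x => by rw [h0]; exact (b.1 x).2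
  have e1 : ∀ t x, p.1 (H (t, (0, x))) = B.pt := fun t x => by
    rw [hH, tentUp_zero, min_eq_left unitInterval.nonneg', mul_zero, hb0]
  have e2 : ∀ τ x, p.1 (H (1, (τ, x))) = B.pt := fun τ x => by
    rw [hH, unitInterval.symm_one, zero_mul, hb0]
  have e3 : ∀ t x, p.1 (H (t, (1, x))) = B.pt := fun t x => by
    rw [hH, tentDown_one, min_eq_right unitInterval.nonneg', mul_zero, hb0]
  let g0 : PtdMap X (ptdFiber p) := toFiber ⟨fun x => H (1, (0, x)), by fun_prop⟩
    (fun x => e1 1 x) (hHpt _ _)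
  let g1 : PtdMap X (ptdFiber p) := toFiber ⟨fun x => H (1, (1, x)), by fun_prop⟩
    (fun x => e2 1 x) (hHpt _ _)
  -- The three sides of the square of parameters other than the initial one lie over the base point,
  -- and lead from `b` to the constant map within the fibre.
  have s1 : b.toHom = g0.toHom := toFiber_toHom_eq ⟨fun y => H (y.1, (0, y.2)), by fun_prop⟩
    (fun y => e1 y.1 y.2) (fun t => hHpt t 0) _ _
    (fun x => (hH0 _).trans (hL0 x)) (fun x => rfl)
  have s2 : g0.toHom = g1.toHom := toFiber_toHom_eq ⟨fun y => H (1, (y.1, y.2)), by fun_prop⟩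
    (fun y => e2 y.1 y.2) (fun t => hHpt 1 t) _ _ (fun x => rfl) (fun x => rfl)
  have s3 : ptdZero X (ptdFiber p) = g1.toHom :=
    toFiber_toHom_eq ⟨fun y => H (y.1, (1, y.2)), by fun_prop⟩
      (fun y => e3 y.1 y.2) (fun t => hHpt t 1) _ _
      (fun x => (hH0 _).trans (hL1 x)) (fun x => rfl)
  exact s1.trans (s2.trans s3.symm)

/-! ### Maps from spheres to fibrations with a section -/

variable {d : ℕ} [NeZero d]

/-- The sequence of groups of the fibration is split by the section: the fibre injects, and dividing
an element by the section of its projection moves it into the kernel. -/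
theorem HasLifting.bijective_fiberIncl_mul (hp : HasLifting p) (ς : PtdMap B E)
    (hς : ∀ x, p.1 (ς.1 x) = x) : Function.Bijective
      fun y : (wedgeSphere d ⟶ ptdFiber p) × (wedgeSphere d ⟶ B) =>
        (y.1 ≫ (fiberIncl p).toHom) * (y.2 ≫ ς.toHom) := by
  have hςp : ς.toHom ≫ p.toHom = 𝟙 B :=
    congrArg (Quotient.mk _) (Subtype.ext (ContinuousMap.ext hς))
  have hj : Function.Injective (sphereHomComp d (fiberIncl p).toHom) :=
    (injective_iff_map_eq_one _).2 fun b hb => by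
      rw [sphereHom_one]
      exact hp.eq_ptdZero ς hς b (hb.trans (sphereHom_one d E))
  have hcomp : ∀ (b : wedgeSphere d ⟶ ptdFiber p) (x : wedgeSphere d ⟶ B),
      ((b ≫ (fiberIncl p).toHom) * (x ≫ ς.toHom)) ≫ p.toHom = x := fun b x => by
    rw [sphereHom_mul_comp, Category.assoc, Category.assoc, hςp, fiberIncl_comp, comp_ptdZero,
      ← sphereHom_one, one_mul, Category.comp_id]
  constructor
  · rintro ⟨b, x⟩ ⟨b', x'⟩ h
    have hx : x = x' := (hcomp b x).symm.trans ((congrArg (· ≫ p.toHom) h).trans (hcomp b' x'))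
    subst hx
    exact Prod.ext (hj (mul_right_cancel h)) rfl
  · intro a
    obtain ⟨b, hb⟩ := hp.exists_comp_fiberIncl (a * (a ≫ p.toHom ≫ ς.toHom)⁻¹) (by
      rw [sphereHom_mul_comp, sphereHom_inv_comp, Category.assoc, Category.assoc, hςp,
        Category.comp_id, mul_inv_cancel, sphereHom_one])
    refine ⟨(b, a ≫ p.toHom), ?_⟩
    change (b ≫ (fiberIncl p).toHom) * ((a ≫ p.toHom) ≫ ς.toHom) = a
    rw [hb, Category.assoc, inv_mul_cancel_right]

variable (p) in
/-- The fibre product of a pointed map with itself. -/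
def pairSpace : PtdSpace where
  carrier := {e : E.carrier × E.carrier // p.1 e.1 = p.1 e.2}
  pt := ⟨(E.pt, E.pt), rfl⟩

variable (p) in
/-- The first projection. -/
def pairFst : PtdMap (pairSpace p) E :=
  ⟨⟨fun e => e.1.1, continuous_fst.comp continuous_subtype_val⟩, rfl⟩

variable (p) in
/-- The second projection. -/
def pairSnd : PtdMap (pairSpace p) E :=
  ⟨⟨fun e => e.1.2, continuous_snd.comp continuous_subtype_val⟩, rfl⟩

variable (p) in
theorem pair_condition : (pairFst p).toHom ≫ p.toHom = (pairSnd p).toHom ≫ p.toHom :=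
  congrArg (Quotient.mk _) (Subtype.ext (ContinuousMap.ext fun x => x.2))

/-- The first projection is a base change of `p`: only the second component has to be lifted. -/
theorem HasLifting.pairFst (hp : HasLifting p) : HasLifting (pairFst p) := by
  intro X _ f h h0
  obtain ⟨H, hH0, hH, hpt⟩ := hp X ((PiAlgebra.pairSnd p).1.comp f) (p.1.comp h)
    (fun x => (congrArg p.1 (h0 x)).trans (f x).2)
  refine ⟨⟨fun y => ⟨(h y, H y), (hH y).symm⟩, by fun_prop⟩, fun x => ?_, fun y => rfl,
    fun x hx hx' t => ?_⟩
  · exact Subtype.ext (Prod.ext (h0 x) (hH0 x))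
  · refine Subtype.ext (Prod.ext (hx' t) (hpt x ?_ (fun s => ?_) t))
    · exact congrArg (fun e : (pairSpace p).carrier => e.1.2) hx
    · exact (congrArg p.1 (hx' s)).trans p.2

/-- Both the first projection and `p` have the same fibre, `ψ` and `ψ'` being the identifications,
so injectivity reduces to that of the fibre. For surjectivity, the pair of `a` with the section of
its projection is corrected in the second component by an element from the fibre. -/
theorem HasLifting.bijective_pair (hp : HasLifting p) (ς : PtdMap B E)
    (hς : ∀ x, p.1 (ς.1 x) = x) : Function.Bijective
      fun y : wedgeSphere d ⟶ pairSpace p =>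
        (⟨(y ≫ (PiAlgebra.pairFst p).toHom, y ≫ (pairSnd p).toHom), by
          rw [Category.assoc, Category.assoc, pair_condition]⟩ :
          {a : (wedgeSphere d ⟶ E) × (wedgeSphere d ⟶ E) // a.1 ≫ p.toHom = a.2 ≫ p.toHom}) := by
  have hςp : ς.toHom ≫ p.toHom = 𝟙 B :=
    congrArg (Quotient.mk _) (Subtype.ext (ContinuousMap.ext hς))
  let ψ : PtdMap (ptdFiber (PiAlgebra.pairFst p)) (ptdFiber p) :=
    toFiber ⟨fun e => e.1.1.2, by
      exact continuous_snd.comp (continuous_subtype_val.comp continuous_subtype_val)⟩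
      (fun e => e.1.2.symm.trans ((congrArg p.1 e.2).trans p.2)) rfl
  let ψ' : PtdMap (ptdFiber p) (ptdFiber (PiAlgebra.pairFst p)) :=
    toFiber ⟨fun e => ⟨(E.pt, e.1), p.2.trans e.2.symm⟩, by
      exact (continuous_const.prodMk continuous_subtype_val).subtype_mk _⟩ (fun e => rfl) rfl
  have hψ : ψ.toHom ≫ ψ'.toHom = 𝟙 _ :=
    congrArg (Quotient.mk _) (Subtype.ext (ContinuousMap.ext fun e =>
      Subtype.ext (Subtype.ext (Prod.ext e.2.symm rfl))))
  have hψj : ψ.toHom ≫ (fiberIncl p).toHom =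
    (fiberIncl (PiAlgebra.pairFst p)).toHom ≫ (pairSnd p).toHom := rfl
  let i2 : PtdMap (ptdFiber p) (pairSpace p) := ψ'.comp (fiberIncl _)
  let δ : PtdMap E (pairSpace p) := ⟨⟨fun e => ⟨(e, ς.1 (p.1 e)), (hς _).symm⟩, by
    exact (continuous_id.prodMk (by fun_prop)).subtype_mk _⟩,
    Subtype.ext (Prod.ext rfl ((congrArg ς.1 p.2).trans ς.2))⟩
  have hi1 : i2.toHom ≫ (PiAlgebra.pairFst p).toHom = ptdZero _ _ := rfl
  have hi2 : i2.toHom ≫ (pairSnd p).toHom = (fiberIncl p).toHom := rfl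
  have hδ1 : δ.toHom ≫ (PiAlgebra.pairFst p).toHom = 𝟙 _ := rfl
  have hδ2 : δ.toHom ≫ (pairSnd p).toHom = p.toHom ≫ ς.toHom := rfl
  constructor
  · intro γ γ' h
    have h1 : γ ≫ (PiAlgebra.pairFst p).toHom = γ' ≫ (PiAlgebra.pairFst p).toHom :=
      congrArg (fun y => y.1.1) h
    have h2 : γ ≫ (pairSnd p).toHom = γ' ≫ (pairSnd p).toHom := congrArg (fun y => y.1.2) h
    refine mul_inv_eq_one.1 ?_
    obtain ⟨c, hc⟩ := hp.pairFst.exists_comp_fiberIncl (γ * γ'⁻¹) (by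
      rw [sphereHom_mul_comp, sphereHom_inv_comp, h1, mul_inv_cancel, sphereHom_one])
    have hc' : c ≫ ψ.toHom = ptdZero _ _ := hp.eq_ptdZero ς hς _ (by
      rw [Category.assoc, hψj, ← Category.assoc, hc, sphereHom_mul_comp, sphereHom_inv_comp, h2,
        mul_inv_cancel, sphereHom_one])
    have hc0 : c = ptdZero _ _ := by
      rw [← Category.comp_id c, ← hψ, ← Category.assoc, hc', ptdZero_comp]
    rw [← hc, hc0, ptdZero_comp, sphereHom_one]
  · rintro ⟨⟨a, b⟩, hab⟩
    obtain ⟨β, hβ⟩ := hp.exists_comp_fiberIncl (b * (a ≫ p.toHom ≫ ς.toHom)⁻¹) (by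
      rw [sphereHom_mul_comp, sphereHom_inv_comp, Category.assoc, Category.assoc, hςp,
        Category.comp_id, ← (hab : a ≫ p.toHom = b ≫ p.toHom), mul_inv_cancel, sphereHom_one])
    refine ⟨(β ≫ i2.toHom) * (a ≫ δ.toHom), Subtype.ext (Prod.ext ?_ ?_)⟩
    · change ((β ≫ i2.toHom) * (a ≫ δ.toHom)) ≫ (PiAlgebra.pairFst p).toHom = a
      rw [sphereHom_mul_comp, Category.assoc, Category.assoc, hi1, hδ1, comp_ptdZero,
        ← sphereHom_one, one_mul, Category.comp_id]
    · change ((β ≫ i2.toHom) * (a ≫ δ.toHom)) ≫ (pairSnd p).toHom = b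
      rw [sphereHom_mul_comp, Category.assoc, Category.assoc, hi2, hδ2, hβ, inv_mul_cancel_right]

end Fibration

end PiAlgebra

end

end

section

open CategoryTheory Opposite

noncomputable section

namespace PiAlgebra

open scoped unitInterval

/-! ### Free loop spaces -/

section FreeLoopSpace

variable (k : ℕ) (Z : PtdSpace)

/-- The space of all maps `S^k → Z`. -/
def loopSpace : PtdSpace where
  carrier := C((sphere k).carrier, Z.carrier)
  pt := ContinuousMap.const _ Z.pt

/-- Evaluation at the base point. -/
def loopEval : PtdMap (loopSpace k Z) Z :=
  ⟨⟨fun α : C((sphere k).carrier, Z.carrier) => α (sphere k).pt, by fun_prop⟩, rfl⟩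

/-- The constant loops. -/
def loopConst : PtdMap Z (loopSpace k Z) :=
  ⟨⟨fun z => ContinuousMap.const (sphere k).carrier z, ContinuousMap.continuous_const'⟩, rfl⟩

variable {k Z}

/-- The family of loops given by a map on a product with the cube that is constant on the
boundary. -/
def cubeLoops [NeZero k] {T : Type} [TopologicalSpace T] (g : C(T × (Fin k → I), Z.carrier))
    (hg : ∀ t, ∀ x ∈ Cube.boundary (Fin k), ∀ x' ∈ Cube.boundary (Fin k), g (t, x) = g (t, x')) :
    C(T, (loopSpace k Z).carrier) :=
  (descend NeZero.one_le g hg).curry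

/-- The loop evaluated at a point of the cube. -/
def loopAt (α : (loopSpace k Z).carrier) (x : Fin k → I) : Z.carrier :=
  (show C((sphere k).carrier, Z.carrier) from α) (cubeCollapse k x)

theorem continuous_loopAt :
    Continuous fun p : (loopSpace k Z).carrier × (Fin k → I) => loopAt p.1 p.2 := by
  have : Continuous fun p : C((sphere k).carrier, Z.carrier) × (Fin k → I) =>
      p.1 (cubeCollapse k p.2) := by fun_prop
  exact this

theorem loop_ext [NeZero k] {α β : (loopSpace k Z).carrier} (h : ∀ x, loopAt α x = loopAt β x) :
    α = β := by
  refine ContinuousMap.ext fun s => ?_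
  obtain ⟨x, rfl⟩ := cubeCollapse_surjective NeZero.one_le s
  exact h x

theorem loopAt_cubeLoops [NeZero k] {T : Type} [TopologicalSpace T]
    (g : C(T × (Fin k → I), Z.carrier)) (hg) (t : T) (x : Fin k → I) :
    loopAt (cubeLoops g hg t) x = g (t, x) :=
  descend_apply NeZero.one_le g hg t x

theorem loopAt_of_mem_boundary (α : (loopSpace k Z).carrier) {x : Fin k → I}
    (hx : x ∈ Cube.boundary (Fin k)) : loopAt α x = (loopEval k Z).1 α :=
  congrArg (show C((sphere k).carrier, Z.carrier) from α) ((cubeCollapse_eq_pt_iff x).2 hx)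

theorem zero_mem_boundary [NeZero k] : (0 : Fin k → I) ∈ Cube.boundary (Fin k) :=
  ⟨0, Or.inl rfl⟩

/-- The cube, rescaled at its centre and clamped. -/
def zoom (r : ℝ) (x : Fin k → I) : Fin k → I := fun j =>
  Set.projIcc 0 1 zero_le_one ((r * centered x j + 1) / 2)

theorem continuous_zoom : Continuous fun p : ℝ × (Fin k → I) => zoom p.1 p.2 := by
  refine continuous_pi fun j => continuous_projIcc.comp ?_
  unfold centered
  fun_prop

theorem zoom_one (x : Fin k → I) : zoom 1 x = x := by
  funext j
  have : (1 * centered x j + 1) / 2 = (x j : ℝ) := by unfold centered; ring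
  rw [zoom, this, Set.projIcc_val]

theorem centered_zoom {r : ℝ} (hr : 0 ≤ r) {x : Fin k → I} (h : r * ‖centered x‖ ≤ 1) :
    centered (zoom r x) = r • centered x := by
  funext j
  have hj : |r * centered x j| ≤ 1 := by
    rw [abs_mul, abs_of_nonneg hr]
    exact (mul_le_mul_of_nonneg_left (norm_le_pi_norm (centered x) j) hr).trans h
  have hj := abs_le.1 hj
  change 2 * ((Set.projIcc 0 1 zero_le_one ((r * centered x j + 1) / 2) : I) : ℝ) - 1 = _
  rw [Set.projIcc_of_mem zero_le_one ⟨by linarith, by linarith⟩]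
  simp only [Pi.smul_apply, smul_eq_mul]
  ring

theorem zoom_mem_boundary {r : ℝ} (hr : 0 ≤ r) {x : Fin k → I} (h : r * ‖centered x‖ = 1) :
    zoom r x ∈ Cube.boundary (Fin k) := by
  rw [mem_boundary_iff, centered_zoom hr h.le, norm_smul, Real.norm_of_nonneg hr, h]

variable (k Z)

/-- To follow a path of base points, the loop is compressed into a smaller inner cube and a collar
is added on which the path is traversed. -/
theorem hasLifting_loopEval [NeZero k] : HasLifting (loopEval k Z) := by
  intro X _ f h h0
  have hz := continuous_zoom (k := k)
  have hl := continuous_loopAt (k := k) (Z := Z)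
  have hc := continuous_centered (k := k)
  -- At time `t` the inner cube has radius `1 / (1 + t)`. On the collar the path is taken at the
  -- time `(1 + t)‖y‖ - 1`, which is `0` at the inner edge and `t` on the boundary.
  let g : C((I × X) × (Fin k → I), Z.carrier) :=
    ⟨fun y => if (1 + (y.1.1 : ℝ)) * ‖centered y.2‖ ≤ 1 then
        loopAt (f y.1.2) (zoom (1 + (y.1.1 : ℝ)) y.2)
      else h (Set.projIcc 0 1 zero_le_one ((1 + (y.1.1 : ℝ)) * ‖centered y.2‖ - 1), y.1.2), by
      refine Continuous.if_le ?_ ?_ (by fun_prop) (by fun_prop) ?_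
      · exact hl.comp (((map_continuous f).comp (by fun_prop)).prodMk
          (hz.comp (f := fun y : (I × X) × (Fin k → I) => (1 + (y.1.1 : ℝ), y.2)) (by fun_prop)))
      · exact (map_continuous h).comp ((continuous_projIcc.comp (by fun_prop)).prodMk (by fun_prop))
      · intro y hy
        have hy0 : (0 : ℝ) ≤ y.1.1 := y.1.1.2.1
        rw [loopAt_of_mem_boundary _ (zoom_mem_boundary (by linarith) hy), hy, ← h0, sub_self]
        congr 2
        exact (Set.projIcc_left _).symm⟩
  have hgb : ∀ t x, ∀ y ∈ Cube.boundary (Fin k), g ((t, x), y) = h (t, x) := by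
    intro t x y hy
    have hN := (mem_boundary_iff y).1 hy
    change (if (1 + (t : ℝ)) * ‖centered y‖ ≤ 1 then _ else _) = _
    rw [hN, mul_one]
    split_ifs with ht
    · have ht0 : t = 0 := Subtype.ext (le_antisymm (by simpa using ht) t.2.1)
      subst ht0
      rw [h0]
      change loopAt (f x) (zoom (1 + 0) y) = _
      rw [add_zero, zoom_one, loopAt_of_mem_boundary _ hy]
    · change h (Set.projIcc 0 1 zero_le_one (1 + (t : ℝ) - 1), x) = _
      rw [add_sub_cancel_left, Set.projIcc_val]
  refine ⟨cubeLoops g fun t x hx x' hx' => (hgb _ _ x hx).trans (hgb _ _ x' hx').symm,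
    fun x => loop_ext fun y => ?_, fun p => ?_, fun x hx hx' t => loop_ext fun y => ?_⟩
  · rw [loopAt_cubeLoops]
    change (if (1 + ((0 : I) : ℝ)) * ‖centered y‖ ≤ 1 then loopAt (f x) (zoom (1 + ((0 : I) : ℝ)) y)
      else _) = _
    rw [show ((0 : I) : ℝ) = 0 from rfl, add_zero, if_pos (by rw [one_mul]; exact norm_centered_le y),
      zoom_one]
  · rw [← loopAt_of_mem_boundary _ (zero_mem_boundary (k := k)), loopAt_cubeLoops]
    exact hgb _ _ _ zero_mem_boundary
  · rw [loopAt_cubeLoops]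
    change (if _ then loopAt (f x) _ else h (_, x)) = Z.pt
    rw [hx, hx', ite_eq_right_iff]
    exact fun _ => rfl

theorem loopEval_loopConst (z : Z.carrier) : (loopEval k Z).1 ((loopConst k Z).1 z) = z := rfl

/-! ### Concatenation of free loops with the same base point -/

/-- The cube, reparametrized in the first coordinate. -/
def reparamCube [NeZero k] (φ : C(I × I, I)) : C(I × (Fin k → I), Fin k → I) :=
  ⟨fun p => Function.update p.2 0 (φ (p.1, p.2 0)), by fun_prop⟩

variable {k}

theorem reparamCube_mem_boundary [NeZero k] {φ : C(I × I, I)} (h0 : ∀ t, φ (t, 0) = 0)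
    (h1 : ∀ t, φ (t, 1) = 1) (t : I) {x : Fin k → I} (hx : x ∈ Cube.boundary (Fin k)) :
    reparamCube k φ (t, x) ∈ Cube.boundary (Fin k) := by
  obtain ⟨j, hj⟩ := hx
  refine ⟨j, ?_⟩
  change Function.update x 0 (φ (t, x 0)) j = 0 ∨ Function.update x 0 (φ (t, x 0)) j = 1
  by_cases h : j = 0
  · subst h
    rw [Function.update_self]
    rcases hj with hj | hj <;> rw [hj]
    exacts [Or.inl (h0 t), Or.inr (h1 t)]
  · rwa [Function.update_of_ne h]

/-- The homotopy of loops given by a reparametrization of the first coordinate. -/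
def reparamLoops [NeZero k] (φ : C(I × I, I)) (h0 : ∀ t, φ (t, 0) = 0)
    (h1 : ∀ t, φ (t, 1) = 1) : C(I × (loopSpace k Z).carrier, (loopSpace k Z).carrier) :=
  cubeLoops ⟨fun p => loopAt p.1.2 (reparamCube k φ (p.1.1, p.2)),
    continuous_loopAt.comp (continuous_fst.snd.prodMk
      ((reparamCube k φ).continuous.comp (by fun_prop)))⟩ fun t x hx x' hx' => by
      exact (loopAt_of_mem_boundary _ (reparamCube_mem_boundary h0 h1 _ hx)).trans
        (loopAt_of_mem_boundary _ (reparamCube_mem_boundary h0 h1 _ hx')).symm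

variable {Z}

theorem loopAt_reparamLoops [NeZero k] (φ : C(I × I, I)) (h0 h1) (t : I)
    (α : (loopSpace k Z).carrier) (x : Fin k → I) :
    loopAt (reparamLoops Z φ h0 h1 (t, α)) x = loopAt α (reparamCube k φ (t, x)) :=
  loopAt_cubeLoops _ _ (t, α) x

theorem reparamLoops_pt [NeZero k] (φ : C(I × I, I)) (h0 h1) (t : I) :
    reparamLoops (k := k) Z φ h0 h1 (t, (loopSpace k Z).pt) = (loopSpace k Z).pt :=
  loop_ext fun _ => loopAt_reparamLoops _ _ _ _ _ _

theorem reparamLoops_one [NeZero k] (φ : C(I × I, I)) (h0 h1) (h : ∀ s, φ (1, s) = s)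
    (α : (loopSpace k Z).carrier) : reparamLoops Z φ h0 h1 (1, α) = α :=
  loop_ext fun x => (loopAt_reparamLoops _ _ _ _ _ _).trans (by
    congr 1
    change Function.update x 0 (φ (1, x 0)) = x
    rw [h, Function.update_eq_self])

/-- The reparametrization by `s ↦ min ((2 - t) s) 1`. -/
def leftParam : C(I × I, I) :=
  ⟨fun p => Set.projIcc 0 1 zero_le_one ((2 - (p.1 : ℝ)) * p.2),
    continuous_projIcc.comp (by fun_prop)⟩

/-- The reparametrization by `s ↦ max ((2 - t) s - (1 - t)) 0`. -/
def rightParam : C(I × I, I) :=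
  ⟨fun p => Set.projIcc 0 1 zero_le_one ((2 - (p.1 : ℝ)) * p.2 - (1 - p.1)),
    continuous_projIcc.comp (by fun_prop)⟩

theorem leftParam_zero (t : I) : leftParam (t, 0) = 0 :=
  Set.projIcc_of_le_left zero_le_one (by simp)

theorem leftParam_one (t : I) : leftParam (t, 1) = 1 :=
  Set.projIcc_of_right_le zero_le_one (by have := t.2.2; simp; linarith)

theorem rightParam_zero (t : I) : rightParam (t, 0) = 0 :=
  Set.projIcc_of_le_left zero_le_one (by have := t.2.2; simp; linarith)

theorem rightParam_one (t : I) : rightParam (t, 1) = 1 :=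
  Set.projIcc_of_right_le zero_le_one (by simp; linarith)

theorem leftParam_end (s : I) : leftParam (1, s) = s := by
  change Set.projIcc 0 1 zero_le_one ((2 - 1) * (s : ℝ)) = s
  rw [show (2 - 1) * (s : ℝ) = s by ring, Set.projIcc_val]

theorem rightParam_end (s : I) : rightParam (1, s) = s := by
  change Set.projIcc 0 1 zero_le_one ((2 - 1) * (s : ℝ) - (1 - 1)) = s
  rw [show (2 - 1) * (s : ℝ) - (1 - 1) = s by ring, Set.projIcc_val]

theorem leftParam_start {s : I} (h : 1 / 2 ≤ (s : ℝ)) : leftParam (0, s) = 1 :=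
  Set.projIcc_of_right_le zero_le_one (by simp; linarith)

theorem rightParam_start {s : I} (h : (s : ℝ) ≤ 1 / 2) : rightParam (0, s) = 0 :=
  Set.projIcc_of_le_left zero_le_one (by simp; linarith)

theorem loopAt_leftParam_start [NeZero k] (α : (loopSpace k Z).carrier) {x : Fin k → I}
    (h : 1 / 2 ≤ (x 0 : ℝ)) :
    loopAt α (reparamCube k leftParam (0, x)) = (loopEval k Z).1 α :=
  loopAt_of_mem_boundary _ ⟨0, Or.inr ((Function.update_self (0 : Fin k) _ x).trans (leftParam_start h))⟩

theorem loopAt_rightParam_start [NeZero k] (α : (loopSpace k Z).carrier) {x : Fin k → I}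
    (h : (x 0 : ℝ) ≤ 1 / 2) :
    loopAt α (reparamCube k rightParam (0, x)) = (loopEval k Z).1 α :=
  loopAt_of_mem_boundary _ ⟨0, Or.inl ((Function.update_self (0 : Fin k) _ x).trans (rightParam_start h))⟩

variable (k Z) in
/-- Concatenation, on the product with the cube. -/
def concatCube [NeZero k] :
    C((pairSpace (loopEval k Z)).carrier × (Fin k → I), Z.carrier) :=
  ⟨fun p => if (p.2 0 : ℝ) ≤ 1 / 2 then loopAt p.1.1.1 (reparamCube k leftParam (0, p.2))
      else loopAt p.1.1.2 (reparamCube k rightParam (0, p.2)), by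
    have h1 : Continuous fun p : (pairSpace (loopEval k Z)).carrier × (Fin k → I) => p.1.1.1 :=
      (pairFst (loopEval k Z)).1.continuous.comp continuous_fst
    have h2 : Continuous fun p : (pairSpace (loopEval k Z)).carrier × (Fin k → I) => p.1.1.2 :=
      (pairSnd (loopEval k Z)).1.continuous.comp continuous_fst
    refine Continuous.if_le ?_ ?_ (by fun_prop) (by fun_prop) fun p hp => ?_
    · exact continuous_loopAt.comp (h1.prodMk (by fun_prop))
    · exact continuous_loopAt.comp (h2.prodMk (by fun_prop))
    · rw [loopAt_leftParam_start _ hp.ge, loopAt_rightParam_start _ hp.le]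
      exact p.1.2⟩

theorem concatCube_boundary [NeZero k] (e : (pairSpace (loopEval k Z)).carrier) {x : Fin k → I}
    (hx : x ∈ Cube.boundary (Fin k)) : concatCube k Z (e, x) = (loopEval k Z).1 e.1.1 := by
  change (if _ then _ else _) = _
  split_ifs
  · exact loopAt_of_mem_boundary _
      (reparamCube_mem_boundary leftParam_zero leftParam_one _ hx)
  · exact (loopAt_of_mem_boundary _
      (reparamCube_mem_boundary rightParam_zero rightParam_one _ hx)).trans e.2.symm

variable (k Z) in
/-- Concatenation of free loops. -/
def concat [NeZero k] : PtdMap (pairSpace (loopEval k Z)) (loopSpace k Z) :=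
  ⟨cubeLoops (concatCube k Z) fun t _ hx _ hx' =>
    (concatCube_boundary t hx).trans (concatCube_boundary t hx').symm,
    loop_ext fun _ => (loopAt_cubeLoops _ _ _ _).trans (ite_self _)⟩

theorem loopAt_concat [NeZero k] (e : (pairSpace (loopEval k Z)).carrier) (x : Fin k → I) :
    loopAt ((concat k Z).1 e) x = if (x 0 : ℝ) ≤ 1 / 2
      then loopAt e.1.1 (reparamCube k leftParam (0, x))
      else loopAt e.1.2 (reparamCube k rightParam (0, x)) :=
  loopAt_cubeLoops _ _ _ _

theorem concat_comp_loopEval [NeZero k] :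
    (concat k Z).toHom ≫ (loopEval k Z).toHom =
      (pairFst (loopEval k Z)).toHom ≫ (loopEval k Z).toHom :=
  congrArg (Quotient.mk _) (Subtype.ext (ContinuousMap.ext fun e =>
    (loopAt_of_mem_boundary ((concat k Z).1 e) (zero_mem_boundary (k := k))).symm.trans
      ((loopAt_cubeLoops _ _ _ _).trans (concatCube_boundary e zero_mem_boundary))))

variable (k Z) in
/-- The pair of a loop and the constant loop. -/
def pairConst : PtdMap (loopSpace k Z) (pairSpace (loopEval k Z)) :=
  ⟨⟨fun α => ⟨(α, (loopConst k Z).1 ((loopEval k Z).1 α)), rfl⟩,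
    (continuous_id.prodMk (by fun_prop)).subtype_mk _⟩, rfl⟩

variable (k Z) in
/-- The pair of the constant loop and a loop. -/
def constPair : PtdMap (loopSpace k Z) (pairSpace (loopEval k Z)) :=
  ⟨⟨fun α => ⟨((loopConst k Z).1 ((loopEval k Z).1 α), α), rfl⟩,
    Continuous.subtype_mk (Continuous.prodMk (by fun_prop) continuous_id) _⟩, rfl⟩

/-- At time `0` the reparametrization rests at the end of the loop during the second half, which is
concatenation with the constant loop; at time `1` it is the identity. -/
theorem pairConst_concat [NeZero k] : (pairConst k Z).toHom ≫ (concat k Z).toHom = 𝟙 _ := by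
  refine PtdMap.toHom_eq (reparamLoops Z leftParam leftParam_zero leftParam_one)
    (fun α => loop_ext fun x => ?_) (fun α => reparamLoops_one _ _ _ leftParam_end α)
    fun t => reparamLoops_pt _ _ _ _
  rw [loopAt_reparamLoops]
  refine Eq.trans ?_ (loopAt_concat ((pairConst k Z).1 α) x).symm
  split_ifs with h
  · rfl
  · exact loopAt_leftParam_start _ (not_le.1 h).le

theorem constPair_concat [NeZero k] : (constPair k Z).toHom ≫ (concat k Z).toHom = 𝟙 _ := by
  refine PtdMap.toHom_eq (reparamLoops Z rightParam rightParam_zero rightParam_one)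
    (fun α => loop_ext fun x => ?_) (fun α => reparamLoops_one _ _ _ rightParam_end α)
    fun t => reparamLoops_pt _ _ _ _
  rw [loopAt_reparamLoops]
  refine Eq.trans ?_ (loopAt_concat ((constPair k Z).1 α) x).symm
  split_ifs with h
  · exact loopAt_rightParam_start _ h
  · rfl

/-! ### Functoriality -/

variable {W : PtdSpace} (g : PtdMap Z W)

variable (k) in
/-- Composition of free loops with a pointed map. -/
def loopMap : PtdMap (loopSpace k Z) (loopSpace k W) :=
  ⟨⟨fun α : C((sphere k).carrier, Z.carrier) => g.1.comp α, g.1.continuous_postcomp⟩,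
    ContinuousMap.ext fun _ => g.2⟩

variable (k) in
/-- Composition of pairs of free loops with a pointed map. -/
def pairMap : PtdMap (pairSpace (loopEval k Z)) (pairSpace (loopEval k W)) :=
  ⟨⟨fun e => ⟨((loopMap k g).1 e.1.1, (loopMap k g).1 e.1.2), congrArg g.1 e.2⟩,
    (((loopMap k g).1.continuous.comp (pairFst (loopEval k Z)).1.continuous).prodMk
      ((loopMap k g).1.continuous.comp (pairSnd (loopEval k Z)).1.continuous)).subtype_mk _⟩,
    Subtype.ext (Prod.ext (loopMap k g).2 (loopMap k g).2)⟩

variable (k) in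
/-- Composition of based loops with a pointed map. -/
def basedLoopMap : PtdMap (ptdFiber (loopEval k Z)) (ptdFiber (loopEval k W)) :=
  toFiber ((loopMap k g).1.comp (fiberIncl (loopEval k Z)).1)
    (fun e => (congrArg g.1 e.2).trans g.2) (loopMap k g).2

theorem concat_loopMap [NeZero k] :
    (concat k Z).toHom ≫ (loopMap k g).toHom = (pairMap k g).toHom ≫ (concat k W).toHom :=
  congrArg (Quotient.mk _) (Subtype.ext (ContinuousMap.ext fun e => loop_ext fun x => by
    refine (congrArg g.1 (loopAt_concat e x)).trans
      (Eq.trans ?_ (loopAt_concat ((pairMap k g).1 e) x).symm)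
    split_ifs <;> rfl))

end FreeLoopSpace

end PiAlgebra

end

end

section

open CategoryTheory Opposite

noncomputable section

namespace PiAlgebra

open scoped unitInterval

/-! ### The adjunction between half-smash products and free loop spaces -/

section Adjunction

variable {k : ℕ} {X Y Z W : PtdSpace}

variable (k X) in
/-- The quotient map to the half-smash product, with the factors swapped. -/
def halfSmashMk : C(X.carrier × (sphere k).carrier, (halfSmash k X).carrier) :=
  ⟨fun p => Quot.mk _ (p.2, p.1), continuous_quot_mk.comp (by fun_prop)⟩

theorem halfSmashMk_pt (s : (sphere k).carrier) :
    halfSmashMk k X (X.pt, s) = (halfSmash k X).pt :=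
  Quot.sound (HalfSmashRel.collapse s _)

theorem halfSmash_ind {p : (halfSmash k X).carrier → Prop} (h : ∀ x s, p (halfSmashMk k X (x, s)))
    (w : (halfSmash k X).carrier) : p w := by
  obtain ⟨⟨s, x⟩⟩ := w
  exact h x s

/-- A map out of the half-smash product. -/
def halfSmashLift {T : Type*} [TopologicalSpace T] (g : C(X.carrier × (sphere k).carrier, T))
    (h : ∀ s t, g (X.pt, s) = g (X.pt, t)) : C((halfSmash k X).carrier, T) :=
  ⟨Quot.lift (fun p => g (p.2, p.1)) (by rintro _ _ ⟨s, t⟩; exact h s t),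
    continuous_quot_lift _ (by fun_prop)⟩

/-- The adjunct of a pointed map out of a half-smash product. -/
def adjunctMap (f : PtdMap (halfSmash k X) Z) : PtdMap X (loopSpace k Z) :=
  ⟨(f.1.comp (halfSmashMk k X)).curry, ContinuousMap.ext fun s =>
    (congrArg f.1 (halfSmashMk_pt s)).trans f.2⟩

theorem adjunctMap_congr {f g : PtdMap (halfSmash k X) Z} (h : f.toHom = g.toHom) :
    (adjunctMap f).toHom = (adjunctMap g).toHom := by
  obtain ⟨F, h0, h1, hF⟩ := PtdMap.exists_homotopy h
  let G : C((I × X.carrier) × (sphere k).carrier, Z.carrier) :=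
    F.comp ⟨fun p => (p.1.1, halfSmashMk k X (p.1.2, p.2)), by fun_prop⟩
  refine PtdMap.toHom_eq (Y := loopSpace k Z) G.curry (fun x => ContinuousMap.ext fun s => h0 _)
    (fun x => ContinuousMap.ext fun s => h1 _) fun t => ContinuousMap.ext fun s => ?_
  exact (congrArg (fun y => F (t, y)) (halfSmashMk_pt s)).trans (hF t)

/-- The homotopy is regarded as a map to the path space of `Z`, so that it descends along the
quotient defining the half-smash product. -/
theorem toHom_eq_of_adjunctMap {f g : PtdMap (halfSmash k X) Z}
    (h : (adjunctMap f).toHom = (adjunctMap g).toHom) : f.toHom = g.toHom := by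
  obtain ⟨F, h0, h1, hF⟩ := PtdMap.exists_homotopy h
  let F' : C(I × X.carrier, C((sphere k).carrier, Z.carrier)) := F
  let G : C((halfSmash k X).carrier, C(I, Z.carrier)) :=
    halfSmashLift (ContinuousMap.curry
      (F'.uncurry.comp ⟨fun p : (X.carrier × (sphere k).carrier) × I => ((p.2, p.1.1), p.1.2),
        by fun_prop⟩)) fun s t => ContinuousMap.ext fun τ => by
          change F' (τ, X.pt) s = F' (τ, X.pt) t
          rw [show F' (τ, X.pt) = ContinuousMap.const _ Z.pt from hF τ]
          rfl
  refine PtdMap.toHom_eq (G.uncurry.comp ⟨Prod.swap, continuous_swap⟩) (fun w => ?_) (fun w => ?_)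
    fun t => ?_
  · induction w using halfSmash_ind with
    | h x s => exact congrArg (fun α : C((sphere k).carrier, Z.carrier) => α s) (h0 x)
  · induction w using halfSmash_ind with
    | h x s => exact congrArg (fun α : C((sphere k).carrier, Z.carrier) => α s) (h1 x)
  · exact congrArg (fun α : C((sphere k).carrier, Z.carrier) => α (sphere k).pt) (hF t)

theorem exists_adjunctMap_eq (a : PtdMap X (loopSpace k Z)) : ∃ f, adjunctMap f = a := by
  let a' : C(X.carrier, C((sphere k).carrier, Z.carrier)) := a.1
  have ha : ∀ s, a' X.pt s = Z.pt := fun s =>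
    congrArg (fun α : C((sphere k).carrier, Z.carrier) => α s) a.2
  exact ⟨⟨halfSmashLift a'.uncurry fun s t => (ha s).trans (ha t).symm, ha _⟩, rfl⟩

/-- The adjunct of a homotopy class of maps out of a half-smash product. -/
def adjunct : (halfSmash k X ⟶ Z) → (X ⟶ loopSpace k Z) :=
  Quotient.lift (fun f => (adjunctMap f).toHom)
    fun _ _ h => adjunctMap_congr (Quotient.sound h)

theorem adjunct_bijective : Function.Bijective (adjunct (k := k) (X := X) (Z := Z)) := by
  constructor
  · intro f g h
    obtain ⟨f, rfl⟩ := PtdMap.toHom_surjective f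
    obtain ⟨g, rfl⟩ := PtdMap.toHom_surjective g
    exact toHom_eq_of_adjunctMap h
  · intro a
    obtain ⟨a, rfl⟩ := PtdMap.toHom_surjective a
    obtain ⟨f, rfl⟩ := exists_adjunctMap_eq a
    exact ⟨f.toHom, rfl⟩

theorem adjunct_comp (a : halfSmash k X ⟶ Z) (g : PtdMap Z W) :
    adjunct (a ≫ g.toHom) = adjunct a ≫ (loopMap k g).toHom := by
  obtain ⟨a, rfl⟩ := PtdMap.toHom_surjective a
  rfl

variable (k) in
/-- `(S^k)₊ ∧ -` on homotopy classes. -/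
def halfSmashHom (f : X ⟶ Y) : halfSmash k X ⟶ halfSmash k Y := (halfSmashFunctor k).map f

theorem adjunct_map_comp (f : X ⟶ Y) (a : halfSmash k Y ⟶ Z) :
    adjunct (halfSmashHom k f ≫ a) = f ≫ adjunct a := by
  obtain ⟨f, rfl⟩ := PtdMap.toHom_surjective f
  obtain ⟨a, rfl⟩ := PtdMap.toHom_surjective a
  rfl

theorem adjunct_loopEval (a : halfSmash k X ⟶ Z) :
    adjunct a ≫ (loopEval k Z).toHom = halfSmashIncl k X ≫ a := by
  obtain ⟨a, rfl⟩ := PtdMap.toHom_surjective a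
  rfl

theorem adjunct_proj_comp (x : X ⟶ Z) :
    adjunct (halfSmashProj k X ≫ x) = x ≫ (loopConst k Z).toHom := by
  obtain ⟨x, rfl⟩ := PtdMap.toHom_surjective x
  rfl

theorem halfSmashIncl_proj : halfSmashIncl k X ≫ halfSmashProj k X = 𝟙 X := rfl

theorem halfSmashIncl_naturality (f : X ⟶ Y) :
    halfSmashIncl k X ≫ halfSmashHom k f = f ≫ halfSmashIncl k Y := by
  obtain ⟨f, rfl⟩ := PtdMap.toHom_surjective f
  rfl

theorem halfSmashProj_naturality (f : X ⟶ Y) :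
    halfSmashHom k f ≫ halfSmashProj k Y = halfSmashProj k X ≫ f := by
  obtain ⟨f, rfl⟩ := PtdMap.toHom_surjective f
  refine congrArg (Quotient.mk _) (Subtype.ext (ContinuousMap.ext fun w => ?_))
  induction w using halfSmash_ind with
  | h x s => rfl

end Adjunction

/-! ### Smash products of spheres -/

section Smash

variable {k d : ℕ}

theorem continuous_append :
    Continuous fun p : (Fin k → I) × (Fin d → I) => Fin.append p.1 p.2 := by
  refine continuous_pi fun i => ?_
  induction i using Fin.addCases with
  | left i => simp only [Fin.append_left]; fun_prop
  | right i => simp only [Fin.append_right]; fun_prop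

theorem append_mem_boundary_iff (x : Fin k → I) (y : Fin d → I) :
    Fin.append x y ∈ Cube.boundary (Fin (k + d)) ↔
      x ∈ Cube.boundary (Fin k) ∨ y ∈ Cube.boundary (Fin d) := by
  constructor
  · rintro ⟨i, hi⟩
    induction i using Fin.addCases with
    | left i => exact Or.inl ⟨i, by simpa only [Fin.append_left] using hi⟩
    | right i => exact Or.inr ⟨i, by simpa only [Fin.append_right] using hi⟩
  · rintro (⟨i, hi⟩ | ⟨i, hi⟩)
    · exact ⟨Fin.castAdd d i, by simpa only [Fin.append_left] using hi⟩
    · exact ⟨Fin.natAdd k i, by simpa only [Fin.append_right] using hi⟩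

variable (k d)

/-- The smash product map, on the product of a cube and a sphere. -/
def smashCube [NeZero d] : C((Fin k → I) × (sphere d).carrier, (sphere (k + d)).carrier) :=
  descend NeZero.one_le ((cubeCollapse (k + d)).comp
    ⟨fun p : (Fin k → I) × (Fin d → I) => Fin.append p.1 p.2, continuous_append⟩)
    fun x y hy y' hy' => by
      exact ((cubeCollapse_eq_pt_iff _).2 ((append_mem_boundary_iff x y).2 (Or.inr hy))).trans
        ((cubeCollapse_eq_pt_iff _).2 ((append_mem_boundary_iff x y').2 (Or.inr hy'))).symm

theorem smashCube_apply [NeZero d] (x : Fin k → I) (y : Fin d → I) :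
    smashCube k d (x, cubeCollapse d y) = cubeCollapse (k + d) (Fin.append x y) :=
  descend_apply NeZero.one_le _ _ _ _

theorem smashCube_boundary [NeZero d] {x : Fin k → I} (hx : x ∈ Cube.boundary (Fin k))
    (s : (sphere d).carrier) : smashCube k d (x, s) = (sphere (k + d)).pt := by
  obtain ⟨y, rfl⟩ := cubeCollapse_surjective NeZero.one_le s
  rw [smashCube_apply, cubeCollapse_eq_pt_iff]
  exact (append_mem_boundary_iff x y).2 (Or.inl hx)

/-- The map `S^d × S^k → S^(k+d)` that collapses the wedge. -/
def smashSphere [NeZero k] [NeZero d] :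
    C((sphere d).carrier × (sphere k).carrier, (sphere (k + d)).carrier) :=
  descend NeZero.one_le ((smashCube k d).comp ⟨Prod.swap, continuous_swap⟩)
    fun s _ hx _ hx' => (smashCube_boundary k d hx s).trans (smashCube_boundary k d hx' s).symm

variable {k d} [NeZero k] [NeZero d]

theorem smashSphere_apply (y : Fin d → I) (x : Fin k → I) :
    smashSphere k d (cubeCollapse d y, cubeCollapse k x) =
      cubeCollapse (k + d) (Fin.append x y) :=
  (descend_apply NeZero.one_le _ _ _ _).trans (smashCube_apply k d x y)

theorem cubeCollapse_zero (k : ℕ) [NeZero k] : cubeCollapse k 0 = (sphere k).pt :=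
  (cubeCollapse_eq_pt_iff _).2 zero_mem_boundary

theorem smashSphere_pt_left (t : (sphere k).carrier) :
    smashSphere k d ((sphere d).pt, t) = (sphere (k + d)).pt := by
  obtain ⟨x, rfl⟩ := cubeCollapse_surjective NeZero.one_le t
  rw [← cubeCollapse_zero d, smashSphere_apply, cubeCollapse_eq_pt_iff]
  exact (append_mem_boundary_iff x 0).2 (Or.inr zero_mem_boundary)

theorem smashSphere_pt_right (s : (sphere d).carrier) :
    smashSphere k d (s, (sphere k).pt) = (sphere (k + d)).pt := by
  obtain ⟨y, rfl⟩ := cubeCollapse_surjective NeZero.one_le s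
  rw [← cubeCollapse_zero k, smashSphere_apply, cubeCollapse_eq_pt_iff]
  exact (append_mem_boundary_iff 0 y).2 (Or.inl zero_mem_boundary)

/-- Maps on a product with the smash product of two spheres. -/
def smashLift {T : Type} [TopologicalSpace T] {Z : PtdSpace}
    (F : C(T × (sphere d).carrier, C((sphere k).carrier, Z.carrier)))
    (h1 : ∀ t y, F (t, y) (sphere k).pt = Z.pt) (h2 : ∀ t x, F (t, (sphere d).pt) x = Z.pt) :
    C(T × (sphere (k + d)).carrier, Z.carrier) :=
  descend (NeZero.one_le.trans (Nat.le_add_right k d)) (F.uncurry.comp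
    ⟨fun p : T × (Fin (k + d) → I) => ((p.1, cubeCollapse d fun i => p.2 (Fin.natAdd k i)),
      cubeCollapse k fun i => p.2 (Fin.castAdd d i)), by fun_prop⟩) (by
      have : ∀ t, ∀ x ∈ Cube.boundary (Fin (k + d)),
          F (t, cubeCollapse d fun i => x (Fin.natAdd k i))
            (cubeCollapse k fun i => x (Fin.castAdd d i)) = Z.pt := by
        rintro t x ⟨i, hi⟩
        induction i using Fin.addCases with
        | left i =>
          rw [(cubeCollapse_eq_pt_iff fun i => x (Fin.castAdd d i)).2 ⟨i, hi⟩, h1]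
        | right i =>
          rw [(cubeCollapse_eq_pt_iff fun i => x (Fin.natAdd k i)).2 ⟨i, hi⟩, h2]
      intro t x hx x' hx'
      exact (this t x hx).trans (this t x' hx').symm)

theorem smashLift_apply {T : Type} [TopologicalSpace T] {Z : PtdSpace}
    (F : C(T × (sphere d).carrier, C((sphere k).carrier, Z.carrier))) (h1 h2) (t : T)
    (s : (sphere d).carrier) (s' : (sphere k).carrier) :
    smashLift (Z := Z) F h1 h2 (t, smashSphere k d (s, s')) = F (t, s) s' := by
  obtain ⟨y, rfl⟩ := cubeCollapse_surjective NeZero.one_le s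
  obtain ⟨x, rfl⟩ := cubeCollapse_surjective NeZero.one_le s'
  rw [smashSphere_apply]
  refine (descend_apply (NeZero.one_le.trans (Nat.le_add_right k d)) _ _ _ _).trans ?_
  change F (t, cubeCollapse d fun i => Fin.append x y (Fin.natAdd k i))
    (cubeCollapse k fun i => Fin.append x y (Fin.castAdd d i)) = _
  simp only [Fin.append_left, Fin.append_right]

theorem exists_smashSphere_eq (r : (sphere (k + d)).carrier) :
    ∃ s s', smashSphere k d (s, s') = r := by
  obtain ⟨x, rfl⟩ := cubeCollapse_surjective (NeZero.one_le.trans (Nat.le_add_right k d)) r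
  exact ⟨cubeCollapse d fun i => x (Fin.natAdd k i), cubeCollapse k fun i => x (Fin.castAdd d i),
    (smashSphere_apply _ _).trans (congrArg _ (Fin.append_castAdd_natAdd ..))⟩

variable {Z W : PtdSpace}

/-- The adjunct of a map out of a smash product of spheres. -/
def smashAdjunctMap (g : PtdMap (sphere (k + d)) Z) :
    PtdMap (sphere d) (ptdFiber (loopEval k Z)) :=
  toFiber (E := loopSpace k Z) (g.1.comp (smashSphere k d)).curry
    (fun s => (congrArg g.1 (smashSphere_pt_right s)).trans g.2)
    (ContinuousMap.ext fun t => (congrArg g.1 (smashSphere_pt_left t)).trans g.2)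

theorem smashAdjunctMap_congr {f g : PtdMap (sphere (k + d)) Z} (h : f.toHom = g.toHom) :
    (smashAdjunctMap f).toHom = (smashAdjunctMap g).toHom := by
  obtain ⟨F, h0, h1, hF⟩ := PtdMap.exists_homotopy h
  let G : C((I × (sphere d).carrier) × (sphere k).carrier, Z.carrier) :=
    F.comp ⟨fun p => (p.1.1, smashSphere k d (p.1.2, p.2)), by fun_prop⟩
  refine toFiber_toHom_eq (E := loopSpace k Z) G.curry (fun y => ?_) (fun t => ?_) _ _
    (fun s => ContinuousMap.ext fun s' => h0 _) (fun s => ContinuousMap.ext fun s' => h1 _)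
  · exact (congrArg (fun r => F (y.1, r)) (smashSphere_pt_right y.2)).trans (hF _)
  · exact ContinuousMap.ext fun s' =>
      (congrArg (fun r => F (t, r)) (smashSphere_pt_left s')).trans (hF _)

theorem toHom_eq_of_smashAdjunctMap {f g : PtdMap (sphere (k + d)) Z}
    (h : (smashAdjunctMap f).toHom = (smashAdjunctMap g).toHom) : f.toHom = g.toHom := by
  obtain ⟨F, h0, h1, hF⟩ := PtdMap.exists_homotopy h
  let F' : C(I × (sphere d).carrier, C((sphere k).carrier, Z.carrier)) :=
    (fiberIncl (loopEval k Z)).1.comp F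
  have e1 : ∀ t y, F' (t, y) (sphere k).pt = Z.pt := fun t y => (F (t, y)).2
  have e2 : ∀ t x, F' (t, (sphere d).pt) x = Z.pt := fun t x =>
    congrArg (fun α : C((sphere k).carrier, Z.carrier) => α x) (congrArg Subtype.val (hF t))
  refine PtdMap.toHom_eq (smashLift F' e1 e2) (fun r => ?_) (fun r => ?_) fun t => ?_
  · obtain ⟨s, s', rfl⟩ := exists_smashSphere_eq r
    rw [smashLift_apply]
    exact congrArg (fun α : C((sphere k).carrier, Z.carrier) => α s') (congrArg Subtype.val (h0 s))
  · obtain ⟨s, s', rfl⟩ := exists_smashSphere_eq r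
    rw [smashLift_apply]
    exact congrArg (fun α : C((sphere k).carrier, Z.carrier) => α s') (congrArg Subtype.val (h1 s))
  · rw [← smashSphere_pt_left (k := k) (d := d) (sphere k).pt, smashLift_apply, e2]

theorem exists_smashAdjunctMap_eq (a : PtdMap (sphere d) (ptdFiber (loopEval k Z))) :
    ∃ g, smashAdjunctMap g = a := by
  let F : C(Unit × (sphere d).carrier, C((sphere k).carrier, Z.carrier)) :=
    ((fiberIncl (loopEval k Z)).1.comp a.1).comp ⟨Prod.snd, continuous_snd⟩
  have e1 : ∀ t y, F (t, y) (sphere k).pt = Z.pt := fun t y => (a.1 y).2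
  have e2 : ∀ t x, F (t, (sphere d).pt) x = Z.pt := fun t x =>
    congrArg (fun α : C((sphere k).carrier, Z.carrier) => α x) (congrArg Subtype.val a.2)
  refine ⟨⟨(smashLift F e1 e2).comp ⟨fun r => ((), r), by fun_prop⟩, ?_⟩,
    Subtype.ext (ContinuousMap.ext fun s => Subtype.ext (ContinuousMap.ext fun s' => ?_))⟩
  · rw [← smashSphere_pt_left (k := k) (d := d) (sphere k).pt]
    exact (smashLift_apply F e1 e2 () _ _).trans (e2 _ _)
  · exact smashLift_apply F e1 e2 () s s'

/-- The adjunct of a homotopy class of maps out of a smash product of spheres. -/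
def smashAdjunct : (sphere (k + d) ⟶ Z) → (sphere d ⟶ ptdFiber (loopEval k Z)) :=
  Quotient.lift (fun f => (smashAdjunctMap f).toHom)
    fun _ _ h => smashAdjunctMap_congr (Quotient.sound h)

theorem smashAdjunct_bijective :
    Function.Bijective (smashAdjunct (k := k) (d := d) (Z := Z)) := by
  constructor
  · intro f g h
    obtain ⟨f, rfl⟩ := PtdMap.toHom_surjective f
    obtain ⟨g, rfl⟩ := PtdMap.toHom_surjective g
    exact toHom_eq_of_smashAdjunctMap h
  · intro a
    obtain ⟨a, rfl⟩ := PtdMap.toHom_surjective a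
    obtain ⟨f, rfl⟩ := exists_smashAdjunctMap_eq a
    exact ⟨f.toHom, rfl⟩

theorem smashAdjunct_comp (a : sphere (k + d) ⟶ Z) (g : PtdMap Z W) :
    smashAdjunct (a ≫ g.toHom) = smashAdjunct a ≫ (basedLoopMap k g).toHom := by
  obtain ⟨a, rfl⟩ := PtdMap.toHom_surjective a
  rfl

end Smash

end PiAlgebra

end

end

section

open CategoryTheory Opposite

noncomputable section

namespace PiAlgebra

/-! ### The cells of half-smash products -/

section Cells

/-- Pointed maps out of the sphere and out of the wedge with one summand agree. -/
theorem wedgeSphereIncl_bijective (d : ℕ) (Z : PtdSpace) :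
    Function.Bijective fun a : wedgeSphere d ⟶ Z => (wedgeSphereIncl d).toHom ≫ a :=
  ⟨fun _ _ h => wedgeSphere_hom_ext h, fun a => ⟨sphereDesc a, wedgeSphereIncl_sphereDesc a⟩⟩

variable (k d : ℕ) [NeZero k] [NeZero d]

/-- The split sequence for free loops and the adjunctions identify maps out of the half-smash
product naturally with pairs of maps from `S^(k+d)` and `S^d`. By the Yoneda argument the bijection
is composition with the pair corresponding to the identity. -/
theorem exists_topCell : ∃ δ : wedgeSphere (k + d) ⟶ halfSmash k (wedgeSphere d), ∀ Z,
    Function.Bijective fun a : halfSmash k (wedgeSphere d) ⟶ Z =>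
      (δ ≫ a, halfSmashIncl k (wedgeSphere d) ≫ a) := by
  let E1 (Z : PtdSpace) : (wedgeSphere (k + d) ⟶ Z) ≃ (wedgeSphere d ⟶ ptdFiber (loopEval k Z)) :=
    ((Equiv.ofBijective _ (wedgeSphereIncl_bijective (k + d) Z)).trans
      (Equiv.ofBijective _ smashAdjunct_bijective)).trans
      (Equiv.ofBijective _ (wedgeSphereIncl_bijective d _)).symm
  have hE1 : ∀ {Z} (u : wedgeSphere (k + d) ⟶ Z), (wedgeSphereIncl d).toHom ≫ E1 Z u =
      smashAdjunct ((wedgeSphereIncl (k + d)).toHom ≫ u) := fun u =>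
    (Equiv.ofBijective _ (wedgeSphereIncl_bijective d _)).apply_symm_apply _
  have hE1n : ∀ {Z W} (u : wedgeSphere (k + d) ⟶ Z) (g : PtdMap Z W),
      E1 W (u ≫ g.toHom) = E1 Z u ≫ (basedLoopMap k g).toHom := fun u g => by
    apply wedgeSphere_hom_ext
    rw [hE1, ← Category.assoc, smashAdjunct_comp, ← hE1, Category.assoc]
  let E2 (Z : PtdSpace) := Equiv.ofBijective _
    ((hasLifting_loopEval k Z).bijective_fiberIncl_mul (d := d) (loopConst k Z)
      (loopEval_loopConst k Z))
  let E3 (Z : PtdSpace) := Equiv.ofBijective _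
    (adjunct_bijective (k := k) (X := wedgeSphere d) (Z := Z))
  let R (Z : PtdSpace) := (((E1 Z).prodCongr (Equiv.refl (wedgeSphere d ⟶ Z))).trans (E2 Z)).trans
    (E3 Z).symm
  have hR : ∀ {Z} (u : wedgeSphere (k + d) ⟶ Z) (x : wedgeSphere d ⟶ Z),
      adjunct (R Z (u, x)) =
        (E1 Z u ≫ (fiberIncl (loopEval k Z)).toHom) * (x ≫ (loopConst k Z).toHom) := fun u x =>
    (E3 _).apply_symm_apply _
  have hj : ∀ {Z W} (g : PtdMap Z W), (fiberIncl (loopEval k Z)).toHom ≫ (loopMap k g).toHom =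
      (basedLoopMap k g).toHom ≫ (fiberIncl (loopEval k W)).toHom := fun g => rfl
  have hs : ∀ {Z W} (g : PtdMap Z W), (loopConst k Z).toHom ≫ (loopMap k g).toHom =
      g.toHom ≫ (loopConst k W).toHom := fun g => rfl
  have hRn : ∀ {Z W} (u : wedgeSphere (k + d) ⟶ Z) (x : wedgeSphere d ⟶ Z) (g : Z ⟶ W),
      R W (u ≫ g, x ≫ g) = R Z (u, x) ≫ g := fun u x g => by
    obtain ⟨g, rfl⟩ := PtdMap.toHom_surjective g
    apply adjunct_bijective.1
    rw [hR, adjunct_comp, hR, sphereHom_mul_comp, Category.assoc, Category.assoc, Category.assoc,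
      hj, hs, hE1n, Category.assoc]
  have hRx : ∀ {Z} (u : wedgeSphere (k + d) ⟶ Z) (x : wedgeSphere d ⟶ Z),
      halfSmashIncl k (wedgeSphere d) ≫ R Z (u, x) = x := fun {Z} u x => by
    have hσp : (loopConst k Z).toHom ≫ (loopEval k Z).toHom = 𝟙 Z := rfl
    rw [← adjunct_loopEval, hR, sphereHom_mul_comp, Category.assoc, Category.assoc, fiberIncl_comp,
      hσp, comp_ptdZero, ← sphereHom_one, one_mul, Category.comp_id]
  -- The universal pair; its second component must be the inclusion at the base point.
  obtain ⟨⟨δ, x⟩, hδ⟩ := (R _).surjective (𝟙 (halfSmash k (wedgeSphere d)))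
  have hx : halfSmashIncl k (wedgeSphere d) = x := by
    rw [← hRx δ x, hδ, Category.comp_id]
  subst hx
  refine ⟨δ, fun Z => ?_⟩
  have h1 : ∀ a : halfSmash k (wedgeSphere d) ⟶ Z,
      R Z (δ ≫ a, halfSmashIncl k (wedgeSphere d) ≫ a) = a := fun a => by
    rw [hRn, hδ, Category.id_comp]
  constructor
  · intro a b h
    rw [← h1 a, ← h1 b]
    exact congrArg (R Z) h
  · intro y
    exact ⟨R Z y, (R Z).injective (h1 _)⟩

/-- The inclusion of the top cell of the half-smash product with a sphere. -/
def topCell : wedgeSphere (k + d) ⟶ halfSmash k (wedgeSphere d) := (exists_topCell k d).choose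

theorem topCell_bijective (Z : PtdSpace) :
    Function.Bijective fun a : halfSmash k (wedgeSphere d) ⟶ Z =>
      (topCell k d ≫ a, halfSmashIncl k (wedgeSphere d) ≫ a) :=
  (exists_topCell k d).choose_spec Z

end Cells

/-! ### Concatenation on half-smash products with wedges of spheres -/

section LoopMul

variable {k : ℕ} {U V : SphereWedge 1 ⊤} {Z W : PtdSpace}

/-- The inclusion of a summand, in the homotopy category. -/
def summandHom (U : SphereWedge 1 ⊤) (j : Fin U.card) : wedgeSphere (U.dim j).1 ⟶ U.space :=
  (SphereWedge.toPtd 1 ⊤).map (U.summand j)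

theorem summandHom_bijective (U : SphereWedge 1 ⊤) (Z : PtdSpace) :
    Function.Bijective fun (a : U.space ⟶ Z) j => summandHom U j ≫ a := by
  have h : ∀ j (a : U.space ⟶ Z), (wedgeSphereIncl (U.dim j).1).toHom ≫ summandHom U j ≫ a =
      wedgeIncl U.family j ≫ a := fun j a => (Category.assoc _ _ _).symm
  constructor
  · intro a b e
    exact wedge_hom_ext fun j => ((h j a).symm.trans
      (congrArg (fun y => (wedgeSphereIncl (U.dim j).1).toHom ≫ y) (congrFun e j))).trans (h j b)
  · intro y
    obtain ⟨a, ha⟩ := (wedge_hom_bijective (X := U.family) Z).2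
      fun j => (wedgeSphereIncl (U.dim j).1).toHom ≫ y j
    exact ⟨a, funext fun j => wedgeSphere_hom_ext ((h j a).trans (congrFun ha j))⟩

theorem map_summandHom_bijective (U : SphereWedge 1 ⊤) (Z : PtdSpace) :
    Function.Bijective fun (a : halfSmash k U.space ⟶ Z) j =>
      halfSmashHom k (summandHom U j) ≫ a := by
  constructor
  · intro a b e
    refine adjunct_bijective.1 ((summandHom_bijective U _).1 (funext fun j => ?_))
    exact (adjunct_map_comp _ _).symm.trans
      ((congrArg adjunct (congrFun e j)).trans (adjunct_map_comp _ _))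
  · intro y
    obtain ⟨a', ha'⟩ := (summandHom_bijective U (loopSpace k Z)).2 fun j => adjunct (y j)
    obtain ⟨a, rfl⟩ := adjunct_bijective.2 a'
    exact ⟨a, funext fun j => adjunct_bijective.1 ((adjunct_map_comp _ _).trans (congrFun ha' j))⟩

/-- Two morphisms out of a half-smash product with the same restriction to the base. -/
def SameBase {X : PtdSpace} (a b : halfSmash k X ⟶ Z) : Prop :=
  halfSmashIncl k X ≫ a = halfSmashIncl k X ≫ b

theorem SameBase.comp {X : PtdSpace} {a b : halfSmash k X ⟶ Z} (h : SameBase a b) (g : Z ⟶ W) :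
    SameBase (a ≫ g) (b ≫ g) := by
  unfold SameBase
  rw [← Category.assoc, ← Category.assoc, h]

theorem SameBase.map_comp {X Y : PtdSpace} {a b : halfSmash k Y ⟶ Z} (h : SameBase a b)
    (f : X ⟶ Y) : SameBase (halfSmashHom k f ≫ a) (halfSmashHom k f ≫ b) := by
  have e : ∀ c : halfSmash k Y ⟶ Z, halfSmashIncl k X ≫ halfSmashHom k f ≫ c =
      f ≫ halfSmashIncl k Y ≫ c := fun c => by
    rw [← Category.assoc, halfSmashIncl_naturality, Category.assoc]
  exact (e a).trans ((congrArg (f ≫ ·) h).trans (e b).symm)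

/-- The constant loops on the restriction to the base. -/
def baseLoops {X : PtdSpace} (a : halfSmash k X ⟶ Z) : halfSmash k X ⟶ Z :=
  halfSmashProj k X ≫ halfSmashIncl k X ≫ a

theorem sameBase_baseLoops {X : PtdSpace} (a : halfSmash k X ⟶ Z) : SameBase a (baseLoops a) := by
  rw [SameBase, baseLoops, ← Category.assoc, halfSmashIncl_proj, Category.id_comp]

theorem adjunct_baseLoops {X : PtdSpace} (a : halfSmash k X ⟶ Z) :
    adjunct (baseLoops a) = adjunct a ≫ (loopEval k Z).toHom ≫ (loopConst k Z).toHom := by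
  rw [baseLoops, adjunct_proj_comp, ← Category.assoc, adjunct_loopEval]

theorem map_comp_baseLoops {X Y : PtdSpace} (f : X ⟶ Y) (a : halfSmash k Y ⟶ Z) :
    halfSmashHom k f ≫ baseLoops a = baseLoops (halfSmashHom k f ≫ a) := by
  rw [baseLoops, baseLoops, ← Category.assoc, halfSmashProj_naturality,
    ← Category.assoc (halfSmashIncl k X), halfSmashIncl_naturality, Category.assoc, Category.assoc]

theorem SameBase.baseLoops_eq {X : PtdSpace} {a b : halfSmash k X ⟶ Z} (h : SameBase a b) :
    baseLoops a = baseLoops b :=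
  congrArg (halfSmashProj k X ≫ ·) h

theorem halfSmash_hom_ext {a b : halfSmash k U.space ⟶ Z}
    (h : ∀ j, halfSmashHom k (summandHom U j) ≫ a = halfSmashHom k (summandHom U j) ≫ b) : a = b :=
  (map_summandHom_bijective U Z).1 (funext h)

variable [NeZero k]

/-- Maps from a wedge are tuples of maps from spheres, so the case of spheres suffices. It follows
that a pair of homotopy classes with equal base lifts uniquely to one class of pairs of loops. -/
theorem pairSpace_bijective (U : SphereWedge 1 ⊤) (Z : PtdSpace) : Function.Bijective
    fun y : U.space ⟶ pairSpace (loopEval k Z) =>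
      (⟨(y ≫ (pairFst (loopEval k Z)).toHom, y ≫ (pairSnd (loopEval k Z)).toHom), by
        rw [Category.assoc, Category.assoc, pair_condition]⟩ :
        {a : (U.space ⟶ loopSpace k Z) × (U.space ⟶ loopSpace k Z) //
          a.1 ≫ (loopEval k Z).toHom = a.2 ≫ (loopEval k Z).toHom}) := by
  have hS := fun j => (hasLifting_loopEval k Z).bijective_pair (d := (U.dim j).1) (loopConst k Z)
      (loopEval_loopConst k Z)
  constructor
  · intro y y' h
    refine (summandHom_bijective U _).1 (funext fun j => (hS j).1 (Subtype.ext (Prod.ext ?_ ?_)))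
    · have h1 : y ≫ (pairFst (loopEval k Z)).toHom = y' ≫ (pairFst (loopEval k Z)).toHom :=
        congrArg (fun a => a.1.1) h
      change (summandHom U j ≫ y) ≫ _ = (summandHom U j ≫ y') ≫ _
      rw [Category.assoc, h1, Category.assoc]
    · have h1 : y ≫ (pairSnd (loopEval k Z)).toHom = y' ≫ (pairSnd (loopEval k Z)).toHom :=
        congrArg (fun a => a.1.2) h
      change (summandHom U j ≫ y) ≫ _ = (summandHom U j ≫ y') ≫ _
      rw [Category.assoc, h1, Category.assoc]
  · rintro ⟨⟨a, b⟩, hab⟩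
    have hab : a ≫ (loopEval k Z).toHom = b ≫ (loopEval k Z).toHom := hab
    choose y hy using fun j => (hS j).2 ⟨(summandHom U j ≫ a, summandHom U j ≫ b), by
      rw [Category.assoc, Category.assoc, hab]⟩
    obtain ⟨z, hz⟩ := (summandHom_bijective U _).2 y
    have hz : ∀ j, summandHom U j ≫ z = y j := fun j => congrFun hz j
    refine ⟨z, Subtype.ext (Prod.ext ?_ ?_)⟩
    · refine (summandHom_bijective U _).1 (funext fun j => ?_)
      change summandHom U j ≫ z ≫ _ = _
      rw [← Category.assoc, hz]
      exact congrArg (fun a => a.1.1) (hy j)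
    · refine (summandHom_bijective U _).1 (funext fun j => ?_)
      change summandHom U j ≫ z ≫ _ = _
      rw [← Category.assoc, hz]
      exact congrArg (fun a => a.1.2) (hy j)

theorem exists_loopMul {a b : halfSmash k U.space ⟶ Z} (h : SameBase a b) :
    ∃ (c : halfSmash k U.space ⟶ Z) (e : U.space ⟶ pairSpace (loopEval k Z)),
      e ≫ (pairFst (loopEval k Z)).toHom = adjunct a ∧
      e ≫ (pairSnd (loopEval k Z)).toHom = adjunct b ∧
      adjunct c = e ≫ (concat k Z).toHom := by
  obtain ⟨e, he⟩ := (pairSpace_bijective U Z).2 ⟨(adjunct a, adjunct b),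
    (adjunct_loopEval a).trans (h.trans (adjunct_loopEval b).symm)⟩
  obtain ⟨c, hc⟩ := adjunct_bijective.2 (e ≫ (concat k Z).toHom)
  exact ⟨c, e, congrArg (fun a => a.1.1) he, congrArg (fun a => a.1.2) he, hc⟩

/-- The concatenation of two morphisms out of a half-smash product with the same restriction to the
base. -/
def loopMul (a b : halfSmash k U.space ⟶ Z) (h : SameBase a b) : halfSmash k U.space ⟶ Z :=
  (exists_loopMul h).choose

theorem loopMul_eq {a b c : halfSmash k U.space ⟶ Z} (h : SameBase a b)
    (e : U.space ⟶ pairSpace (loopEval k Z))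
    (h1 : e ≫ (pairFst (loopEval k Z)).toHom = adjunct a)
    (h2 : e ≫ (pairSnd (loopEval k Z)).toHom = adjunct b)
    (hc : adjunct c = e ≫ (concat k Z).toHom) : loopMul a b h = c := by
  obtain ⟨e', h1', h2', hc'⟩ := (exists_loopMul h).choose_spec
  have : e' = e := (pairSpace_bijective U Z).1
    (Subtype.ext (Prod.ext (h1'.trans h1.symm) (h2'.trans h2.symm)))
  subst this
  exact adjunct_bijective.1 (hc'.trans hc.symm)

theorem incl_loopMul {a b : halfSmash k U.space ⟶ Z} (h : SameBase a b) :
    halfSmashIncl k U.space ≫ loopMul a b h = halfSmashIncl k U.space ≫ a := by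
  obtain ⟨e', h1', h2', hc'⟩ := (exists_loopMul h).choose_spec
  change adjunct (loopMul a b h) = _ at hc'
  rw [← adjunct_loopEval, hc', Category.assoc, concat_comp_loopEval, ← Category.assoc, h1',
    adjunct_loopEval]

theorem loopMul_comp {a b : halfSmash k U.space ⟶ Z} (h : SameBase a b) (g : Z ⟶ W) :
    loopMul a b h ≫ g = loopMul (a ≫ g) (b ≫ g) (h.comp g) := by
  obtain ⟨g, rfl⟩ := PtdMap.toHom_surjective g
  obtain ⟨e, h1, h2, hc⟩ := (exists_loopMul h).choose_spec
  have e1 : (pairMap k g).toHom ≫ (pairFst (loopEval k W)).toHom =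
    (pairFst (loopEval k Z)).toHom ≫ (loopMap k g).toHom := rfl
  have e2 : (pairMap k g).toHom ≫ (pairSnd (loopEval k W)).toHom =
    (pairSnd (loopEval k Z)).toHom ≫ (loopMap k g).toHom := rfl
  refine (loopMul_eq _ (e ≫ (pairMap k g).toHom) ?_ ?_ ?_).symm
  · rw [Category.assoc, e1, ← Category.assoc, h1, adjunct_comp]
  · rw [Category.assoc, e2, ← Category.assoc, h2, adjunct_comp]
  · rw [adjunct_comp, Category.assoc, ← concat_loopMap, ← Category.assoc, ← hc]
    rfl

theorem map_comp_loopMul (f : U.space ⟶ V.space) {a b : halfSmash k V.space ⟶ Z}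
    (h : SameBase a b) : halfSmashHom k f ≫ loopMul a b h =
      loopMul (halfSmashHom k f ≫ a) (halfSmashHom k f ≫ b)
        (h.map_comp f) := by
  obtain ⟨e, h1, h2, hc⟩ := (exists_loopMul h).choose_spec
  refine (loopMul_eq _ (f ≫ e) ?_ ?_ ?_).symm
  · rw [Category.assoc, h1]
    exact (adjunct_map_comp f a).symm
  · rw [Category.assoc, h2]
    exact (adjunct_map_comp f b).symm
  · refine (adjunct_map_comp f _).trans ?_
    rw [Category.assoc, ← hc]
    rfl

theorem loopMul_baseLoops (a : halfSmash k U.space ⟶ Z) :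
    loopMul a (baseLoops a) (sameBase_baseLoops a) = a := by
  refine loopMul_eq _ (adjunct a ≫ (pairConst k Z).toHom) ?_
    ((Category.assoc _ _ _).trans (adjunct_baseLoops a).symm) ?_
  · exact (Category.assoc _ _ _).trans (Category.comp_id _)
  · rw [Category.assoc, pairConst_concat, Category.comp_id]

section Sphere

variable {d : Dim 1 ⊤}

/-- The group of maps from a sphere to a free loop space. -/
instance loopGroup (d : Dim 1 ⊤) (Z : PtdSpace) :
    Group ((SphereWedge.sphere d).space ⟶ loopSpace k Z) :=
  sphereHomGroup d.1 (loopSpace k Z)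

/-- Eckmann–Hilton: concatenation is a homomorphism for the group structure given by the source
sphere. The pair `e` factors both as `p r⁻¹ q` and as `q r⁻¹ p`, where `p` and `q` have one constant
component and `r` has two. -/
theorem adjunct_loopMul_sphere {a b : halfSmash k (SphereWedge.sphere d).space ⟶ Z}
    (h : SameBase a b) :
    adjunct (loopMul a b h) = adjunct a * (adjunct (baseLoops a))⁻¹ * adjunct b ∧
    adjunct (loopMul a b h) = adjunct b * (adjunct (baseLoops a))⁻¹ * adjunct a := by
  obtain ⟨e, h1, h2, hc⟩ := (exists_loopMul h).choose_spec
  let G := wedgeSphere d.1 ⟶ pairSpace (loopEval k Z)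
  let fst : G →* (wedgeSphere d.1 ⟶ loopSpace k Z) := sphereHomComp d.1 (pairFst _).toHom
  let snd : G →* (wedgeSphere d.1 ⟶ loopSpace k Z) := sphereHomComp d.1 (pairSnd _).toHom
  let mm : G →* (wedgeSphere d.1 ⟶ loopSpace k Z) := sphereHomComp d.1 (concat k Z).toHom
  have hinj : ∀ x y : G, fst x = fst y → snd x = snd y → x = y := fun x y hx hy =>
    (pairSpace_bijective (SphereWedge.sphere d) Z).1 (Subtype.ext (Prod.ext hx hy))
  let α : wedgeSphere d.1 ⟶ loopSpace k Z := adjunct a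
  let β : wedgeSphere d.1 ⟶ loopSpace k Z := adjunct b
  let ζ : wedgeSphere d.1 ⟶ loopSpace k Z := adjunct (baseLoops a)
  have hζα : ζ = α ≫ (loopEval k Z).toHom ≫ (loopConst k Z).toHom := adjunct_baseLoops a
  have hζβ : ζ = β ≫ (loopEval k Z).toHom ≫ (loopConst k Z).toHom := by
    rw [hζα, ← Category.assoc, ← Category.assoc]
    exact congrArg (· ≫ (loopConst k Z).toHom)
      ((adjunct_loopEval a).trans (h.trans (adjunct_loopEval b).symm))
  let p : G := α ≫ (pairConst k Z).toHom
  let q : G := β ≫ (constPair k Z).toHom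
  let r : G := ζ ≫ (pairConst k Z).toHom
  have hee : (loopConst k Z).toHom ≫ (loopEval k Z).toHom = 𝟙 Z := rfl
  have hζζ : ζ ≫ (loopEval k Z).toHom ≫ (loopConst k Z).toHom = ζ := by
    rw [hζα, Category.assoc, Category.assoc, ← Category.assoc (loopConst k Z).toHom, hee,
      Category.id_comp]
  have hpf : (pairConst k Z).toHom ≫ (pairFst (loopEval k Z)).toHom = 𝟙 _ := rfl
  have p1 : fst p = α := (Category.assoc _ _ _).trans
    ((congrArg (α ≫ ·) hpf).trans (Category.comp_id _))
  have hps : (pairConst k Z).toHom ≫ (pairSnd (loopEval k Z)).toHom =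
    (loopEval k Z).toHom ≫ (loopConst k Z).toHom := rfl
  have hqf : (constPair k Z).toHom ≫ (pairFst (loopEval k Z)).toHom =
    (loopEval k Z).toHom ≫ (loopConst k Z).toHom := rfl
  have hqs : (constPair k Z).toHom ≫ (pairSnd (loopEval k Z)).toHom = 𝟙 _ := rfl
  have p2 : snd p = ζ := (Category.assoc _ _ _).trans ((congrArg (α ≫ ·) hps).trans hζα.symm)
  have q1 : fst q = ζ := (Category.assoc _ _ _).trans ((congrArg (β ≫ ·) hqf).trans hζβ.symm)
  have q2 : snd q = β := (Category.assoc _ _ _).trans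
    ((congrArg (β ≫ ·) hqs).trans (Category.comp_id _))
  have r1 : fst r = ζ := (Category.assoc _ _ _).trans
    ((congrArg (ζ ≫ ·) hpf).trans (Category.comp_id _))
  have r2 : snd r = ζ := (Category.assoc _ _ _).trans ((congrArg (ζ ≫ ·) hps).trans hζζ)
  have pm : mm p = α := (Category.assoc _ _ _).trans
    ((congrArg (α ≫ ·) pairConst_concat).trans (Category.comp_id _))
  have qm : mm q = β := (Category.assoc _ _ _).trans
    ((congrArg (β ≫ ·) constPair_concat).trans (Category.comp_id _))
  have rm : mm r = ζ := (Category.assoc _ _ _).trans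
    ((congrArg (ζ ≫ ·) pairConst_concat).trans (Category.comp_id _))
  have hf : fst e = α := h1
  have hs : snd e = β := h2
  have em : adjunct (loopMul a b h) = mm e := hc
  have e1 : e = p * r⁻¹ * q := hinj _ _
    (by rw [hf, map_mul, map_mul, map_inv, p1, q1, r1, inv_mul_cancel_right])
    (by rw [hs, map_mul, map_mul, map_inv, p2, q2, r2, mul_inv_cancel, one_mul])
  have e2 : e = q * r⁻¹ * p := hinj _ _
    (by rw [hf, map_mul, map_mul, map_inv, p1, q1, r1, mul_inv_cancel, one_mul])
    (by rw [hs, map_mul, map_mul, map_inv, p2, q2, r2, inv_mul_cancel_right])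
  constructor
  · rw [em, e1, map_mul, map_mul, map_inv, pm, qm, rm]
    rfl
  · rw [em, e2, map_mul, map_mul, map_inv, pm, qm, rm]
    rfl

theorem loopMul_comm_sphere {a b : halfSmash k (SphereWedge.sphere d).space ⟶ Z}
    (h : SameBase a b) : loopMul a b h = loopMul b a h.symm := by
  apply adjunct_bijective.1
  rw [(adjunct_loopMul_sphere h).1, (adjunct_loopMul_sphere h.symm).2, h.baseLoops_eq]

theorem SameBase.loopMul {a b c : halfSmash k U.space ⟶ Z} (h : SameBase a b) (h' : SameBase a c) :
    SameBase (loopMul a b h) c :=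
  (incl_loopMul h).trans h'

theorem loopMul_assoc_sphere {a b c : halfSmash k (SphereWedge.sphere d).space ⟶ Z}
    (h : SameBase a b) (h' : SameBase b c) (h1 : SameBase (loopMul a b h) c)
    (h2 : SameBase a (loopMul b c h')) :
    loopMul (loopMul a b h) c h1 = loopMul a (loopMul b c h') h2 := by
  apply adjunct_bijective.1
  rw [(adjunct_loopMul_sphere h1).1, (adjunct_loopMul_sphere h2).1, (adjunct_loopMul_sphere h).1,
    (adjunct_loopMul_sphere h').1, h1.baseLoops_eq, h.baseLoops_eq, h'.baseLoops_eq]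
  simp only [mul_assoc]

theorem exists_loopMul_eq_sphere (a : halfSmash k (SphereWedge.sphere d).space ⟶ Z) :
    ∃ (b : halfSmash k (SphereWedge.sphere d).space ⟶ Z) (h : SameBase a b),
      loopMul a b h = baseLoops a := by
  -- With `α` the loop and `ζ` its constant loop, `ζ α⁻¹ ζ` solves `α ζ⁻¹ β = ζ`, the equation for
  -- an inverse under concatenation.
  obtain ⟨b, hb⟩ := adjunct_bijective.2
    (adjunct (baseLoops a) * (adjunct a)⁻¹ * adjunct (baseLoops a))
  have h : SameBase a b := by
    let ev : (wedgeSphere d.1 ⟶ loopSpace k Z) →* (wedgeSphere d.1 ⟶ Z) :=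
      sphereHomComp d.1 (loopEval k Z).toHom
    have e1 : ev (adjunct (baseLoops a)) = ev (adjunct a) :=
      (adjunct_loopEval _).trans ((sameBase_baseLoops a).symm.trans (adjunct_loopEval _).symm)
    have key : ∀ {G H : Type} [Group G] [Group H] (f : G →* H) (x y : G), f x = f y →
        f (x * y⁻¹ * x) = f y := fun f x y h => by
      rw [map_mul, map_mul, map_inv, h, inv_mul_cancel_right]
    have e2 : ev (adjunct b) = ev (adjunct a) := (congrArg ev hb).trans (key ev _ _ e1)
    exact (adjunct_loopEval _).symm.trans (e2.symm.trans (adjunct_loopEval _))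
  refine ⟨b, h, adjunct_bijective.1 ?_⟩
  rw [(adjunct_loopMul_sphere h).1, hb]
  group

end Sphere

theorem loopMul_congr {a a' b b' : halfSmash k U.space ⟶ Z} {h : SameBase a b} (ha : a = a')
    (hb : b = b') (h' : SameBase a' b') : loopMul a b h = loopMul a' b' h' := by
  subst ha hb
  rfl

theorem loopMul_comm {a b : halfSmash k U.space ⟶ Z} (h : SameBase a b) :
    loopMul a b h = loopMul b a h.symm :=
  halfSmash_hom_ext fun j =>
    (map_comp_loopMul (U := SphereWedge.sphere (U.dim j)) _ h).trans
      ((loopMul_comm_sphere _).trans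
        (map_comp_loopMul (U := SphereWedge.sphere (U.dim j)) _ h.symm).symm)

theorem loopMul_assoc {a b c : halfSmash k U.space ⟶ Z} (h : SameBase a b) (h' : SameBase b c)
    (h1 : SameBase (loopMul a b h) c) (h2 : SameBase a (loopMul b c h')) :
    loopMul (loopMul a b h) c h1 = loopMul a (loopMul b c h') h2 := by
  refine halfSmash_hom_ext fun j => ?_
  let S := SphereWedge.sphere (U.dim j)
  let f : S.space ⟶ U.space := summandHom U j
  have e1 := map_comp_loopMul (U := S) f h
  have e2 := map_comp_loopMul (U := S) f h'
  have k1 : SameBase (loopMul _ _ (h.map_comp f)) (halfSmashHom k f ≫ c) :=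
    (h.map_comp f).loopMul ((h.map_comp f).trans (h'.map_comp f))
  have k2 : SameBase (halfSmashHom k f ≫ a) (loopMul _ _ (h'.map_comp f)) :=
    (h.map_comp f).trans (incl_loopMul (h'.map_comp f)).symm
  refine (map_comp_loopMul (U := S) f h1).trans (Eq.trans ?_ (map_comp_loopMul (U := S) f h2).symm)
  exact (loopMul_congr e1 rfl k1).trans
    ((loopMul_assoc_sphere (h.map_comp f) (h'.map_comp f) k1 k2).trans
      (loopMul_congr rfl e2 _).symm)

theorem exists_loopMul_eq_baseLoops (a : halfSmash k U.space ⟶ Z) :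
    ∃ (b : halfSmash k U.space ⟶ Z) (h : SameBase a b), loopMul a b h = baseLoops a := by
  choose b h hb using fun j => exists_loopMul_eq_sphere (d := U.dim j)
    (halfSmashHom k (summandHom U j) ≫ a)
  obtain ⟨b', hb'⟩ := (map_summandHom_bijective U Z).2 b
  have hb' : ∀ j, halfSmashHom k (summandHom U j) ≫ b' = b j := fun j => congrFun hb' j
  have hab : SameBase a b' := (summandHom_bijective U Z).1 (funext fun j => by
    have e : ∀ c : halfSmash k U.space ⟶ Z, summandHom U j ≫ halfSmashIncl k U.space ≫ c =
        halfSmashIncl k _ ≫ halfSmashHom k (summandHom U j) ≫ c := fun c => by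
      rw [← Category.assoc, ← halfSmashIncl_naturality, Category.assoc]
    refine (e a).trans (Eq.trans ?_ (e b').symm)
    rw [hb']
    exact h j)
  refine ⟨b', hab, halfSmash_hom_ext fun j => ?_⟩
  refine (map_comp_loopMul (U := SphereWedge.sphere (U.dim j)) _ hab).trans ?_
  exact (loopMul_congr rfl (hb' j) (h j)).trans ((hb j).trans (map_comp_baseLoops _ _).symm)

end LoopMul

end PiAlgebra

end

end

section

open CategoryTheory Opposite

noncomputable section

namespace PiAlgebra

/-! ### Values of algebras on coproducts of spheres -/

section SphereCoproduct

/-- The family of maps from spheres exhibits a coproduct in the homotopy category. -/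
def IsSphereCoproduct {ι : Type} (D : ι → Dim 1 ⊤) {X : PtdSpace}
    (s : ∀ i, wedgeSphere (D i).1 ⟶ X) : Prop :=
  ∀ Z, Function.Bijective fun (a : X ⟶ Z) i => s i ≫ a

/-- A presheaf on the homotopy category sends finite coproducts of spheres to products. -/
def SphereContinuous (F : PtdSpaceᵒᵖ ⥤ Type) : Prop :=
  ∀ ⦃ι : Type⦄ [Finite ι] (D : ι → Dim 1 ⊤) ⦃X : PtdSpace⦄ (s : ∀ i, wedgeSphere (D i).1 ⟶ X),
    IsSphereCoproduct D s → Function.Bijective fun (x : F.obj (op X)) i => F.map (s i).op x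

theorem presheaf_map_map (F : PtdSpaceᵒᵖ ⥤ Type) {X Y Z : PtdSpace} (f : X ⟶ Y) (g : Y ⟶ Z)
    (x : F.obj (op Z)) : F.map f.op (F.map g.op x) = F.map (f ≫ g).op x :=
  (congrArg (fun h => h x) (F.map_comp g.op f.op)).symm

theorem presheaf_map_id (F : PtdSpaceᵒᵖ ⥤ Type) {X : PtdSpace} (x : F.obj (op X)) :
    F.map (𝟙 X).op x = x :=
  congrArg (fun h => h x) (F.map_id (op X))

theorem sphereContinuous_yoneda (Z : PtdSpace) : SphereContinuous (yoneda.obj Z) :=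
  fun _ _ _ _ _ h => h Z

/-- The value of an algebra on a pointed space. -/
def ptdValue (A : PiAlg 1 ⊤) : PtdSpaceᵒᵖ ⥤ Type := homotopyPresheaf.op ⋙ yoneda.obj A.obj

variable (A : PiAlg 1 ⊤)

/-- The value of an algebra on a wedge of spheres, by the Yoneda lemma. -/
def ptdValueEquiv (V : SphereWedge 1 ⊤) :
    (ptdValue A).obj (op V.space) ≃ A.obj.obj (op V) :=
  (yonedaEquiv : (yoneda.obj V ⟶ A.obj) ≃ A.obj.obj (op V))

theorem ptdValueEquiv_map {X : PtdSpace} {U : SphereWedge 1 ⊤} (f : U.space ⟶ X)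
    (φ : (ptdValue A).obj (op X)) : ptdValueEquiv A U ((ptdValue A).map f.op φ) =
      NatTrans.app (F := homotopyPresheaf.obj X) (G := A.obj) φ (op U) f :=
  congrArg (NatTrans.app (F := homotopyPresheaf.obj X) (G := A.obj) φ (op U))
    (Category.id_comp f)

/-- A morphism of `Π` in the homotopy category. -/
def ptdHom {U V : SphereWedge 1 ⊤} (f : U ⟶ V) : U.space ⟶ V.space := f

theorem ptdValueEquiv_naturality {U V : SphereWedge 1 ⊤} (f : U ⟶ V)
    (φ : (ptdValue A).obj (op V.space)) :
    ptdValueEquiv A U ((ptdValue A).map (ptdHom f).op φ) =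
      A.obj.map f.op (ptdValueEquiv A V φ) := by
  refine (ptdValueEquiv_map A (ptdHom f) φ).trans ?_
  refine (congrArg (NatTrans.app (F := homotopyPresheaf.obj V.space) (G := A.obj) φ (op U))
    (Category.comp_id (X := U.space) f).symm).trans ?_
  exact NatTrans.naturality_apply (F := homotopyPresheaf.obj V.space) (G := A.obj) φ f.op
    (𝟙 V.space)

/-- A space that is a coproduct of spheres in the homotopy category is isomorphic there to an object
of `Π`, and for such objects the claim is the product condition on `A`. -/
theorem sphereContinuous_ptdValue : SphereContinuous (ptdValue A) := by
  intro ι _ D X s hs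
  obtain ⟨n, ⟨e⟩⟩ := Finite.exists_equiv_fin ι
  let V : SphereWedge 1 ⊤ := ⟨n, fun j => D (e.symm j)⟩
  have hre : ∀ T : ι → Type, Function.Bijective fun (x : ∀ i, T i) (j : Fin n) => x (e.symm j) :=
    fun T => (Equiv.piCongrLeft' T e).bijective
  -- `V` and `X` corepresent the same product of sets of maps from spheres, so the comparison is
  -- invertible.
  obtain ⟨θ, hθ⟩ := (summandHom_bijective V X).2 fun j => s (e.symm j)
  have hθ : ∀ j, summandHom V j ≫ θ = s (e.symm j) := fun j => congrFun hθ j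
  have hiso : IsIso θ := by
    refine (isIso_iff_coyoneda_map_bijective θ).2 fun Z => ?_
    refine ((summandHom_bijective V Z).of_comp_iff' _).1 ?_
    refine Eq.subst (motive := Function.Bijective) ?_ ((hre _).comp (hs Z))
    funext a j
    exact (congrArg (· ≫ a) (hθ j).symm).trans (Category.assoc _ _ _)
  have h1 : Function.Bijective ((ptdValue A).map θ.op) := by
    have : IsIso ((ptdValue A).map θ.op) := inferInstance
    exact (isIso_iff_bijective _).1 this
  let T (i : ι) : Type := (ptdValue A).obj (op (wedgeSphere (D i).1))
  let E (j : Fin n) : T (e.symm j) ≃ A.obj.obj (op (SphereWedge.sphere (V.dim j))) :=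
    ptdValueEquiv A (SphereWedge.sphere (V.dim j))
  have hE : Function.Bijective fun (x : ∀ i, T i) (j : Fin n) => E j (x (e.symm j)) :=
    (Function.Bijective.piMap fun j => (E j).bijective).comp (hre T)
  refine (hE.of_comp_iff' _).1 ?_
  refine Eq.subst (motive := Function.Bijective) ?_
    ((A.property V).comp ((ptdValueEquiv A V).bijective.comp h1))
  funext φ j
  refine (ptdValueEquiv_naturality A (V.summand j) ((ptdValue A).map θ.op φ)).symm.trans ?_
  refine congrArg (E j) ((presheaf_map_map (ptdValue A) _ _ _).trans ?_)
  exact congrArg (fun f => (ptdValue A).map (Quiver.Hom.op f) φ) (hθ j)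

end SphereCoproduct

/-! ### Cells of half-smash products and their amalgams -/

section Amalgam

variable (k : ℕ)

/-- The dimension `k + d`. -/
def shiftDim (d : Dim 1 ⊤) : Dim 1 ⊤ :=
  ⟨k + d.1, d.2.1.trans (Nat.le_add_left _ _), d.2.1.trans (Nat.le_add_left _ _), le_top⟩

variable (U : SphereWedge 1 ⊤)

/-- The dimensions of the cells of a half-smash product. -/
def cellDim : Fin U.card ⊕ Fin U.card → Dim 1 ⊤ :=
  Sum.elim U.dim fun j => shiftDim k (U.dim j)

/-- The dimensions of the cells of an amalgam. -/
def amalgamDim (B : Type) : Fin U.card ⊕ (Fin U.card × B) → Dim 1 ⊤ :=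
  Sum.elim U.dim fun j => shiftDim k (U.dim j.1)

/-- The amalgam of copies of a half-smash product along the base. -/
def amalgam (B : Type) : PtdSpace := wedge fun i => wedgeSphere (amalgamDim k U B i).1

/-- The cells of an amalgam. -/
def amalgamCell (B : Type) (i) : wedgeSphere (amalgamDim k U B i).1 ⟶ amalgam k U B :=
  wedgeIncl (fun i => wedgeSphere (amalgamDim k U B i).1) i

theorem isSphereCoproduct_amalgamCell (B : Type) :
    IsSphereCoproduct (amalgamDim k U B) (amalgamCell k U B) :=
  fun Z => wedge_hom_bijective Z

variable [NeZero k]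

/-- The cells of a half-smash product. -/
def cell : ∀ i, wedgeSphere (cellDim k U i).1 ⟶ halfSmash k U.space
  | Sum.inl j => summandHom U j ≫ halfSmashIncl k U.space
  | Sum.inr j => topCell k (U.dim j).1 ≫ halfSmashHom k (summandHom U j)

theorem isSphereCoproduct_cell : IsSphereCoproduct (cellDim k U) (cell k U) := by
  intro Z
  have e1 : ∀ (a : halfSmash k U.space ⟶ Z) (j : Fin U.card), cell k U (Sum.inl j) ≫ a =
      halfSmashIncl k (wedgeSphere (U.dim j).1) ≫ halfSmashHom k (summandHom U j) ≫ a :=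
    fun a j => by
      change (summandHom U j ≫ halfSmashIncl k U.space) ≫ a = _
      rw [← halfSmashIncl_naturality, Category.assoc]
  have e2 : ∀ (a : halfSmash k U.space ⟶ Z) (j : Fin U.card), cell k U (Sum.inr j) ≫ a =
      topCell k (U.dim j).1 ≫ halfSmashHom k (summandHom U j) ≫ a :=
    fun a j => Category.assoc _ _ _
  constructor
  · intro a b h
    refine halfSmash_hom_ext fun j => (topCell_bijective k (U.dim j).1 Z).1 (Prod.ext ?_ ?_)
    · exact (e2 a j).symm.trans ((congrFun h (Sum.inr j)).trans (e2 b j))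
    · exact (e1 a j).symm.trans ((congrFun h (Sum.inl j)).trans (e1 b j))
  · intro y
    choose z hz using fun j => (topCell_bijective k (U.dim j).1 Z).2 (y (Sum.inr j), y (Sum.inl j))
    obtain ⟨a, ha⟩ := (map_summandHom_bijective (k := k) U Z).2 z
    refine ⟨a, funext fun i => ?_⟩
    rcases i with j | j
    · exact (e1 a j).trans ((congrArg (halfSmashIncl k (wedgeSphere (U.dim j).1) ≫ ·)
        (congrFun ha j)).trans (congrArg Prod.snd (hz j)))
    · exact (e2 a j).trans ((congrArg (topCell k (U.dim j).1 ≫ ·)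
        (congrFun ha j)).trans (congrArg Prod.fst (hz j)))

/-- The dimensions of the two cells of the half-smash product with a sphere. -/
def sphereCellDim (d : Dim 1 ⊤) (t : Bool) : Dim 1 ⊤ := cond t (shiftDim k d) d

/-- The two cells of the half-smash product with a sphere. -/
def sphereCell (d : Dim 1 ⊤) :
    ∀ t, wedgeSphere (sphereCellDim k d t).1 ⟶ halfSmash k (wedgeSphere d.1)
  | true => topCell k d.1
  | false => halfSmashIncl k (wedgeSphere d.1)

theorem isSphereCoproduct_sphereCell (d : Dim 1 ⊤) :
    IsSphereCoproduct (sphereCellDim k d) (sphereCell k d) := by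
  intro Z
  constructor
  · intro a b h
    exact (topCell_bijective k d.1 Z).1 (Prod.ext (congrFun h true) (congrFun h false))
  · intro y
    obtain ⟨a, ha⟩ := (topCell_bijective k d.1 Z).2 (y true, y false)
    refine ⟨a, funext fun t => ?_⟩
    cases t
    · exact congrArg Prod.snd ha
    · exact congrArg Prod.fst ha

variable {B : Type}

theorem exists_amalgamIncl (b : B) : ∃ f : halfSmash k U.space ⟶ amalgam k U B,
    (∀ j, cell k U (Sum.inl j) ≫ f = amalgamCell k U B (Sum.inl j)) ∧
      ∀ j, cell k U (Sum.inr j) ≫ f = amalgamCell k U B (Sum.inr (j, b)) := by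
  obtain ⟨f, hf⟩ := (isSphereCoproduct_cell k U (amalgam k U B)).2 fun
    | Sum.inl j => amalgamCell k U B (Sum.inl j)
    | Sum.inr j => amalgamCell k U B (Sum.inr (j, b))
  exact ⟨f, fun j => congrFun hf (Sum.inl j), fun j => congrFun hf (Sum.inr j)⟩

/-- The inclusion of a copy in an amalgam. -/
def amalgamIncl (b : B) : halfSmash k U.space ⟶ amalgam k U B := (exists_amalgamIncl k U b).choose

theorem cell_inl_amalgamIncl (b : B) (j : Fin U.card) :
    cell k U (Sum.inl j) ≫ amalgamIncl k U b = amalgamCell k U B (Sum.inl j) :=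
  (exists_amalgamIncl k U b).choose_spec.1 j

theorem cell_inr_amalgamIncl (b : B) (j : Fin U.card) :
    cell k U (Sum.inr j) ≫ amalgamIncl k U b = amalgamCell k U B (Sum.inr (j, b)) :=
  (exists_amalgamIncl k U b).choose_spec.2 j

/-- All copies share the base cells; only the top cells are indexed by `B`. -/
theorem sameBase_amalgamIncl (b b' : B) : SameBase (amalgamIncl k U b) (amalgamIncl k U b') := by
  refine (summandHom_bijective U _).1 (funext fun j => ?_)
  exact (Category.assoc _ _ _).symm.trans ((cell_inl_amalgamIncl k U b j).trans
    ((cell_inl_amalgamIncl k U b' j).symm.trans (Category.assoc _ _ _)))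

variable {k U} {F : PtdSpaceᵒᵖ ⥤ Type} (hF : SphereContinuous F)

include hF

theorem SphereContinuous.amalgam_ext [Nonempty B] [Finite B]
    {w w' : F.obj (op (amalgam k U B))}
    (h : ∀ b, F.map (amalgamIncl k U b).op w = F.map (amalgamIncl k U b).op w') : w = w' := by
  have h' : ∀ b i, F.map (cell k U i ≫ amalgamIncl k U b).op w =
      F.map (cell k U i ≫ amalgamIncl k U b).op w' := fun b i => by
    rw [← presheaf_map_map, h, presheaf_map_map]
  refine (hF _ _ (isSphereCoproduct_amalgamCell k U B)).1 (funext fun i => ?_)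
  rcases i with j | ⟨j, b⟩
  · have := h' (Classical.arbitrary B) (Sum.inl j)
    rwa [cell_inl_amalgamIncl] at this
  · have := h' b (Sum.inr j)
    rwa [cell_inr_amalgamIncl] at this

theorem SphereContinuous.exists_amalgam [Nonempty B] [Finite B]
    (u : B → F.obj (op (halfSmash k U.space)))
    (hu : ∀ b b', F.map (halfSmashIncl k U.space).op (u b) =
      F.map (halfSmashIncl k U.space).op (u b')) :
    ∃ w : F.obj (op (amalgam k U B)), ∀ b, F.map (amalgamIncl k U b).op w = u b := by
  -- The values on the base cells are taken from an arbitrary member of the family; by `hu` the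
  -- choice does not matter.
  obtain ⟨w, hw⟩ := (hF _ _ (isSphereCoproduct_amalgamCell k U B)).2 fun
    | Sum.inl j => F.map (cell k U (Sum.inl j)).op (u (Classical.arbitrary B))
    | Sum.inr (j, b) => F.map (cell k U (Sum.inr j)).op (u b)
  refine ⟨w, fun b => (hF _ _ (isSphereCoproduct_cell k U)).1 (funext fun i => ?_)⟩
  refine (presheaf_map_map F _ _ w).trans ?_
  rcases i with j | j
  · rw [cell_inl_amalgamIncl]
    refine (congrFun hw (Sum.inl j)).trans ?_
    change F.map (summandHom U j ≫ halfSmashIncl k U.space).op _ =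
      F.map (summandHom U j ≫ halfSmashIncl k U.space).op _
    rw [← presheaf_map_map, hu _ b, presheaf_map_map]
  · rw [cell_inr_amalgamIncl]
    exact congrFun hw (Sum.inr (j, b))

end Amalgam

end PiAlgebra

end

end

section

open CategoryTheory Opposite

noncomputable section

namespace PiAlgebra

/-! ### Addition of free loops in an algebra -/

section LoopAdd

variable {k : ℕ} {U V : SphereWedge 1 ⊤} {A : PiAlg 1 ⊤}

/-- Two elements of the value at a half-smash product with the same restriction to the base. -/
def SameEval (u v : (ptdValue A).obj (op (halfSmash k U.space))) : Prop :=
  (ptdValue A).map (halfSmashIncl k U.space).op u = (ptdValue A).map (halfSmashIncl k U.space).op v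

theorem SameBase.sameEval {Z : PtdSpace} {a b : halfSmash k U.space ⟶ Z} (h : SameBase a b)
    (z : (ptdValue A).obj (op Z)) : SameEval ((ptdValue A).map a.op z) ((ptdValue A).map b.op z) := by
  unfold SameEval
  rw [presheaf_map_map, h, presheaf_map_map]

theorem SameEval.map {u v : (ptdValue A).obj (op (halfSmash k V.space))} (h : SameEval u v)
    (f : U.space ⟶ V.space) : SameEval ((ptdValue A).map (halfSmashHom k f).op u)
      ((ptdValue A).map (halfSmashHom k f).op v) := by
  unfold SameEval
  rw [presheaf_map_map, halfSmashIncl_naturality, ← presheaf_map_map, h, presheaf_map_map,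
    presheaf_map_map, halfSmashIncl_naturality]

/-- The constant loop at the base point of a loop. -/
def constLoop (u : (ptdValue A).obj (op (halfSmash k U.space))) :
    (ptdValue A).obj (op (halfSmash k U.space)) :=
  (ptdValue A).map (halfSmashProj k U.space).op ((ptdValue A).map (halfSmashIncl k U.space).op u)

theorem constLoop_eq (u : (ptdValue A).obj (op (halfSmash k U.space))) :
    (ptdValue A).map (baseLoops (𝟙 (halfSmash k U.space))).op u = constLoop u := by
  rw [baseLoops, Category.comp_id, ← presheaf_map_map]
  rfl

theorem sameEval_constLoop (u : (ptdValue A).obj (op (halfSmash k U.space))) :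
    SameEval u (constLoop u) := by
  have h := (sameBase_baseLoops (𝟙 (halfSmash k U.space))).sameEval u
  rwa [presheaf_map_id, constLoop_eq] at h

variable [NeZero k]

/-- Finitely many loops with a common base point come from a single element on the amalgam.
Identities between them therefore follow from universal ones in the homotopy category. -/
theorem exists_representation {B : Type} [Finite B] [Nonempty B]
    (u : B → (ptdValue A).obj (op (halfSmash k U.space))) (hu : ∀ b b', SameEval (u b) (u b')) :
    ∃ w : (ptdValue A).obj (op (amalgam k U B)),
      ∀ b, (ptdValue A).map (amalgamIncl k U b).op w = u b :=
  SphereContinuous.exists_amalgam (sphereContinuous_ptdValue A) u hu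

theorem exists_pair_representation {u v : (ptdValue A).obj (op (halfSmash k U.space))}
    (h : SameEval u v) : ∃ w : (ptdValue A).obj (op (amalgam k U Bool)),
      (ptdValue A).map (amalgamIncl k U true).op w = u ∧
      (ptdValue A).map (amalgamIncl k U false).op w = v := by
  obtain ⟨w, hw⟩ := exists_representation (fun b => cond b u v) (by
    intro b b'
    cases b <;> cases b'
    exacts [rfl, h.symm, h, rfl])
  exact ⟨w, hw true, hw false⟩

/-- The sum of two free loops with the same base point. -/
def loopAdd (u v : (ptdValue A).obj (op (halfSmash k U.space))) (h : SameEval u v) :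
    (ptdValue A).obj (op (halfSmash k U.space)) :=
  (ptdValue A).map (loopMul (amalgamIncl k U true) (amalgamIncl k U false)
    (sameBase_amalgamIncl k U true false)).op (exists_pair_representation h).choose

/-- The sum can be computed from any common source: a pair of maps with the same base factors
through the amalgam, and the element there is unique. All laws for `loopAdd` are deduced from those
for `loopMul` in this way. -/
theorem loopAdd_eq {Z : PtdSpace} {a b : halfSmash k U.space ⟶ Z} (h : SameBase a b)
    (z : (ptdValue A).obj (op Z)) {u v : (ptdValue A).obj (op (halfSmash k U.space))}
    (huv : SameEval u v) (hu : (ptdValue A).map a.op z = u) (hv : (ptdValue A).map b.op z = v) :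
    loopAdd u v huv = (ptdValue A).map (loopMul a b h).op z := by
  have hw := (exists_pair_representation huv).choose_spec
  obtain ⟨g, hg⟩ := SphereContinuous.exists_amalgam (sphereContinuous_yoneda Z) (k := k) (U := U)
    (fun t : Bool => cond t a b) (by
      intro b b'
      cases b <;> cases b'
      exacts [rfl, h.symm, h, rfl])
  have hg1 : amalgamIncl k U true ≫ g = a := hg true
  have hg2 : amalgamIncl k U false ≫ g = b := hg false
  have e : (exists_pair_representation huv).choose = (ptdValue A).map (Quiver.Hom.op g) z := by
    refine SphereContinuous.amalgam_ext (sphereContinuous_ptdValue A) (k := k) (U := U) (B := Bool) fun t => ?_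
    refine Eq.trans ?_ (presheaf_map_map (ptdValue A) _ g z).symm
    cases t
    · exact hw.2.trans (hv.symm.trans (congrArg (fun f => (ptdValue A).map (Quiver.Hom.op f) z)
        hg2.symm))
    · exact hw.1.trans (hu.symm.trans (congrArg (fun f => (ptdValue A).map (Quiver.Hom.op f) z)
        hg1.symm))
  rw [loopAdd, e]
  refine (presheaf_map_map (ptdValue A) _ g z).trans ?_
  exact congrArg (fun f => (ptdValue A).map (Quiver.Hom.op f) z)
    ((loopMul_comp _ g).trans (loopMul_congr hg1 hg2 h))

theorem eval_loopAdd {u v : (ptdValue A).obj (op (halfSmash k U.space))} (h : SameEval u v) :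
    SameEval (loopAdd u v h) u := by
  obtain ⟨w, rfl, rfl⟩ := exists_pair_representation h
  rw [loopAdd_eq (sameBase_amalgamIncl k U true false) w h rfl rfl]
  exact SameBase.sameEval (incl_loopMul _) w

theorem map_loopAdd {u v : (ptdValue A).obj (op (halfSmash k V.space))} (h : SameEval u v)
    (f : U.space ⟶ V.space) : (ptdValue A).map (halfSmashHom k f).op (loopAdd u v h) =
      loopAdd ((ptdValue A).map (halfSmashHom k f).op u)
        ((ptdValue A).map (halfSmashHom k f).op v) (h.map f) := by
  obtain ⟨w, rfl, rfl⟩ := exists_pair_representation h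
  have hb := sameBase_amalgamIncl k V true false
  rw [loopAdd_eq hb w h rfl rfl, presheaf_map_map, map_comp_loopMul f hb]
  exact (loopAdd_eq (hb.map_comp f) w _ (presheaf_map_map _ _ _ _).symm
    (presheaf_map_map _ _ _ _).symm).symm

theorem loopAdd_comm {u v : (ptdValue A).obj (op (halfSmash k U.space))} (h : SameEval u v) :
    loopAdd u v h = loopAdd v u h.symm := by
  obtain ⟨w, rfl, rfl⟩ := exists_pair_representation h
  have hb := sameBase_amalgamIncl k U true false
  rw [loopAdd_eq hb w h rfl rfl, loopAdd_eq hb.symm w h.symm rfl rfl, loopMul_comm]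

theorem loopAdd_assoc {u v w : (ptdValue A).obj (op (halfSmash k U.space))} (h : SameEval u v)
    (h' : SameEval v w) (h1 : SameEval (loopAdd u v h) w) (h2 : SameEval u (loopAdd v w h')) :
    loopAdd (loopAdd u v h) w h1 = loopAdd u (loopAdd v w h') h2 := by
  -- Three loops require an amalgam of three copies, indexed by `Option Bool`.
  obtain ⟨z, hz⟩ := exists_representation
    (fun t : Option Bool => t.elim u fun b => cond b v w) (by
      have h3 := h.trans h'
      rintro (_ | _ | _) (_ | _ | _)
      exacts [rfl, h3, h, h3.symm, rfl, h'.symm, h.symm, h', rfl])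
  have hu : _ = u := hz none
  have hv : _ = v := hz (some true)
  have hw : _ = w := hz (some false)
  have b1 := sameBase_amalgamIncl k U (none : Option Bool) (some true)
  have b2 := sameBase_amalgamIncl k U (some true) (some false)
  have c1 : SameBase (loopMul _ _ b1) (amalgamIncl k U (some false)) := b1.loopMul (b1.trans b2)
  have c2 : SameBase (amalgamIncl k U none) (loopMul _ _ b2) := b1.trans (incl_loopMul b2).symm
  rw [loopAdd_eq c1 z h1 (loopAdd_eq b1 z h hu hv).symm hw,
    loopAdd_eq c2 z h2 hu (loopAdd_eq b2 z h' hv hw).symm, loopMul_assoc b1 b2 c1 c2]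

theorem loopAdd_constLoop (u : (ptdValue A).obj (op (halfSmash k U.space))) :
    loopAdd u (constLoop u) (sameEval_constLoop u) = u := by
  rw [loopAdd_eq (sameBase_baseLoops (𝟙 _)) u _ (presheaf_map_id _ _) (constLoop_eq u),
    loopMul_baseLoops, presheaf_map_id]

theorem exists_loopAdd_eq_constLoop (u : (ptdValue A).obj (op (halfSmash k U.space))) :
    ∃ (v : (ptdValue A).obj (op (halfSmash k U.space))) (h : SameEval u v),
      loopAdd u v h = constLoop u := by
  obtain ⟨b, hb, e⟩ := exists_loopMul_eq_baseLoops (𝟙 (halfSmash k U.space))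
  have h := hb.sameEval u
  rw [presheaf_map_id] at h
  refine ⟨_, h, ?_⟩
  rw [loopAdd_eq hb u h (presheaf_map_id _ _) rfl, e, constLoop_eq]

end LoopAdd

/-! ### The loop modules -/

section LoopModule

variable {k : ℕ} {A : PiAlg 1 ⊤}

theorem sameEval_iff {U : SphereWedge 1 ⊤} (u v : (ptdValue A).obj (op (halfSmash k U.space))) :
    SameEval u v ↔ freeLoops.eval k A U u = freeLoops.eval k A U v := by
  rw [SameEval, ← (ptdValueEquiv A U).injective.eq_iff, ptdValueEquiv_map, ptdValueEquiv_map]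
  rfl

theorem const_eval {U : SphereWedge 1 ⊤} (u : (ptdValue A).obj (op (halfSmash k U.space))) :
    freeLoops.const k A U (freeLoops.eval k A U u) = constLoop u := by
  have h : (ptdValue A).map (halfSmashIncl k U.space).op u =
      (ptdValueEquiv A U).symm (freeLoops.eval k A U u) := by
    rw [Equiv.eq_symm_apply, ptdValueEquiv_map]
    rfl
  rw [constLoop, h]
  rfl

theorem eval_const {U : SphereWedge 1 ⊤} (x : A.obj.obj (op U)) :
    freeLoops.eval k A U (freeLoops.const k A U x) = x := by
  have h := presheaf_map_map (ptdValue A) (halfSmashIncl k U.space) (halfSmashProj k U.space)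
    ((ptdValueEquiv A U).symm x)
  rw [halfSmashIncl_proj, presheaf_map_id] at h
  have h' := congrArg (ptdValueEquiv A U) h
  rw [ptdValueEquiv_map, Equiv.apply_symm_apply] at h'
  exact h'

variable (k A)

theorem eval_naturality {U V : SphereWedge 1 ⊤} (f : U ⟶ V) (φ : (freeLoops k A).obj (op V)) :
    freeLoops.eval k A U ((freeLoops k A).map f.op φ) =
      A.obj.map f.op (freeLoops.eval k A V φ) := by
  let φ' : (ptdValue A).obj (op (halfSmash k V.space)) := φ
  refine (ptdValueEquiv_map A (halfSmashIncl k U.space)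
    ((ptdValue A).map (halfSmashHom k (ptdHom f)).op φ')).symm.trans ?_
  rw [presheaf_map_map, halfSmashIncl_naturality, ← presheaf_map_map, ptdValueEquiv_naturality,
    ptdValueEquiv_map]
  rfl

variable [NeZero k]

theorem ext_sphereCell {d : Dim 1 ⊤} {u v : (ptdValue A).obj (op (halfSmash k (wedgeSphere d.1)))}
    (h1 : (ptdValue A).map (halfSmashIncl k (wedgeSphere d.1)).op u =
      (ptdValue A).map (halfSmashIncl k (wedgeSphere d.1)).op v)
    (h2 : (ptdValue A).map (topCell k d.1).op u = (ptdValue A).map (topCell k d.1).op v) : u = v :=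
  (sphereContinuous_ptdValue A _ _ (isSphereCoproduct_sphereCell k d)).1 (funext fun t => by
    cases t
    exacts [h1, h2])

/-- The cells of the half-smash product with `U` are those of the half-smash products with the
summands, and the value of `A` is the product over the cells. -/
theorem sendsWedgesToProducts_freeLoops : SendsWedgesToProducts 1 ⊤ (freeLoops k A) := by
  intro U
  have e1 : ∀ (x : (ptdValue A).obj (op (halfSmash k U.space))) (j : Fin U.card),
      (ptdValue A).map (cell k U (Sum.inl j)).op x =
        (ptdValue A).map (halfSmashIncl k (wedgeSphere (U.dim j).1)).op
          ((ptdValue A).map (halfSmashHom k (summandHom U j)).op x) := fun x j => by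
    rw [presheaf_map_map, halfSmashIncl_naturality]
    rfl
  have e2 : ∀ (x : (ptdValue A).obj (op (halfSmash k U.space))) (j : Fin U.card),
      (ptdValue A).map (cell k U (Sum.inr j)).op x = (ptdValue A).map (topCell k (U.dim j).1).op
        ((ptdValue A).map (halfSmashHom k (summandHom U j)).op x) := fun x j =>
    (presheaf_map_map _ _ _ _).symm
  have hU := sphereContinuous_ptdValue A _ _ (isSphereCoproduct_cell k U)
  constructor
  · intro x y h
    have h : ∀ j, (ptdValue A).map (halfSmashHom k (summandHom U j)).op x =
      (ptdValue A).map (halfSmashHom k (summandHom U j)).op y := fun j => congrFun h j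
    refine hU.1 (funext fun i => ?_)
    rcases i with j | j
    · exact (e1 x j).trans ((congrArg _ (h j)).trans (e1 y j).symm)
    · exact (e2 x j).trans ((congrArg _ (h j)).trans (e2 y j).symm)
  · intro y
    let y' (j : Fin U.card) : (ptdValue A).obj (op (halfSmash k (wedgeSphere (U.dim j).1))) := y j
    obtain ⟨x, hx⟩ := hU.2 fun
      | Sum.inl j => (ptdValue A).map (halfSmashIncl k (wedgeSphere (U.dim j).1)).op (y' j)
      | Sum.inr j => (ptdValue A).map (topCell k (U.dim j).1).op (y' j)
    refine ⟨x, funext fun j => ext_sphereCell k A (d := U.dim j) ?_ ?_⟩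
    · exact (e1 x j).symm.trans (congrFun hx (Sum.inl j))
    · exact (e2 x j).symm.trans (congrFun hx (Sum.inr j))

/-- The underlying algebra of the loop module. -/
def loopAlg : PiAlg 1 ⊤ := ⟨freeLoops k A, sendsWedgesToProducts_freeLoops k A⟩

/-- Evaluation at the base point, as a morphism of algebras. -/
def loopProj : loopAlg k A ⟶ A :=
  ObjectProperty.homMk
    { app := fun U => TypeCat.ofHom fun φ => freeLoops.eval k A U.unop φ
      naturality := fun V U f => by
        ext φ
        exact eval_naturality k A f.unop φ }

variable {k A}

theorem Fiber.sameEval {U : SphereWedge 1 ⊤} {x : A.obj.obj (op U)}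
    (e e' : Fiber (loopProj k A) U x) : SameEval (k := k) (A := A) (U := U) e.1 e'.1 :=
  (sameEval_iff _ _).2 (e.2.trans e'.2.symm)

variable (k A)

/-- The sum of two loops with a given base point. -/
def fiberAdd {U : SphereWedge 1 ⊤} {x : A.obj.obj (op U)} (e e' : Fiber (loopProj k A) U x) :
    Fiber (loopProj k A) U x :=
  ⟨loopAdd (k := k) (A := A) (U := U) e.1 e'.1 (e.sameEval e'),
    ((sameEval_iff _ _).1 (eval_loopAdd (k := k) (A := A) (U := U) (e.sameEval e'))).trans e.2⟩

/-- The constant loop at a given base point. -/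
def fiberZero (U : SphereWedge 1 ⊤) (x : A.obj.obj (op U)) : Fiber (loopProj k A) U x :=
  ⟨freeLoops.const k A U x, eval_const x⟩

section

variable {U : SphereWedge 1 ⊤} {x : A.obj.obj (op U)} (e e' e'' : Fiber (loopProj k A) U x)

theorem fiberZero_val :
    (fiberZero k A U x).1 = constLoop (k := k) (A := A) (U := U) e.1 :=
  (congrArg (freeLoops.const k A U) e.2.symm).trans (const_eval _)

theorem fiberAdd_comm : fiberAdd k A e e' = fiberAdd k A e' e :=
  Subtype.ext (loopAdd_comm (k := k) (A := A) (U := U) (e.sameEval e'))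

theorem fiberAdd_assoc :
    fiberAdd k A (fiberAdd k A e e') e'' = fiberAdd k A e (fiberAdd k A e' e'') :=
  Subtype.ext (loopAdd_assoc (k := k) (A := A) (U := U) (e.sameEval e') (e'.sameEval e'')
    (Fiber.sameEval (fiberAdd k A e e') e'') (e.sameEval (fiberAdd k A e' e'')))

theorem fiberAdd_eq_of_val {v : (ptdValue A).obj (op (halfSmash k U.space))}
    (h : SameEval (k := k) (A := A) (U := U) e.1 v) (he' : e'.1 = v) :
    (fiberAdd k A e e').1 = loopAdd (k := k) (A := A) (U := U) e.1 v h := by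
  subst he'
  rfl

theorem fiberAdd_zero : fiberAdd k A e (fiberZero k A U x) = e :=
  Subtype.ext ((fiberAdd_eq_of_val k A e _ (sameEval_constLoop (k := k) (A := A) (U := U) e.1)
    (fiberZero_val k A e)).trans (loopAdd_constLoop (k := k) (A := A) (U := U) e.1))

theorem exists_fiberAdd_eq_zero : ∃ e', fiberAdd k A e' e = fiberZero k A U x := by
  obtain ⟨v, hv, h⟩ := exists_loopAdd_eq_constLoop (k := k) (A := A) (U := U) e.1
  refine ⟨⟨v, ((sameEval_iff _ _).1 hv).symm.trans e.2⟩, (fiberAdd_comm k A _ _).trans ?_⟩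
  exact Subtype.ext (h.trans (fiberZero_val k A e).symm)

end

/-- The group structure on the loops with a given base point. -/
@[reducible]
def loopFiberGroup (U : SphereWedge 1 ⊤) (x : A.obj.obj (op U)) :
    AddCommGroup (Fiber (loopProj k A) U x) :=
  letI : Add (Fiber (loopProj k A) U x) := ⟨fiberAdd k A⟩
  letI : Zero (Fiber (loopProj k A) U x) := ⟨fiberZero k A U x⟩
  letI : Neg (Fiber (loopProj k A) U x) := ⟨fun e => (exists_fiberAdd_eq_zero k A e).choose⟩
  letI : AddGroup (Fiber (loopProj k A) U x) :=
    AddGroup.ofLeftAxioms (fiberAdd_assoc k A)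
      (fun e => (fiberAdd_comm k A _ e).trans (fiberAdd_zero k A e))
      (fun e => (exists_fiberAdd_eq_zero k A e).choose_spec)
  { add_comm := fiberAdd_comm k A }

/-- The loop module. -/
def loopModule : BeckModule A where
  total := loopAlg k A
  proj := loopProj k A
  group := loopFiberGroup k A
  map_add {U V} f {_} e e' := Subtype.ext (map_loopAdd (k := k) (A := A) (U := U) (V := V)
    (e.sameEval e') (ptdHom f))

theorem isLoopModule_loopModule : IsLoopModule k (loopModule k A) :=
  ⟨Iso.refl _, fun _ _ => rfl, fun _ _ => rfl⟩

end LoopModule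

theorem exists_isLoopModule (k : ℕ) (hk : 1 ≤ k) (A : PiAlg 1 ⊤) :
    ∃ N : BeckModule A, IsLoopModule k N :=
  haveI : NeZero k := ⟨Nat.one_le_iff_ne_zero.1 hk⟩
  ⟨loopModule k A, isLoopModule_loopModule k A⟩

/-- An element over a fixed base point is determined by its value on the top cell, which lies in
`A(S^(k+d))`. -/
theorem IsLoopModule.isTruncated {n k : ℕ} (hk : 1 ≤ k) {A : PiAlg 1 ⊤} (hA : IsTruncated n A)
    {N : BeckModule A} (hN : IsLoopModule k N) : N.IsTruncated (n - k) := by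
  have : NeZero k := ⟨Nat.one_le_iff_ne_zero.1 hk⟩
  intro d hd z
  obtain ⟨e, he, -⟩ := hN
  -- Subtraction is truncated, but `n - k < d` still gives `n < k + d` when `k > n`.
  have hs : Subsingleton (A.obj.obj (op (SphereWedge.sphere (shiftDim k d)))) :=
    hA _ (by change n < k + d.1; omega)
  have hs' : Subsingleton ((ptdValue A).obj (op (wedgeSphere (k + d.1)))) :=
    (ptdValueEquiv A (SphereWedge.sphere (shiftDim k d))).subsingleton
  have hsurj : Function.Surjective (e.hom.app (op (SphereWedge.sphere d))) :=
    ((isIso_iff_bijective _).1 inferInstance).2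
  refine ⟨fun x y => Subtype.ext ?_⟩
  obtain ⟨u, hu⟩ := hsurj x.1
  obtain ⟨v, hv⟩ := hsurj y.1
  have huv : freeLoops.eval k A (SphereWedge.sphere d) u =
      freeLoops.eval k A (SphereWedge.sphere d) v := by
    rw [← he, ← he, hu, hv, x.2, y.2]
  rw [← hu, ← hv]
  refine congrArg _ (ext_sphereCell k A (d := d) ((sameEval_iff _ _).2 huv) ?_)
  exact Subsingleton.elim _ _

end PiAlgebra

end

end

/-! ### Assembly of the proposition -/

open PiAlgebra CategoryTheory in
theorem proposition4p14 (m n : ℕ) :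
    -- `P_n` and `C_m` are the Postnikov truncation and the connected cover
    ((IsReflectionOnto (truncation 1 n) (IsTruncated n) ∧
      IsReflectionOnto (truncation (m + 1) n) (IsTruncated n)) ∧
     (IsCoreflectionOnto (cover m ⊤) (IsConnected m) ∧
      IsCoreflectionOnto (cover m n) (IsConnected m))) ∧
    ∀ A : PiAlg 1 ⊤, IsConnected m A →
      -- Quillen cohomology is defined for the four objects of the square
      (Nonempty (CofibrantReplacement A) ∧
       Nonempty (CofibrantReplacement ((truncation 1 n).obj A)) ∧
       Nonempty (CofibrantReplacement ((cover m ⊤).obj A)) ∧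
       Nonempty (CofibrantReplacement ((truncation (m + 1) n).obj ((cover m ⊤).obj A)))) ∧
      -- the square of comparison isomorphisms
      (∀ M : BeckModule A, M.IsTruncated n →
        ∀ (C : CofibrantReplacement A)
          (Cn : CofibrantReplacement ((truncation 1 n).obj A))
          (Cm : CofibrantReplacement ((cover m ⊤).obj A))
          (Cmn : CofibrantReplacement ((truncation (m + 1) n).obj ((cover m ⊤).obj A)))
          (q : ℕ),
        (∃! t, IsTruncationMap C Cn M q t) ∧
        (∃! t', IsTruncationMap Cm Cmn (M.restrict (Nat.le_add_left 1 m) le_rfl) q t') ∧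
        (∃! c, IsCoverMap C Cm M q c) ∧
        (∃! c', IsCoverMap (m := m) Cn Cmn (M.restrict le_rfl le_top) q c') ∧
        ∀ t t' c c', IsTruncationMap C Cn M q t →
          IsTruncationMap Cm Cmn (M.restrict (Nat.le_add_left 1 m) le_rfl) q t' →
          IsCoverMap C Cm M q c →
          IsCoverMap (m := m) Cn Cmn (M.restrict le_rfl le_top) q c' →
          IsIso t ∧ IsIso t' ∧ IsIso c ∧ IsIso c' ∧ t ≫ c = c' ≫ t') ∧
      -- the consequence for the loop modules
      (IsTruncated n A → ∀ k : ℕ, 1 ≤ k →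
        (∃ N : BeckModule A, IsLoopModule k N) ∧
        ∀ N : BeckModule A, IsLoopModule k N → N.IsTruncated (n - k) ∧
          ∀ (C : CofibrantReplacement A)
            (Cn : CofibrantReplacement ((truncation 1 (n - k)).obj A))
            (Cm : CofibrantReplacement ((cover m ⊤).obj A))
            (Cmn : CofibrantReplacement
              ((truncation (m + 1) (n - k)).obj ((cover m ⊤).obj A)))
            (q : ℕ),
          ∃ φ : HQ C N q ≅
              HQ Cmn ((N.restrict (Nat.le_add_left 1 m) le_rfl).restrict le_rfl le_top) q,
            ∀ t t' c c', IsTruncationMap C Cn N q t →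
              IsTruncationMap Cm Cmn (N.restrict (Nat.le_add_left 1 m) le_rfl) q t' →
              IsCoverMap C Cm N q c →
              IsCoverMap (m := m) Cn Cmn (N.restrict le_rfl le_top) q c' →
              t ≫ φ.hom = c' ∧ φ.hom ≫ t' = c) := by
  refine ⟨⟨⟨truncation_isReflectionOnto _ _, truncation_isReflectionOnto _ _⟩,
    ⟨cover_isCoreflectionOnto _ _, cover_isCoreflectionOnto _ _⟩⟩, fun A hA =>
    ⟨⟨nonempty_cofibrantReplacement _, nonempty_cofibrantReplacement _,
      nonempty_cofibrantReplacement _, nonempty_cofibrantReplacement _⟩, ?_, ?_⟩⟩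
  · intro M hM C Cn Cm Cmn q
    exact comparison_isos hA hM C Cn Cm Cmn q
  · intro hA' k hk
    refine ⟨exists_isLoopModule k hk A, fun N hN => ⟨hN.isTruncated hk hA', ?_⟩⟩
    intro C Cn Cm Cmn q
    exact exists_comparison_iso hA (hN.isTruncated hk hA') C Cn Cm Cmn q
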